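/- **Setting.** Let $K\ge 3$ actions be indexed by $\mathbb Z/K$, with angles $\theta_j=2\pi j/K$ and Fourier vectors $\varphi_m=(\cos m\theta_j)_j$, $\psi_m=(\sin m\theta_j)_j$. Let $A_{jl}=c(j-l)$ be a real symmetric circulant matrix with eigenvalues $\lambda_m=\sum_j c(j)\cos(m\theta_j)$ on $\mathrm{span}\{\varphi_m,\psi_m\}$. Assume there is an index $0<k_\star<K/2$, $4k_\star\neq K$, with $\lambda_{k_\star}>0$ and $\lambda_m<\lambda_{k_\star}$ for all $0\le m\le K/2$, $m\ne k_\star$. Let $S:\mathbb R\to\mathbb R$ be odd and $C^3$ with $S'(0)=1$ and $s_3=S'''(0)\neq0$, let $d,\tau>0$, and put $F(z,\alpha,b)=-dz+S(\alpha Az+b)$ ($S$ acting componentwise), where $b\in\mathbb R^K$ is the evidence of one agent, whose decision dynamics is $\tau\dot z=F(z,\alpha,b)$. Let $\alpha_c=d/\lambda_{k_\star}$, $\mu=-d+\alpha\lambda_{k_\star}$, $\sigma_m=-d+\alpha_c\lambda_m$, $E_c=\mathrm{span}\{\varphi_{k_\star},\psi_{k_\star}\}$, $E_s=E_c^\perp$,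 and let $\Psi_A$ be the orthogonal projection onto $E_c$. Put $e_\theta=\sqrt2(\cos\theta\,\varphi_{k_\star}+\sin\theta\,\psi_{k_\star})$, $\langle u,v\rangle=\frac1K\sum_ju_jv_j$, $\Gamma=\frac{s_3}{4}\alpha_c^3\lambda_{k_\star}^3$, $\eta=\frac{s_3}{4}\alpha_c^2\lambda_{k_\star}^2$. Let $a_m,\beta_m$ be the Fourier coefficients in $b_j=a_0+\sum_m(a_m\cos m\theta_j+\beta_m\sin m\theta_j)$ (defined by the same sums, with $\cos m\theta_j,\sin m\theta_j$ depending on $m$ modulo $K$ only, for $m>K/2$), $A^b_m=\sqrt{a_m^2+\beta_m^2}$ and $\theta^b_m=\operatorname{atan2}(\beta_m,a_m)$. A state $z$ selects the actions $\arg\max_j z_j$, and $\mathrm{BR}^A(b)=\arg\max_j[\Psi_A(b)]_j$. For $\delta>0$, call $b$ $\delta$-decisive if $[\Psi_A(b)]_j+\delta A^b_{k_\star}\le\max_l[\Psi_A(b)]_l$ for every $j\notin \mathrm{BR}^A(b)$. (Every $b$ with $\Psi_A(b)\ne0$ is $\delta$-decisive for some $\delta>0$.) Define $$g_r=\mu r+\Gamma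 r^3+\tfrac{A^b_{k_\star}}{\sqrt2}\cos(\theta-\theta^b_{k_\star})+\tfrac{\eta r^2}{\sqrt2}\big[3A^b_{k_\star}\cos(\theta-\theta^b_{k_\star})+A^b_{3k_\star}\cos(3\theta-\theta^b_{3k_\star})\big],$$ $$g_\theta=\tfrac{A^b_{k_\star}}{\sqrt2}\sin(\theta^b_{k_\star}-\theta)+\tfrac{\eta r^2}{\sqrt2}\big[3A^b_{k_\star}\sin(\theta^b_{k_\star}-\theta)+A^b_{3k_\star}\sin(\theta^b_{3k_\star}-3\theta)\big].$$ **Claim.** 1. *(Only $\Psi_A(b)$ enters at leading order.)* For $(v,\alpha,b)$, $v\in E_c$, in a neighbourhood of $(0,\alpha_c,0)$, the range equation $(I-\Psi_A)F(v+w,\alpha,b)=0$ has a unique small solution $w=W(v,\alpha,b)\in E_s$. For the reduced map $G(v,\alpha,b)=\Psi_AF(v+W(v,\alpha,b),\alpha,b)$ there is a constant $C$ such that for every $\varepsilon>0$, for all sufficiently small $r\ge0$, $|\alpha-\alpha_c|$, $\|b\|$ and all $\theta$, $$\big\|G(re_\theta,\alpha,b)-\big[(\mu r+\Gamma r^3)e_\theta+\Psi_A(b)\big]\big\|\le\varepsilon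 r^3+C\big(\|b\|r^2+\|b\|^2r+\|b\|^3\big),$$ and, with the same bound on the error, $\langle G(re_\theta,\alpha,b),e_\theta\rangle\approx g_r$ and $\langle G(re_\theta,\alpha,b),e_{\theta+\pi/2}\rangle\approx g_\theta$. 2. *(Angular equation.)* For every $\delta>0$ there is $\rho>0$ such that for all $0<r<\rho$ and all $b$ with $3A^b_{k_\star}>A^b_{3k_\star}$: the equation $g_\theta=0$ has exactly one solution modulo $2\pi$ with $\partial_\theta g_\theta<0$ (the locally stable phase $\theta^\star$), and if $b$ is $\delta$-decisive, then every action selected by $re_{\theta^\star}$ belongs to $\mathrm{BR}^A(b)$. 3. *(Decision dynamics.)* For all $\kappa,M,\delta>0$ there are $R,\rho>0$ such that for all $\alpha,b$ with $|\alpha-\alpha_c|<\rho$, $\|b\|<\rho$, $3A^b_{k_\star}>A^b_{3k_\star}$, $A^b_m\le\kappa|\sigma_m|A^b_{k_\star}$ for all $0\le m\le K/2$, $m\neq k_\star$ (suppression), and $\mu^3\le M(A^b_{k_\star})^2$: if $s_3<0$, then $\tau\dot z=F(z,\alpha,b)$ has an equilibrium $z$ with $\|z\|<R$ that is locally stable (all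 eigenvalues of its Jacobian have negative real part); and, for either sign of $s_3$, if $b$ is $\delta$-decisive, then every action selected by any locally stable equilibrium $z$ with $\|z\|<R$ belongs to $\mathrm{BR}^A(b)$. -/

import Mathlib

namespace NOD

open Real

/-- Decision states and evidence vectors: real vectors indexed by the ring of `K` actions. -/
abbrev State (K : ℕ) [NeZero K] : Type := EuclideanSpace ℝ (ZMod K)

variable {K : ℕ} [NeZero K]

/-- Sector angle `θ_j = 2πj/K`. -/
noncomputable def sector (j : ZMod K) : ℝ := 2 * π * (j.val : ℝ) / (K : ℝ)

/-- The Fourier vector `φ_m = (cos (m θ_j))_j`. -/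
noncomputable def cosMode (m : ℕ) : State K :=
  WithLp.toLp 2 fun j => cos ((m : ℝ) * sector j)

/-- The Fourier vector `ψ_m = (sin (m θ_j))_j`. -/
noncomputable def sinMode (m : ℕ) : State K :=
  WithLp.toLp 2 fun j => sin ((m : ℝ) * sector j)

/-- The eigenvalue `λ_m` of the symmetric circulant matrix with profile `c` on the mode
`span {φ_m, ψ_m}`. -/
noncomputable def eigenvalue (c : ZMod K → ℝ) (m : ℕ) : ℝ :=
  ∑ j, c j * cos ((m : ℝ) * sector j)

/-- Normalization of the `m`-th Fourier coefficient: `1/K` for the self-conjugate modes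
(`m ≡ 0` or `m ≡ K/2` modulo `K`), and `2/K` otherwise. -/
noncomputable def fourierWeight (K m : ℕ) : ℝ := if K ∣ 2 * m then 1 / (K : ℝ) else 2 / (K : ℝ)

/-- The coefficient `a_m` in `b_j = a_0 + ∑_m (a_m cos (m θ_j) + β_m sin (m θ_j))`. -/
noncomputable def cosCoeff (b : State K) (m : ℕ) : ℝ :=
  fourierWeight K m * ∑ j, b j * cos ((m : ℝ) * sector j)

/-- The coefficient `β_m` in `b_j = a_0 + ∑_m (a_m cos (m θ_j) + β_m sin (m θ_j))`. -/
noncomputable def sinCoeff (b : State K) (m : ℕ) : ℝ :=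
  fourierWeight K m * ∑ j, b j * sin ((m : ℝ) * sector j)

/-- Amplitude `A_m^b` of the evidence at mode `m`. -/
noncomputable def amplitude (b : State K) (m : ℕ) : ℝ :=
  √(cosCoeff b m ^ 2 + sinCoeff b m ^ 2)

/-- Phase `θ_m^b = atan2 (β_m, a_m)` of the evidence at mode `m`. -/
noncomputable def phase (b : State K) (m : ℕ) : ℝ :=
  Complex.arg ⟨cosCoeff b m, sinCoeff b m⟩

/-- The critical subspace `E_c = span {φ_k, ψ_k}`; its orthogonal complement is `E_s`. -/
noncomputable def criticalSpace (K : ℕ) [NeZero K] (k : ℕ) : Submodule ℝ (State K) :=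
  Submodule.span ℝ {cosMode k, sinMode k}

/-- `Ψ_A`: orthogonal projection onto the critical subspace. -/
noncomputable def proj (k : ℕ) (b : State K) : State K :=
  (criticalSpace K k).starProjection b

/-- The geometry-aware best response `argmax_a [Ψ_A b]_a`, as a set of actions. -/
def bestResponse (k : ℕ) (b : State K) : Set (ZMod K) :=
  {a | ∀ j, proj k b j ≤ proj k b a}

/-- The action `a` is selected by the decision state `z`: it has the largest preference. -/
def Selects (z : State K) (a : ZMod K) : Prop := ∀ j, z j ≤ z a

/-- `F(z, α, b) = -d z + S(α A z + b)`, where `A` is the circulant matrix with profile `c` and `S`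
acts componentwise. -/
noncomputable def vectorField (S : ℝ → ℝ) (d : ℝ) (c : ZMod K → ℝ) (α : ℝ) (b z : State K) :
    State K :=
  WithLp.toLp 2 fun j => -d * z j + S (α * ((Matrix.circulant c).mulVec z.ofLp) j + b j)

/-- `z` is a locally (exponentially) stable equilibrium of `ż = f z`: an equilibrium at which all
complex eigenvalues of the Jacobian matrix have negative real part. -/
def IsStableEquilibrium (f : State K → State K) (z : State K) : Prop :=
  f z = 0 ∧ DifferentiableAt ℝ f z ∧
    ∀ x ∈ spectrum ℂ ((LinearMap.toMatrix (EuclideanSpace.basisFun (ZMod K) ℝ).toBasis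
      (EuclideanSpace.basisFun (ZMod K) ℝ).toBasis
      (fderiv ℝ f z : State K →ₗ[ℝ] State K)).map (algebraMap ℝ ℂ)), x.re < 0

/-- Critical gain `α_c = d / λ_k`. -/
noncomputable def criticalGain (d : ℝ) (c : ZMod K → ℝ) (k : ℕ) : ℝ := d / eigenvalue c k

/-- Distance from the bifurcation, `μ = -d + α λ_k`. -/
noncomputable def onset (d : ℝ) (c : ZMod K → ℝ) (k : ℕ) (α : ℝ) : ℝ := -d + α * eigenvalue c k

/-- Eigenvalue `σ_m = -d + α_c λ_m` of the linearization at onset. -/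
noncomputable def stableEigenvalue (d : ℝ) (c : ZMod K → ℝ) (k m : ℕ) : ℝ :=
  -d + criticalGain d c k * eigenvalue c m

/-- `e_θ = √2 (cos θ φ_k + sin θ ψ_k)`. -/
noncomputable def direction (k : ℕ) (θ : ℝ) : State K :=
  √2 • (cos θ • cosMode k + sin θ • sinMode k)

/-- The normalized inner product `⟨u, v⟩ = (1/K) ∑_j u_j v_j`. -/
noncomputable def pairing (u v : State K) : ℝ := (1 / (K : ℝ)) * ∑ j, u j * v j

/-- `Γ = (s₃/4) α_c³ λ_k³`, with `s₃ = S'''(0)`. -/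
noncomputable def cubicCoeff (S : ℝ → ℝ) (d : ℝ) (c : ZMod K → ℝ) (k : ℕ) : ℝ :=
  iteratedDeriv 3 S 0 / 4 * criticalGain d c k ^ 3 * eigenvalue c k ^ 3

/-- `η = (s₃/4) α_c² λ_k²`, with `s₃ = S'''(0)`. -/
noncomputable def mixedCoeff (S : ℝ → ℝ) (d : ℝ) (c : ZMod K → ℝ) (k : ℕ) : ℝ :=
  iteratedDeriv 3 S 0 / 4 * criticalGain d c k ^ 2 * eigenvalue c k ^ 2

/-- Right-hand side `g_r` of the polar radial equation. -/
noncomputable def polarRadial (S : ℝ → ℝ) (d : ℝ) (c : ZMod K → ℝ) (k : ℕ) (α : ℝ) (b : State K)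
    (r θ : ℝ) : ℝ :=
  onset d c k α * r + cubicCoeff S d c k * r ^ 3
    + amplitude b k / √2 * cos (θ - phase b k)
    + mixedCoeff S d c k * r ^ 2 / √2 *
      (3 * amplitude b k * cos (θ - phase b k)
        + amplitude b (3 * k) * cos (3 * θ - phase b (3 * k)))

/-- Right-hand side `g_θ` of the polar angular equation (it vanishes when `b = 0`, since then both
amplitudes do). -/
noncomputable def polarAngular (S : ℝ → ℝ) (d : ℝ) (c : ZMod K → ℝ) (k : ℕ) (b : State K)
    (r θ : ℝ) : ℝ :=
  amplitude b k / √2 * sin (phase b k - θ)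
    + mixedCoeff S d c k * r ^ 2 / √2 *
      (3 * amplitude b k * sin (phase b k - θ)
        + amplitude b (3 * k) * sin (phase b (3 * k) - 3 * θ))

/-- `θ` is a locally stable equilibrium of the polar angular equation at amplitude `r`. -/
def IsStablePhase (S : ℝ → ℝ) (d : ℝ) (c : ZMod K → ℝ) (k : ℕ) (b : State K) (r θ : ℝ) : Prop :=
  polarAngular S d c k b r θ = 0 ∧ deriv (polarAngular S d c k b r) θ < 0

/-- Suppression of noncritical evidence: relative to the critical evidence, the evidence at
every noncritical mode `m` is at most `κ |σ_m|`. -/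
def Suppressed (d : ℝ) (c : ZMod K → ℝ) (k : ℕ) (κ : ℝ) (b : State K) : Prop :=
  ∀ m ≤ K / 2, m ≠ k → amplitude b m ≤ κ * |stableEigenvalue d c k m| * amplitude b k

/-- The actions that are not best responses fall short of the best one by at least the fraction
`δ` of the amplitude of the projected evidence. For each `b` with `Ψ_A b ≠ 0` this holds for some
`δ > 0`, and it depends on `b` only up to a positive factor. -/
def Decisive (k : ℕ) (δ : ℝ) (b : State K) : Prop :=
  ∀ a ∈ bestResponse k b, ∀ j ∉ bestResponse k b, proj k b j + δ * amplitude b k ≤ proj k b a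

/-- `W` is a Lyapunov–Schmidt reduction map near `(0, α_c, 0)`: for parameters and `v ∈ E_c` of
size less than `ρ`, `W v α b` is the unique `w ∈ E_s` with `‖w‖ < ρ'` that solves the range
equation `(1 - Ψ_A) F(v + w, α, b) = 0`. -/
def IsReductionMap (S : ℝ → ℝ) (d : ℝ) (c : ZMod K → ℝ) (k : ℕ)
    (W : State K → ℝ → State K → State K) (ρ ρ' : ℝ) : Prop :=
  ∀ v ∈ criticalSpace K k, ∀ (α : ℝ) (b : State K),
    ‖v‖ < ρ → |α - criticalGain d c k| < ρ → ‖b‖ < ρ → ∀ w : State K,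
      (w ∈ (criticalSpace K k)ᗮ ∧ ‖w‖ < ρ' ∧
        vectorField S d c α b (v + w) - proj k (vectorField S d c α b (v + w)) = 0) ↔
      w = W v α b

/-- The reduced critical map `G(v, α, b) = Ψ_A F(v + W(v, α, b), α, b)`. -/
noncomputable def reducedMap (S : ℝ → ℝ) (d : ℝ) (c : ZMod K → ℝ) (k : ℕ)
    (W : State K → ℝ → State K → State K) (v : State K) (α : ℝ) (b : State K) : State K :=
  proj k (vectorField S d c α b (v + W v α b))

end NOD

namespace NOD

open Real Finset Filter Topology

variable {K : ℕ} [NeZero K]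

/-! ### Trigonometric sums over the ring of actions -/

/-! The Fourier modes diagonalize the symmetric circulant A. Strict dominance of λ_k makes d - αA
coercive on E_s, uniformly for α near α_c (`exists_coercive`), while on E_c it is the scalar -μ. Let
z = v + w be a small solution of the range equation, with v in E_c and w in E_s. Pairing the
equation with w and using S(x) - x = O(x³) gives w = O(‖b‖ + ‖v‖³) (`exists_range_bound`), so the
net input is d v up to small terms, and the only nonlinear contribution at leading order is the cube
of v. Since K divides neither 2k nor 4k, the quartic form ∑ v_j⁴ is isotropic on E_c, and the cube
projects to a multiple of ‖v‖² v (`proj_cube`). Hence Ψ_A F = m v + Ψ_A b + error, where m = μ +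
(Γ/K)‖v‖² (`exists_critical_expansion`). The implicit function theorem supplies W, ‖e_θ‖² = K turns
Γ/K into Γ, and the η terms of g_r and g_θ are O(‖b‖ r²), hence part of the permitted error.

For the angular equation, divide g_θ by A/√2, where A and A₃ are the amplitudes at modes k and 3k.
What remains is a sin(p - θ) + e sin(p₃ - 3θ) with a close to 1 and |e| ≤ 3|η| r², because A₃ < 3A.
Its zeros are close to p or p + π, only those near p are descending, and the deviation from p is
O(r²), too small to overcome the decisive margin.

The dynamical part works with arbitrary small equilibria and does not use W. The Jacobian -d + α
diag(S'(x_j)) A is symmetric for the inner product weighted by 1/S'(x_j), so stability is governed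
by the form Q(u) = d ∑ u_j²/S'(x_j) - α⟨u, Au⟩: stability forces Q ≥ 0, and Q > 0 off zero forces
stability. With t = ‖v‖, β = ‖Ψ_A b‖ and G = Γ/K, suppression gives ‖b‖ = O(β), the equilibrium
equation reads m v + Ψ_A b = o(t³), and on E_c one has Q(u) = -m‖u‖² - 2G⟨v, u⟩² + o(t²)‖u‖².
Testing Q ≥ 0 with u ⊥ v and with u = v bounds m and m + 2G t² above by o(t²). Together with μ³ ≤ M
A² this yields t³ ≤ C₀ β (`cube_le_of_stable`), so the error o(t³) is o(β); then m < 0 and v is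
nearly the positive multiple (t/β) Ψ_A b (`aligned_of_stable`), which selects a best response when b
is decisive.

For existence when s₃ < 0, the energy of the dynamics, written in the net input, has a quartic well
near onset. Its minimizer over a small ball is interior and gives an equilibrium with Q ≥ 0
(`exists_equilibrium`). The structure above improves this to Q > 0: on E_c because -m is at least a
multiple of t² and G < 0, on E_s by coercivity (`exists_stabilityForm_pos`). -/

lemma stdAddChar_natCast_mul (m : ℕ) (j : ZMod K) :
    ZMod.stdAddChar ((m : ZMod K) * j) = Complex.exp (((m : ℝ) * sector j : ℝ) * Complex.I) := by
  have h : ((m : ZMod K) * j) = (((m * j.val : ℕ) : ℤ) : ZMod K) := by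
    push_cast; rw [ZMod.natCast_zmod_val]
  rw [h, ZMod.stdAddChar_coe]
  congr 1
  simp only [sector]
  push_cast
  ring

lemma cos_mul_sector (m : ℕ) (j : ZMod K) :
    cos (m * sector j) = (ZMod.stdAddChar ((m : ZMod K) * j) : ℂ).re := by
  rw [stdAddChar_natCast_mul, Complex.exp_ofReal_mul_I_re]

lemma sin_mul_sector (m : ℕ) (j : ZMod K) :
    sin (m * sector j) = (ZMod.stdAddChar ((m : ZMod K) * j) : ℂ).im := by
  rw [stdAddChar_natCast_mul, Complex.exp_ofReal_mul_I_im]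

lemma stdAddChar_neg_eq_conj (x : ZMod K) :
    (ZMod.stdAddChar (-x) : ℂ) = (starRingEnd ℂ) (ZMod.stdAddChar x) := by
  rw [AddChar.map_neg_eq_conj]

lemma cos_mul_sector_neg (m : ℕ) (j : ZMod K) :
    cos (m * sector (-j)) = cos (m * sector j) := by
  rw [cos_mul_sector, cos_mul_sector, mul_neg, stdAddChar_neg_eq_conj, Complex.conj_re]

lemma sin_mul_sector_neg (m : ℕ) (j : ZMod K) :
    sin (m * sector (-j)) = -sin (m * sector j) := by
  rw [sin_mul_sector, sin_mul_sector, mul_neg, stdAddChar_neg_eq_conj, Complex.conj_im]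

lemma cos_mul_sector_add (m : ℕ) (i j : ZMod K) :
    cos (m * sector (i + j)) =
      cos (m * sector i) * cos (m * sector j) - sin (m * sector i) * sin (m * sector j) := by
  simp only [cos_mul_sector, sin_mul_sector, mul_add, AddChar.map_add_eq_mul, Complex.mul_re]

lemma sin_mul_sector_add (m : ℕ) (i j : ZMod K) :
    sin (m * sector (i + j)) =
      sin (m * sector i) * cos (m * sector j) + cos (m * sector i) * sin (m * sector j) := by
  simp only [cos_mul_sector, sin_mul_sector, mul_add, AddChar.map_add_eq_mul, Complex.mul_im]
  ring

lemma cos_mul_sector_sub (m : ℕ) (i j : ZMod K) :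
    cos (m * sector (i - j)) =
      cos (m * sector i) * cos (m * sector j) + sin (m * sector i) * sin (m * sector j) := by
  rw [sub_eq_add_neg, cos_mul_sector_add, cos_mul_sector_neg, sin_mul_sector_neg]; ring

lemma sin_mul_sector_sub (m : ℕ) (i j : ZMod K) :
    sin (m * sector (i - j)) =
      sin (m * sector i) * cos (m * sector j) - cos (m * sector i) * sin (m * sector j) := by
  rw [sub_eq_add_neg, sin_mul_sector_add, cos_mul_sector_neg, sin_mul_sector_neg]; ring

lemma cos_sub_mul_sector {m : ℕ} (hm : m ≤ K) (j : ZMod K) :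
    cos ((K - m : ℕ) * sector j) = cos (m * sector j) := by
  rw [cos_mul_sector, cos_mul_sector, Nat.cast_sub hm, ZMod.natCast_self, zero_sub, neg_mul,
    stdAddChar_neg_eq_conj, Complex.conj_re]

lemma sin_sub_mul_sector {m : ℕ} (hm : m ≤ K) (j : ZMod K) :
    sin ((K - m : ℕ) * sector j) = -sin (m * sector j) := by
  rw [sin_mul_sector, sin_mul_sector, Nat.cast_sub hm, ZMod.natCast_self, zero_sub, neg_mul,
    stdAddChar_neg_eq_conj, Complex.conj_im]

lemma sum_stdAddChar_mul {m : ℕ} (hm : ¬ K ∣ m) :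
    ∑ j : ZMod K, (ZMod.stdAddChar ((m : ZMod K) * j) : ℂ) = 0 := by
  have h := AddChar.sum_mulShift (ψ := (ZMod.stdAddChar : AddChar (ZMod K) ℂ)) (m : ZMod K)
    (ZMod.isPrimitive_stdAddChar K)
  rw [if_neg (by rwa [ZMod.natCast_eq_zero_iff])] at h
  rw [Nat.cast_zero] at h
  rw [← h]
  exact sum_congr rfl fun j _ => by rw [mul_comm]

lemma sum_cos_mul_sector {m : ℕ} (hm : ¬ K ∣ m) : ∑ j : ZMod K, cos (m * sector j) = 0 := by
  simp only [cos_mul_sector, ← Complex.re_sum, sum_stdAddChar_mul hm, Complex.zero_re]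

/-- The reflection j ↦ -j changes the sign of the sum, so no condition on m is needed, unlike for
the cosine sum. -/
lemma sum_sin_mul_sector (m : ℕ) : ∑ j : ZMod K, sin (m * sector j) = 0 := by
  have h : ∑ j : ZMod K, sin (m * sector j) = ∑ j : ZMod K, sin (m * sector (-j)) :=
    (Equiv.sum_comp (Equiv.neg (ZMod K)) fun j => sin (m * sector j)).symm
  simp only [sin_mul_sector_neg, sum_neg_distrib] at h
  linarith

/-- The dual orthogonality relation, summed over frequencies rather than actions; it is the kernel
of Fourier inversion. -/
lemma sum_range_cos_mul_sector (j : ZMod K) :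
    ∑ m ∈ range K, cos (m * sector j) = if j = 0 then (K : ℝ) else 0 := by
  have h := AddChar.sum_mulShift (ψ := (ZMod.stdAddChar : AddChar (ZMod K) ℂ)) j
    (ZMod.isPrimitive_stdAddChar K)
  have h2 : ∑ m ∈ range K, cos (m * sector j) =
      (∑ x : ZMod K, (ZMod.stdAddChar (x * j) : ℂ)).re := by
    simp only [cos_mul_sector, Complex.re_sum]
    refine sum_bij' (fun m _ => (m : ZMod K)) (fun x _ => x.val) ?_ ?_ ?_ ?_ ?_
    · simp
    · intro x _; simpa using ZMod.val_lt x
    · intro m hm; exact ZMod.val_cast_of_lt (by simpa using hm)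
    · intro x _; exact ZMod.natCast_zmod_val x
    · intro m _; rfl
  rw [h2, h]
  split_ifs <;> simp [ZMod.card]

/-! ### The circulant coupling and its spectral decomposition -/

/-- The symmetric circulant coupling as a continuous linear map. -/
noncomputable def coupling (c : ZMod K → ℝ) : State K →L[ℝ] State K :=
  Matrix.toEuclideanCLM (𝕜 := ℝ) (Matrix.circulant c)

lemma coupling_apply (c : ZMod K → ℝ) (z : State K) (j : ZMod K) :
    coupling c z j = ((Matrix.circulant c).mulVec z.ofLp) j := rfl

lemma coupling_apply_sum (c : ZMod K → ℝ) (z : State K) (j : ZMod K) :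
    coupling c z j = ∑ l, c l * z (j - l) := by
  rw [coupling_apply]
  simp only [Matrix.mulVec, dotProduct, Matrix.circulant_apply]
  exact Fintype.sum_equiv (Equiv.subLeft j) _ _ fun l => by simp

lemma state_inner (u v : State K) : inner ℝ u v = ∑ j, u j * v j := by
  simp [PiLp.inner_apply, mul_comm]

lemma norm_sq_eq_sum (u : State K) : ‖u‖ ^ 2 = ∑ j, u j ^ 2 := by
  rw [← real_inner_self_eq_norm_sq, state_inner]
  exact sum_congr rfl fun j _ => by ring

/-- Evenness of the profile removes the sine moments; this is what makes both real modes at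
frequency m eigenvectors for the same eigenvalue. -/
lemma sum_mul_sin_eq_zero {c : ZMod K → ℝ} (hc : ∀ j, c (-j) = c j) (m : ℕ) :
    ∑ j, c j * sin (m * sector j) = 0 := by
  have h : ∑ j, c j * sin (m * sector j) = ∑ j, c (-j) * sin (m * sector (-j)) :=
    (Equiv.sum_comp (Equiv.neg (ZMod K)) fun j => c j * sin (m * sector j)).symm
  simp only [sin_mul_sector_neg, hc, mul_neg, sum_neg_distrib] at h
  linarith

lemma coupling_cosMode {c : ZMod K → ℝ} (hc : ∀ j, c (-j) = c j) (m : ℕ) :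
    coupling c (cosMode m) = eigenvalue c m • cosMode m := by
  ext j
  rw [coupling_apply_sum]
  simp only [cosMode, eigenvalue, PiLp.smul_apply, smul_eq_mul, cos_mul_sector_sub]
  have := sum_mul_sin_eq_zero hc m
  calc _ = (∑ l, c l * cos (m * sector l)) * cos (m * sector j)
        + (∑ l, c l * sin (m * sector l)) * sin (m * sector j) := by
        rw [sum_mul, sum_mul, ← sum_add_distrib]; exact sum_congr rfl fun l _ => by ring
    _ = _ := by rw [this]; ring

lemma coupling_sinMode {c : ZMod K → ℝ} (hc : ∀ j, c (-j) = c j) (m : ℕ) :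
    coupling c (sinMode m) = eigenvalue c m • sinMode m := by
  ext j
  rw [coupling_apply_sum]
  simp only [sinMode, eigenvalue, PiLp.smul_apply, smul_eq_mul, sin_mul_sector_sub]
  have := sum_mul_sin_eq_zero hc m
  calc _ = (∑ l, c l * cos (m * sector l)) * sin (m * sector j)
        - (∑ l, c l * sin (m * sector l)) * cos (m * sector j) := by
        rw [sum_mul, sum_mul, ← sum_sub_distrib]; exact sum_congr rfl fun l _ => by ring
    _ = _ := by rw [this]; ring

/-- The coupling is self-adjoint. -/
lemma inner_coupling_comm {c : ZMod K → ℝ} (hc : ∀ j, c (-j) = c j) (u v : State K) :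
    inner ℝ (coupling c u) v = inner ℝ u (coupling c v) := by
  simp only [state_inner, coupling_apply, Matrix.mulVec, dotProduct, Matrix.circulant_apply,
    sum_mul, mul_sum]
  rw [sum_comm]
  refine sum_congr rfl fun i _ => sum_congr rfl fun j _ => ?_
  rw [← hc (i - j), neg_sub]; ring

/-- Discrete Fourier inversion. -/
lemma fourier_inversion (z : State K) :
    z = ∑ m ∈ range K, (1 / (K : ℝ)) •
      (inner ℝ z (cosMode m) • cosMode m + inner ℝ z (sinMode m) • sinMode m) := by
  have hK : (K : ℝ) ≠ 0 := NeZero.ne _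
  ext j
  have h : ∀ m : ℕ, ((1 / (K : ℝ)) • (inner ℝ z (cosMode m) • cosMode m
      + inner ℝ z (sinMode m) • sinMode m) : State K) j =
      ∑ l, (1 / (K : ℝ)) * z l * cos (m * sector (j - l)) := by
    intro m
    simp only [state_inner, cosMode, sinMode, PiLp.smul_apply, PiLp.add_apply, smul_eq_mul,
      cos_mul_sector_sub, sum_mul, ← sum_add_distrib, mul_sum]
    exact sum_congr rfl fun l _ => by ring
  rw [WithLp.ofLp_sum, Finset.sum_apply]
  simp only [h]
  rw [sum_comm]
  simp only [← mul_sum, sum_range_cos_mul_sector, sub_eq_zero]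
  simp
  field_simp

/-- The energy of `z` in the mode `m` of the discrete Fourier transform. -/
noncomputable def modeEnergy (z : State K) (m : ℕ) : ℝ :=
  (1 / (K : ℝ)) * (inner ℝ z (cosMode m) ^ 2 + inner ℝ z (sinMode m) ^ 2)

lemma modeEnergy_nonneg (z : State K) (m : ℕ) : 0 ≤ modeEnergy z m := by
  unfold modeEnergy; positivity

lemma norm_sq_eq_sum_modeEnergy (z : State K) : ‖z‖ ^ 2 = ∑ m ∈ range K, modeEnergy z m := by
  rw [← real_inner_self_eq_norm_sq]
  nth_rewrite 2 [fourier_inversion z]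
  rw [inner_sum]
  refine sum_congr rfl fun m _ => ?_
  rw [inner_smul_right, inner_add_right, inner_smul_right, inner_smul_right, modeEnergy]; ring

lemma inner_coupling_self {c : ZMod K → ℝ} (hc : ∀ j, c (-j) = c j) (z : State K) :
    inner ℝ z (coupling c z) = ∑ m ∈ range K, eigenvalue c m * modeEnergy z m := by
  nth_rewrite 2 [fourier_inversion z]
  rw [map_sum, inner_sum]
  refine sum_congr rfl fun m _ => ?_
  rw [map_smul, map_add, map_smul, map_smul, coupling_cosMode hc, coupling_sinMode hc,
    inner_smul_right, inner_add_right, inner_smul_right, inner_smul_right, inner_smul_right,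
    inner_smul_right, modeEnergy]
  ring

lemma modeEnergy_sub (z : State K) {m : ℕ} (hm : m ≤ K) :
    modeEnergy z (K - m) = modeEnergy z m := by
  simp only [modeEnergy, state_inner, cosMode, sinMode, cos_sub_mul_sector hm,
    sin_sub_mul_sector hm, mul_neg, sum_neg_distrib, neg_sq]

lemma eigenvalue_sub (c : ZMod K → ℝ) {m : ℕ} (hm : m ≤ K) :
    eigenvalue c (K - m) = eigenvalue c m := by
  simp only [eigenvalue, cos_sub_mul_sector hm]

lemma cosMode_mem (k : ℕ) : (cosMode k : State K) ∈ criticalSpace K k :=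
  Submodule.subset_span (by simp)

lemma sinMode_mem (k : ℕ) : (sinMode k : State K) ∈ criticalSpace K k :=
  Submodule.subset_span (by simp)

lemma mem_criticalSpace {k : ℕ} {v : State K} :
    v ∈ criticalSpace K k ↔ ∃ p q : ℝ, v = p • cosMode k + q • sinMode k := by
  rw [criticalSpace, Submodule.mem_span_pair]
  exact ⟨fun ⟨p, q, h⟩ => ⟨p, q, h.symm⟩, fun ⟨p, q, h⟩ => ⟨p, q, h.symm⟩⟩

lemma inner_eq_zero_of_mem {k : ℕ} {v w : State K} (hv : v ∈ criticalSpace K k)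
    (hw : w ∈ (criticalSpace K k)ᗮ) : inner ℝ v w = 0 := hw v hv

lemma coupling_of_mem {c : ZMod K → ℝ} (hc : ∀ j, c (-j) = c j) {k : ℕ} {v : State K}
    (hv : v ∈ criticalSpace K k) : coupling c v = eigenvalue c k • v := by
  obtain ⟨p, q, rfl⟩ := mem_criticalSpace.1 hv
  rw [map_add, map_smul, map_smul, coupling_cosMode hc, coupling_sinMode hc]
  module

lemma coupling_mem_orthogonal {c : ZMod K → ℝ} (hc : ∀ j, c (-j) = c j) {k : ℕ} {w : State K}
    (hw : w ∈ (criticalSpace K k)ᗮ) : coupling c w ∈ (criticalSpace K k)ᗮ := by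
  intro v hv
  rw [← inner_coupling_comm hc, coupling_of_mem hc hv, inner_smul_left, hw v hv, mul_zero]

/-- Spectral bound for the coupling on the whole space. -/
lemma inner_coupling_le {c : ZMod K → ℝ} (hc : ∀ j, c (-j) = c j) {k : ℕ}
    (hdom : ∀ m ≤ K / 2, m ≠ k → eigenvalue c m < eigenvalue c k) (z : State K) :
    inner ℝ z (coupling c z) ≤ eigenvalue c k * ‖z‖ ^ 2 := by
  have hle : ∀ m ≤ K / 2, eigenvalue c m ≤ eigenvalue c k := fun m hm => by
    by_cases h : m = k
    · rw [h]
    · exact (hdom m hm h).le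
  rw [inner_coupling_self hc, norm_sq_eq_sum_modeEnergy, mul_sum]
  refine sum_le_sum fun m hm => mul_le_mul_of_nonneg_right ?_ (modeEnergy_nonneg z m)
  have hmK : m < K := by simpa using hm
  by_cases h : m ≤ K / 2
  · exact hle m h
  · rw [← eigenvalue_sub c hmK.le]; exact hle _ (by omega)

/-- Spectral gap of the coupling on the complement of the critical space. -/
lemma exists_spectral_gap {c : ZMod K → ℝ} (hc : ∀ j, c (-j) = c j) {k : ℕ}
    (hdom : ∀ m ≤ K / 2, m ≠ k → eigenvalue c m < eigenvalue c k) :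
    ∃ g > 0, ∀ w ∈ (criticalSpace K k)ᗮ,
      inner ℝ w (coupling c w) ≤ (eigenvalue c k - g) * ‖w‖ ^ 2 := by
  obtain ⟨g, hg, hgap⟩ : ∃ g > 0, ∀ m ≤ K / 2, m ≠ k → eigenvalue c m ≤ eigenvalue c k - g := by
    rcases ((range (K / 2 + 1)).erase k).eq_empty_or_nonempty with h | h
    · refine ⟨1, one_pos, fun m hm hmk => ?_⟩
      have : m ∈ (range (K / 2 + 1)).erase k := by simp [hmk]; omega
      simp [h] at this
    · obtain ⟨m₀, hm₀, hmax⟩ := exists_max_image _ (eigenvalue c) h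
      simp only [mem_erase, mem_range] at hm₀
      refine ⟨eigenvalue c k - eigenvalue c m₀, sub_pos.2 (hdom m₀ (by omega) hm₀.1), ?_⟩
      intro m hm hmk
      have := hmax m (by simp [hmk]; omega)
      linarith
  refine ⟨g, hg, fun w hw => ?_⟩
  have hk0 : modeEnergy w k = 0 := by
    rw [modeEnergy, real_inner_comm, inner_eq_zero_of_mem (cosMode_mem k) hw, real_inner_comm,
      inner_eq_zero_of_mem (sinMode_mem k) hw]
    ring
  rw [inner_coupling_self hc, norm_sq_eq_sum_modeEnergy, mul_sum]
  refine sum_le_sum fun m hm => ?_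
  have hmK : m < K := by simpa using hm
  by_cases h : m ≤ K / 2
  · by_cases hmk : m = k
    · rw [hmk, hk0, mul_zero, mul_zero]
    · exact mul_le_mul_of_nonneg_right (hgap m h hmk) (modeEnergy_nonneg w m)
  -- Frequencies above K/2 are folded to K - m; in particular m = K - k is again critical and
  -- carries no energy.
  · rw [← eigenvalue_sub c hmK.le, ← modeEnergy_sub w hmK.le]
    by_cases hmk : K - m = k
    · rw [hmk, hk0, mul_zero, mul_zero]
    · exact mul_le_mul_of_nonneg_right (hgap _ (by omega) hmk) (modeEnergy_nonneg w _)

/-! ### The critical space -/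

omit [NeZero K] in
lemma not_dvd_two_mul {k : ℕ} (hk : 0 < k) (hkK : 2 * k < K) : ¬ K ∣ 2 * k :=
  fun h => absurd (Nat.le_of_dvd (by omega) h) (by omega)

omit [NeZero K] in
-- Since 0 < 4k < 2K, the only possible multiple of K is K itself, which `hres` excludes.
lemma not_dvd_four_mul {k : ℕ} (hk : 0 < k) (hkK : 2 * k < K) (hres : 4 * k ≠ K) :
    ¬ K ∣ 4 * k := by
  rintro ⟨n, hn⟩
  rcases n with _ | _ | n
  · omega
  · omega
  · nlinarith

/-! ### Second moments of the critical modes and the projection onto them -/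

section quadratic

variable {k : ℕ} (h2 : ¬ K ∣ 2 * k)
include h2

lemma sum_cos_sq : ∑ j : ZMod K, cos (k * sector j) ^ 2 = K / 2 := by
  have h := sum_cos_mul_sector h2
  have e : ∀ j : ZMod K, cos ((2 * k : ℕ) * sector j) = 2 * cos (k * sector j) ^ 2 - 1 := by
    intro j; rw [← cos_two_mul]; push_cast; ring_nf
  simp only [e, sum_sub_distrib, ← mul_sum, sum_const, card_univ, ZMod.card, nsmul_eq_mul] at h
  linarith

lemma sum_sin_sq : ∑ j : ZMod K, sin (k * sector j) ^ 2 = K / 2 := by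
  simp only [sin_sq, sum_sub_distrib, sum_cos_sq h2, sum_const, card_univ, ZMod.card,
    nsmul_eq_mul]
  ring

omit h2 in
lemma sum_cos_mul_sin : ∑ j : ZMod K, cos (k * sector j) * sin (k * sector j) = 0 := by
  have h := sum_sin_mul_sector (K := K) (2 * k)
  have e : ∀ j : ZMod K, sin ((2 * k : ℕ) * sector j) =
      2 * (cos (k * sector j) * sin (k * sector j)) := by
    intro j
    rw [show ((2 * k : ℕ) : ℝ) * sector j = 2 * (k * sector j) by push_cast; ring, sin_two_mul]
    ring
  simp only [e, ← mul_sum] at h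
  linarith

lemma inner_modes (p q p' q' : ℝ) :
    inner ℝ (p • cosMode k + q • sinMode k : State K) (p' • cosMode k + q' • sinMode k) =
      K / 2 * (p * p' + q * q') := by
  rw [state_inner]
  simp only [PiLp.add_apply, PiLp.smul_apply, cosMode, sinMode, smul_eq_mul]
  calc _ = ∑ j : ZMod K, (p * p' * cos (k * sector j) ^ 2 + q * q' * sin (k * sector j) ^ 2
        + (p * q' + q * p') * (cos (k * sector j) * sin (k * sector j))) :=
        sum_congr rfl fun j _ => by ring
    _ = _ := by
      simp only [sum_add_distrib, ← mul_sum, sum_cos_sq h2, sum_sin_sq h2, sum_cos_mul_sin]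
      ring

omit [NeZero K] in
lemma fourierWeight_eq : fourierWeight K k = 2 / K := if_neg h2

/-- The orthogonal projection onto the critical space in terms of Fourier coefficients. -/
lemma proj_eq (b : State K) :
    proj k b = cosCoeff b k • cosMode k + sinCoeff b k • sinMode k := by
  have hK : (K : ℝ) ≠ 0 := NeZero.ne _
  apply Submodule.eq_starProjection_of_mem_of_inner_eq_zero
  · exact mem_criticalSpace.2 ⟨_, _, rfl⟩
  · intro w hw
    obtain ⟨p, q, rfl⟩ := mem_criticalSpace.1 hw
    rw [inner_sub_left, inner_modes h2, cosCoeff, sinCoeff, fourierWeight_eq h2, inner_add_right,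
      inner_smul_right, inner_smul_right, state_inner, state_inner]
    simp only [cosMode, sinMode]
    field_simp
    ring

lemma norm_proj_sq (b : State K) : ‖proj k b‖ ^ 2 = K / 2 * amplitude b k ^ 2 := by
  rw [← real_inner_self_eq_norm_sq, proj_eq h2, inner_modes h2, amplitude,
    sq_sqrt (by positivity)]
  ring

end quadratic

/-! ### Fourth moments of the critical modes and isotropy of the cubic term -/

section quartic

variable {k : ℕ} (h2 : ¬ K ∣ 2 * k) (h4 : ¬ K ∣ 4 * k)
include h2 h4

/-- Multiple-angle formulas reduce the fourth power to frequencies 0, 2k and 4k, and only frequency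
0 survives. If K divided 4k, the last harmonic would survive too and destroy isotropy. -/
lemma sum_cos_pow_four : ∑ j : ZMod K, cos (k * sector j) ^ 4 = 3 * K / 8 := by
  have h := sum_cos_mul_sector h4
  have e : ∀ j : ZMod K, cos ((4 * k : ℕ) * sector j) =
      8 * cos (k * sector j) ^ 4 - 8 * cos (k * sector j) ^ 2 + 1 := by
    intro j
    rw [show ((4 * k : ℕ) : ℝ) * sector j = 2 * (2 * (k * sector j)) by push_cast; ring,
      cos_two_mul, cos_two_mul]
    ring
  simp only [e, sum_add_distrib, sum_sub_distrib, ← mul_sum, sum_const, card_univ, ZMod.card,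
    nsmul_eq_mul, sum_cos_sq h2] at h
  linarith

lemma sum_cos_sq_mul_sin_sq :
    ∑ j : ZMod K, cos (k * sector j) ^ 2 * sin (k * sector j) ^ 2 = K / 8 := by
  calc _ = ∑ j : ZMod K, (cos (k * sector j) ^ 2 - cos (k * sector j) ^ 4) :=
        sum_congr rfl fun j _ => by rw [sin_sq]; ring
    _ = _ := by rw [sum_sub_distrib, sum_cos_sq h2, sum_cos_pow_four h2 h4]; ring

lemma sum_sin_pow_four : ∑ j : ZMod K, sin (k * sector j) ^ 4 = 3 * K / 8 := by
  calc _ = ∑ j : ZMod K, (sin (k * sector j) ^ 2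
        - cos (k * sector j) ^ 2 * sin (k * sector j) ^ 2) :=
        sum_congr rfl fun j _ => by rw [cos_sq']; ring
    _ = _ := by rw [sum_sub_distrib, sum_sin_sq h2, sum_cos_sq_mul_sin_sq h2 h4]; ring

omit h2 h4 in
lemma sum_cos_pow_three_mul_sin :
    ∑ j : ZMod K, cos (k * sector j) ^ 3 * sin (k * sector j) = 0 := by
  have h := sum_sin_mul_sector (K := K) (4 * k)
  have e : ∀ j : ZMod K, sin ((4 * k : ℕ) * sector j) =
      8 * (cos (k * sector j) ^ 3 * sin (k * sector j))
        - 4 * (cos (k * sector j) * sin (k * sector j)) := by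
    intro j
    rw [show ((4 * k : ℕ) : ℝ) * sector j = 2 * (2 * (k * sector j)) by push_cast; ring,
      sin_two_mul, sin_two_mul, cos_two_mul]
    ring
  simp only [e, sum_sub_distrib, ← mul_sum, sum_cos_mul_sin] at h
  linarith

omit h2 h4 in
lemma sum_cos_mul_sin_pow_three :
    ∑ j : ZMod K, cos (k * sector j) * sin (k * sector j) ^ 3 = 0 := by
  calc _ = ∑ j : ZMod K, (cos (k * sector j) * sin (k * sector j)
        - cos (k * sector j) ^ 3 * sin (k * sector j)) :=
        sum_congr rfl fun j _ => by
          rw [show sin (k * sector j) ^ 3 = sin (k * sector j) * sin (k * sector j) ^ 2 by ring,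
            sin_sq]
          ring
    _ = _ := by rw [sum_sub_distrib, sum_cos_mul_sin, sum_cos_pow_three_mul_sin]; ring

/-- The cubic form of the critical space is isotropic: no resonance of order four. -/
lemma sum_pow_three_mul {v u : State K} (hv : v ∈ criticalSpace K k)
    (hu : u ∈ criticalSpace K k) :
    ∑ j, v j ^ 3 * u j = 3 / (2 * K) * ‖v‖ ^ 2 * inner ℝ v u := by
  have hK : (K : ℝ) ≠ 0 := NeZero.ne _
  obtain ⟨p, q, rfl⟩ := mem_criticalSpace.1 hv
  obtain ⟨p', q', rfl⟩ := mem_criticalSpace.1 hu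
  rw [← real_inner_self_eq_norm_sq, inner_modes h2, inner_modes h2]
  simp only [PiLp.add_apply, PiLp.smul_apply, cosMode, sinMode, smul_eq_mul]
  calc _ = ∑ j : ZMod K, (p ^ 3 * p' * cos (k * sector j) ^ 4 + q ^ 3 * q' * sin (k * sector j) ^ 4
        + (3 * p * q ^ 2 * p' + 3 * p ^ 2 * q * q') *
            (cos (k * sector j) ^ 2 * sin (k * sector j) ^ 2)
        + (p ^ 3 * q' + 3 * p ^ 2 * q * p') * (cos (k * sector j) ^ 3 * sin (k * sector j))
        + (q ^ 3 * p' + 3 * p * q ^ 2 * q') * (cos (k * sector j) * sin (k * sector j) ^ 3)) :=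
        sum_congr rfl fun j _ => by ring
    _ = _ := by
      simp only [sum_add_distrib, ← mul_sum, sum_cos_pow_four h2 h4, sum_sin_pow_four h2 h4,
        sum_cos_sq_mul_sin_sq h2 h4, sum_cos_pow_three_mul_sin, sum_cos_mul_sin_pow_three]
      field_simp
      ring

/-- The polarized quartic form enters the stability form: relative to directions u orthogonal to v,
the value at u = v is three times larger. This separates the radial from the tangential stability
condition. -/
lemma sum_sq_mul_sq {v u : State K} (hv : v ∈ criticalSpace K k)
    (hu : u ∈ criticalSpace K k) :
    ∑ j, v j ^ 2 * u j ^ 2 = 1 / (2 * K) * (‖v‖ ^ 2 * ‖u‖ ^ 2 + 2 * inner ℝ v u ^ 2) := by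
  have hK : (K : ℝ) ≠ 0 := NeZero.ne _
  obtain ⟨p, q, rfl⟩ := mem_criticalSpace.1 hv
  obtain ⟨p', q', rfl⟩ := mem_criticalSpace.1 hu
  rw [← real_inner_self_eq_norm_sq, ← real_inner_self_eq_norm_sq, inner_modes h2, inner_modes h2,
    inner_modes h2]
  simp only [PiLp.add_apply, PiLp.smul_apply, cosMode, sinMode, smul_eq_mul]
  calc _ = ∑ j : ZMod K, (p ^ 2 * p' ^ 2 * cos (k * sector j) ^ 4
        + q ^ 2 * q' ^ 2 * sin (k * sector j) ^ 4
        + (p ^ 2 * q' ^ 2 + q ^ 2 * p' ^ 2 + 4 * p * q * p' * q') *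
            (cos (k * sector j) ^ 2 * sin (k * sector j) ^ 2)
        + (2 * p * q * p' ^ 2 + 2 * p ^ 2 * p' * q') *
            (cos (k * sector j) ^ 3 * sin (k * sector j))
        + (2 * p * q * q' ^ 2 + 2 * q ^ 2 * p' * q') *
            (cos (k * sector j) * sin (k * sector j) ^ 3)) :=
        sum_congr rfl fun j _ => by ring
    _ = _ := by
      simp only [sum_add_distrib, ← mul_sum, sum_cos_pow_four h2 h4, sum_sin_pow_four h2 h4,
        sum_cos_sq_mul_sin_sq h2 h4, sum_cos_pow_three_mul_sin, sum_cos_mul_sin_pow_three]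
      field_simp
      ring

/-- The cube of a critical vector projects to a multiple of that vector. -/
lemma proj_cube {v : State K} (hv : v ∈ criticalSpace K k) :
    proj k (WithLp.toLp 2 fun j => v j ^ 3 : State K) = (3 / (2 * K) * ‖v‖ ^ 2) • v := by
  apply Submodule.eq_starProjection_of_mem_of_inner_eq_zero
  · exact Submodule.smul_mem _ _ hv
  · intro u hu
    rw [inner_sub_left, inner_smul_left, state_inner]
    simp only [sum_pow_three_mul h2 h4 hv hu]
    simp

end quartic

/-- Every critical vector has a critical vector of the same length orthogonal to it. -/
lemma exists_orthogonal_mem {k : ℕ} (h2 : ¬ K ∣ 2 * k) {v : State K}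
    (hv : v ∈ criticalSpace K k) :
    ∃ u ∈ criticalSpace K k, inner ℝ v u = 0 ∧ ‖u‖ = ‖v‖ := by
  obtain ⟨p, q, rfl⟩ := mem_criticalSpace.1 hv
  refine ⟨-q • cosMode k + p • sinMode k, mem_criticalSpace.2 ⟨_, _, rfl⟩, ?_, ?_⟩
  · rw [inner_modes h2]; ring
  · rw [← sq_eq_sq₀ (norm_nonneg _) (norm_nonneg _), ← real_inner_self_eq_norm_sq,
      ← real_inner_self_eq_norm_sq, inner_modes h2, inner_modes h2]
    ring

/-! ### Polar coordinates and amplitudes -/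

lemma amplitude_nonneg (b : State K) (m : ℕ) : 0 ≤ amplitude b m := sqrt_nonneg _

lemma amplitude_eq_norm (b : State K) (m : ℕ) :
    amplitude b m = ‖(⟨cosCoeff b m, sinCoeff b m⟩ : ℂ)‖ := by
  rw [amplitude, Complex.norm_eq_sqrt_sq_add_sq]

lemma amplitude_mul_cos_phase (b : State K) (m : ℕ) :
    amplitude b m * cos (phase b m) = cosCoeff b m := by
  rw [amplitude_eq_norm, phase, Complex.norm_mul_cos_arg]

lemma amplitude_mul_sin_phase (b : State K) (m : ℕ) :
    amplitude b m * sin (phase b m) = sinCoeff b m := by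
  rw [amplitude_eq_norm, phase, Complex.norm_mul_sin_arg]

lemma proj_apply {k : ℕ} (h2 : ¬ K ∣ 2 * k) (b : State K) (j : ZMod K) :
    proj k b j = amplitude b k * cos (k * sector j - phase b k) := by
  rw [proj_eq h2, cos_sub]
  simp only [PiLp.add_apply, PiLp.smul_apply, cosMode, sinMode, smul_eq_mul,
    ← amplitude_mul_cos_phase, ← amplitude_mul_sin_phase]
  ring

lemma direction_eq (k : ℕ) (θ : ℝ) :
    (direction k θ : State K) = (√2 * cos θ) • cosMode k + (√2 * sin θ) • sinMode k := by
  rw [direction, smul_add, smul_smul, smul_smul]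

lemma direction_mem (k : ℕ) (θ : ℝ) : (direction k θ : State K) ∈ criticalSpace K k := by
  rw [direction_eq]; exact mem_criticalSpace.2 ⟨_, _, rfl⟩

lemma direction_apply (k : ℕ) (θ : ℝ) (j : ZMod K) :
    (direction k θ : State K) j = √2 * cos (k * sector j - θ) := by
  rw [direction_eq, cos_sub]
  simp only [PiLp.add_apply, PiLp.smul_apply, cosMode, sinMode, smul_eq_mul]
  ring

lemma pairing_eq_inner (u v : State K) : pairing u v = 1 / K * inner ℝ u v := by
  rw [pairing, state_inner]

lemma pairing_direction {k : ℕ} (h2 : ¬ K ∣ 2 * k) (θ θ' : ℝ) :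
    pairing (direction k θ : State K) (direction k θ') = cos (θ' - θ) := by
  have hK : (K : ℝ) ≠ 0 := NeZero.ne _
  have hs : √2 * √2 = 2 := mul_self_sqrt (by norm_num)
  rw [pairing_eq_inner, direction_eq, direction_eq, inner_modes h2, cos_sub]
  field_simp
  linear_combination (cos θ * cos θ' + sin θ * sin θ') * hs

lemma norm_direction {k : ℕ} (h2 : ¬ K ∣ 2 * k) (θ : ℝ) :
    ‖(direction k θ : State K)‖ = √K := by
  have hK : (K : ℝ) ≠ 0 := NeZero.ne _
  have h := pairing_direction h2 θ θ
  rw [pairing_eq_inner, real_inner_self_eq_norm_sq, sub_self, cos_zero] at h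
  rw [eq_comm, sqrt_eq_iff_mul_self_eq (by positivity) (norm_nonneg _)]
  field_simp at h
  linarith

lemma pairing_proj_direction {k : ℕ} (h2 : ¬ K ∣ 2 * k) (b : State K) (θ : ℝ) :
    pairing (proj k b) (direction k θ) = amplitude b k / √2 * cos (θ - phase b k) := by
  have hK : (K : ℝ) ≠ 0 := NeZero.ne _
  have hs : √2 * √2 = 2 := mul_self_sqrt (by norm_num)
  have hs' : √2 ≠ 0 := by positivity
  rw [pairing_eq_inner, proj_eq h2, direction_eq, inner_modes h2, cos_sub,
    ← amplitude_mul_cos_phase, ← amplitude_mul_sin_phase]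
  field_simp
  linear_combination (amplitude b k * (cos (phase b k) * cos θ + sin (phase b k) * sin θ)) * hs

lemma amplitude_sq_eq_modeEnergy (b : State K) (m : ℕ) :
    amplitude b m ^ 2 = fourierWeight K m ^ 2 * (K * modeEnergy b m) := by
  have hK : (K : ℝ) ≠ 0 := NeZero.ne _
  rw [amplitude, sq_sqrt (by positivity), modeEnergy, state_inner, state_inner, cosCoeff, sinCoeff]
  simp only [cosMode, sinMode]
  field_simp

lemma exists_amplitude_le (K : ℕ) [NeZero K] (m : ℕ) :
    ∃ C ≥ 0, ∀ b : State K, amplitude b m ≤ C * ‖b‖ := by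
  have hK : 0 < (K : ℝ) := Nat.cast_pos.2 (NeZero.pos K)
  have hw : 0 ≤ fourierWeight K m := by unfold fourierWeight; split_ifs <;> positivity
  refine ⟨fourierWeight K m * (‖(cosMode m : State K)‖ + ‖(sinMode m : State K)‖),
    by positivity, fun b => ?_⟩
  have h1 : |cosCoeff b m| ≤ fourierWeight K m * (‖b‖ * ‖(cosMode m : State K)‖) := by
    rw [cosCoeff, abs_mul, abs_of_nonneg hw]
    have := abs_real_inner_le_norm b (cosMode m)
    rw [state_inner] at this
    exact mul_le_mul_of_nonneg_left this hw
  have h2 : |sinCoeff b m| ≤ fourierWeight K m * (‖b‖ * ‖(sinMode m : State K)‖) := by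
    rw [sinCoeff, abs_mul, abs_of_nonneg hw]
    have := abs_real_inner_le_norm b (sinMode m)
    rw [state_inner] at this
    exact mul_le_mul_of_nonneg_left this hw
  have h3 : amplitude b m ≤ |cosCoeff b m| + |sinCoeff b m| := by
    rw [amplitude, sqrt_le_left (by positivity)]
    nlinarith [abs_nonneg (cosCoeff b m), abs_nonneg (sinCoeff b m), sq_abs (cosCoeff b m),
      sq_abs (sinCoeff b m)]
  linarith

/-- Both normalizations of the Fourier coefficients are at least 1/K, so the self-conjugate modes
need no separate treatment. -/
lemma modeEnergy_le_amplitude_sq (b : State K) (m : ℕ) :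
    modeEnergy b m ≤ K * amplitude b m ^ 2 := by
  have hK : 0 < (K : ℝ) := Nat.cast_pos.2 (NeZero.pos K)
  have hw : 1 / (K : ℝ) ≤ fourierWeight K m := by
    unfold fourierWeight; split_ifs
    · exact le_rfl
    · gcongr; norm_num
  have h1 := pow_le_pow_left₀ (by positivity) hw 2
  have h2 := mul_le_mul_of_nonneg_right h1 (mul_nonneg hK.le (modeEnergy_nonneg b m))
  rw [← amplitude_sq_eq_modeEnergy] at h2
  calc modeEnergy b m = K * ((1 / (K : ℝ)) ^ 2 * (K * modeEnergy b m)) := by field_simp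
    _ ≤ _ := by gcongr

/-- Suppressed evidence is controlled by its critical amplitude. -/
lemma exists_norm_le_amplitude {d : ℝ} {c : ZMod K → ℝ} {k : ℕ} {κ : ℝ} (hκ : 0 ≤ κ) :
    ∃ C > 0, ∀ b : State K, Suppressed d c k κ b → ‖b‖ ≤ C * amplitude b k := by
  obtain ⟨B, hB⟩ : ∃ B, ∀ m ∈ range (K / 2 + 1), |stableEigenvalue d c k m| ≤ B :=
    (Finset.bddAbove ((range (K / 2 + 1)).image fun m => |stableEigenvalue d c k m|)).imp
      fun B hB m hm => hB (by simpa using ⟨m, by simpa using hm, rfl⟩)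
  -- The summand 1 covers m = k, the other one the suppressed modes, so one constant serves all
  -- frequencies.
  set D := 1 + κ * |B| with hD
  have hD0 : 0 < D := by positivity
  refine ⟨K * D, by have := NeZero.pos K; positivity, fun b hb => ?_⟩
  have hamp : ∀ m ≤ K / 2, amplitude b m ≤ D * amplitude b k := fun m hm => by
    have ha := amplitude_nonneg b k
    by_cases h : m = k
    · rw [h, hD]; nlinarith [mul_nonneg (mul_nonneg hκ (abs_nonneg B)) ha]
    · refine (hb m hm h).trans (mul_le_mul_of_nonneg_right ?_ ha)
      have := (hB m (by simp; omega)).trans (le_abs_self B)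
      rw [hD]; nlinarith
  have hE : ∀ m ∈ range K, modeEnergy b m ≤ K * (D * amplitude b k) ^ 2 := fun m hm => by
    have hmK : m < K := by simpa using hm
    by_cases h : m ≤ K / 2
    · refine (modeEnergy_le_amplitude_sq b m).trans ?_
      gcongr
      · exact amplitude_nonneg b m
      · exact hamp m h
    · rw [← modeEnergy_sub b hmK.le]
      refine (modeEnergy_le_amplitude_sq b _).trans ?_
      gcongr
      · exact amplitude_nonneg b _
      · exact hamp _ (by omega)
  have := sum_le_sum hE
  rw [← norm_sq_eq_sum_modeEnergy, sum_const, card_range, nsmul_eq_mul] at this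
  have ha := amplitude_nonneg b k
  refine abs_le_of_sq_le_sq' (this.trans (le_of_eq (by ring))) (by positivity) |>.2

/-! ### Expansion of an odd nonlinearity -/

/-- A function whose derivative at `x` is bounded by `C |x| ^ n` near `0` and that vanishes at `0`
is bounded by `C |x| ^ (n + 1)`. -/
lemma abs_le_pow_succ_of_deriv {f f' : ℝ → ℝ} {C ρ : ℝ} {n : ℕ} (hf0 : f 0 = 0) (hC : 0 ≤ C)
    (hf : ∀ x, HasDerivAt f (f' x) x) (hb : ∀ x, |x| < ρ → |f' x| ≤ C * |x| ^ n) {x : ℝ}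
    (hx : |x| < ρ) : |f x| ≤ C * |x| ^ (n + 1) := by
  have h := (convex_Icc (-|x|) |x|).norm_image_sub_le_of_norm_hasDerivWithin_le
    (f := f) (f' := f') (C := C * |x| ^ n) (x := 0) (y := x)
    (fun y _ => (hf y).hasDerivWithinAt)
    (fun y hy => by
      have hy' : |y| ≤ |x| := abs_le.2 hy
      refine (hb y (hy'.trans_lt hx)).trans ?_
      gcongr)
    ⟨by simp, by simp⟩ ⟨neg_abs_le x, le_abs_self x⟩
  rw [hf0, sub_zero, sub_zero, norm_eq_abs, norm_eq_abs] at h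
  rw [pow_succ, ← mul_assoc]
  exact h

section nonlinearity

variable {S : ℝ → ℝ} (hSodd : ∀ x, S (-x) = -S x) (hS : ContDiff ℝ 3 S)

include hSodd in
lemma odd_zero : S 0 = 0 := by
  have := hSodd 0
  rw [neg_zero] at this
  linarith

include hSodd in
lemma deriv_neg_of_odd (x : ℝ) : deriv S (-x) = deriv S x := by
  have h : (fun y => S (-y)) = fun y => -S y := funext hSodd
  have h1 := deriv_comp_neg S x
  rw [h, deriv.fun_neg] at h1
  linarith

include hSodd in
lemma deriv_deriv_zero_of_odd : deriv (deriv S) 0 = 0 := by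
  have h : (fun y => deriv S (-y)) = fun y => deriv S y := funext (deriv_neg_of_odd hSodd)
  have h1 := deriv_comp_neg (deriv S) 0
  rw [h, neg_zero] at h1
  change deriv (deriv S) 0 = _ at h1
  linarith

include hS

lemma hasDerivAt_of_contDiff (x : ℝ) : HasDerivAt S (deriv S x) x :=
  (hS.differentiable (by norm_num) x).hasDerivAt

lemma contDiff_two_deriv : ContDiff ℝ 2 (deriv S) := by
  have : ContDiff ℝ (2 + 1) S := by simpa [two_add_one_eq_three] using hS
  exact (contDiff_succ_iff_deriv.1 this).2.2

lemma hasDerivAt_deriv_of_contDiff (x : ℝ) :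
    HasDerivAt (deriv S) (deriv (deriv S) x) x :=
  ((contDiff_two_deriv hS).differentiable (by norm_num) x).hasDerivAt

lemma hasDerivAt_deriv_deriv_zero :
    HasDerivAt (deriv (deriv S)) (iteratedDeriv 3 S 0) 0 := by
  have h1 : ContDiff ℝ 1 (deriv (deriv S)) := by
    have : ContDiff ℝ (1 + 1) (deriv S) := by
      simpa [one_add_one_eq_two] using contDiff_two_deriv hS
    exact (contDiff_succ_iff_deriv.1 this).2.2
  have := (h1.differentiable (by norm_num) 0).hasDerivAt
  rwa [show deriv (deriv (deriv S)) 0 = iteratedDeriv 3 S 0 by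
    simp [iteratedDeriv_succ]] at this

include hSodd

/-- Second-order expansion of the slope of the nonlinearity. -/
lemma exists_deriv_expansion (hS1 : deriv S 0 = 1) {ε : ℝ} (hε : 0 < ε) :
    ∃ ρ > 0, ∀ x, |x| < ρ → |deriv S x - 1 - iteratedDeriv 3 S 0 / 2 * x ^ 2| ≤ ε * |x| ^ 2 := by
  -- Only differentiability of S'' at 0 is used, together with S''(0) = 0 from oddness; integrating
  -- the o(x) remainder gives ε|x|².
  have h := (hasDerivAt_deriv_deriv_zero hS).isLittleO
  have h1 := h.def hε
  obtain ⟨ρ, hρ, hb⟩ := Metric.eventually_nhds_iff.1 h1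
  refine ⟨ρ, hρ, fun x hx => ?_⟩
  refine abs_le_pow_succ_of_deriv (n := 1)
    (f := fun y => deriv S y - 1 - iteratedDeriv 3 S 0 / 2 * y ^ 2)
    (f' := fun y => deriv (deriv S) y - iteratedDeriv 3 S 0 * y) (by simp [hS1]) hε.le
    (fun y => ?_) (fun y hy => ?_) hx
  · have := ((hasDerivAt_deriv_of_contDiff hS y).sub_const 1).sub
      ((hasDerivAt_pow 2 y).const_mul (iteratedDeriv 3 S 0 / 2))
    exact this.congr_deriv (by push_cast; ring)
  · have := hb (y := y) (by simpa using hy)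
    simpa [deriv_deriv_zero_of_odd hSodd, mul_comm] using this

/-- Third-order expansion of the nonlinearity. -/
lemma exists_expansion (hS1 : deriv S 0 = 1) {ε : ℝ} (hε : 0 < ε) :
    ∃ ρ > 0, ∀ x, |x| < ρ → |S x - x - iteratedDeriv 3 S 0 / 6 * x ^ 3| ≤ ε * |x| ^ 3 := by
  obtain ⟨ρ, hρ, hb⟩ := exists_deriv_expansion hSodd hS hS1 hε
  refine ⟨ρ, hρ, fun x hx => ?_⟩
  refine abs_le_pow_succ_of_deriv (n := 2)
    (f := fun y => S y - y - iteratedDeriv 3 S 0 / 6 * y ^ 3)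
    (f' := fun y => deriv S y - 1 - iteratedDeriv 3 S 0 / 2 * y ^ 2) (by simp [odd_zero hSodd])
    hε.le (fun y => ?_) hb hx
  have := ((hasDerivAt_of_contDiff hS y).sub (hasDerivAt_id y)).sub
    ((hasDerivAt_pow 3 y).const_mul (iteratedDeriv 3 S 0 / 6))
  exact this.congr_deriv (by push_cast; ring)

omit hSodd in
lemma exists_slope_bounds (hS1 : deriv S 0 = 1) :
    ∃ ρ > 0, ∀ x, |x| < ρ → 1 / 2 ≤ deriv S x ∧ deriv S x ≤ 2 := by
  have hc : ContinuousAt (deriv S) 0 := (contDiff_two_deriv hS).continuous.continuousAt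
  obtain ⟨ρ, hρ, hb⟩ := Metric.continuousAt_iff.1 hc (1 / 2) (by norm_num)
  refine ⟨ρ, hρ, fun x hx => ?_⟩
  have h := hb (x := x) (by simpa using hx)
  rw [hS1, dist_eq, abs_lt] at h
  constructor <;> linarith

/-- Second-order expansion of the reciprocal slope of the nonlinearity. -/
lemma exists_inv_deriv_expansion (hS1 : deriv S 0 = 1) {ε : ℝ} (hε : 0 < ε) :
    ∃ ρ > 0, ∀ x, |x| < ρ →
      |(deriv S x)⁻¹ - 1 + iteratedDeriv 3 S 0 / 2 * x ^ 2| ≤ ε * |x| ^ 2 := by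
  set s := iteratedDeriv 3 S 0
  obtain ⟨ρ₁, hρ₁, hb₁⟩ := exists_deriv_expansion hSodd hS hS1 (ε := ε / 4) (by positivity)
  obtain ⟨ρ₂, hρ₂, hb₂⟩ := exists_slope_bounds hS hS1
  set D := |s / 2| * (|s / 2| + ε / 4) with hD
  have hD0 : 0 ≤ D := by positivity
  -- The last two bounds give D|x|² ≤ ε/4. The linear remainder and this product each cost ε/4, and
  -- the factor 1/S'(x) ≤ 2 doubles their sum to ε.
  refine ⟨min (min ρ₁ ρ₂) (min 1 (ε / (4 * (D + 1)))), by positivity, fun x hx => ?_⟩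
  have hx1 : |x| < ρ₁ := hx.trans_le ((min_le_left _ _).trans (min_le_left _ _))
  have hx2 : |x| < ρ₂ := hx.trans_le ((min_le_left _ _).trans (min_le_right _ _))
  have hx3 : |x| < 1 := hx.trans_le ((min_le_right _ _).trans (min_le_left _ _))
  have hx4 : |x| < ε / (4 * (D + 1)) := hx.trans_le ((min_le_right _ _).trans (min_le_right _ _))
  obtain ⟨hlo, -⟩ := hb₂ x hx2
  have hpos : 0 < deriv S x := by linarith
  have h1 := hb₁ x hx1
  set y := deriv S x
  have e : y⁻¹ - 1 + s / 2 * x ^ 2 =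
      (-(y - 1 - s / 2 * x ^ 2) + s / 2 * x ^ 2 * (y - 1)) * y⁻¹ := by
    field_simp; ring
  have hinv : y⁻¹ ≤ 2 := by
    rw [inv_le_comm₀ hpos (by norm_num)]; linarith
  have hx2' : 0 ≤ |x| ^ 2 := by positivity
  have hy1 : |y - 1| ≤ (|s / 2| + ε / 4) * |x| ^ 2 := by
    calc |y - 1| = |(y - 1 - s / 2 * x ^ 2) + s / 2 * x ^ 2| := by ring_nf
      _ ≤ |y - 1 - s / 2 * x ^ 2| + |s / 2 * x ^ 2| := abs_add_le _ _
      _ ≤ ε / 4 * |x| ^ 2 + |s / 2| * |x| ^ 2 := by rw [abs_mul, abs_pow]; gcongr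
      _ = _ := by ring
  have hy2 : |s / 2 * x ^ 2 * (y - 1)| ≤ D * |x| ^ 2 * |x| ^ 2 := by
    rw [abs_mul, abs_mul, abs_pow, hD]
    calc |s / 2| * |x| ^ 2 * |y - 1| ≤ |s / 2| * |x| ^ 2 * ((|s / 2| + ε / 4) * |x| ^ 2) := by
          gcongr
      _ = _ := by ring
  have hDx : D * |x| ^ 2 ≤ ε / 4 := by
    have : (D + 1) * |x| < ε / 4 := by
      rw [lt_div_iff₀ (by positivity)] at hx4; linarith
    nlinarith [abs_nonneg x]
  rw [e, abs_mul, abs_of_pos (inv_pos.2 hpos)]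
  calc _ ≤ (|y - 1 - s / 2 * x ^ 2| + |s / 2 * x ^ 2 * (y - 1)|) * 2 := by
        gcongr
        refine (abs_add_le _ _).trans ?_
        rw [abs_neg]
    _ ≤ (ε / 4 * |x| ^ 2 + ε / 4 * |x| ^ 2) * 2 := by
        gcongr
        exact hy2.trans (by gcongr)
    _ = _ := by ring

end nonlinearity

/-! ### Norm estimates and the projection -/

lemma abs_apply_le_norm (u : State K) (j : ZMod K) : |u j| ≤ ‖u‖ := by
  refine abs_le_of_sq_le_sq (?_ : u j ^ 2 ≤ ‖u‖ ^ 2) (norm_nonneg u)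
  rw [norm_sq_eq_sum]
  exact single_le_sum (f := fun i => u i ^ 2) (fun i _ => sq_nonneg _) (mem_univ j)

lemma norm_le_of_forall_abs_le {u : State K} {B : ℝ} (h : ∀ j, |u j| ≤ B) : ‖u‖ ≤ K * B := by
  have hB : 0 ≤ B := (abs_nonneg _).trans (h 0)
  have hK : (1 : ℝ) ≤ K := Nat.one_le_cast.2 (NeZero.pos K)
  refine (abs_le_of_sq_le_sq' (?_ : ‖u‖ ^ 2 ≤ (K * B) ^ 2) (by positivity)).2
  rw [norm_sq_eq_sum]
  calc ∑ j, u j ^ 2 ≤ ∑ _j : ZMod K, B ^ 2 := sum_le_sum fun j _ => sq_le_sq' (by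
        have := abs_le.1 (h j); linarith) (abs_le.1 (h j)).2
    _ = K * B ^ 2 := by simp [ZMod.card]
    _ ≤ (K * B) ^ 2 := by
      rw [mul_pow]; gcongr; nlinarith

lemma proj_add (k : ℕ) (u v : State K) : proj k (u + v) = proj k u + proj k v := map_add _ _ _

lemma proj_sub (k : ℕ) (u v : State K) : proj k (u - v) = proj k u - proj k v := map_sub _ _ _

lemma proj_smul (k : ℕ) (a : ℝ) (u : State K) : proj k (a • u) = a • proj k u := map_smul _ _ _

lemma proj_mem (k : ℕ) (u : State K) : proj k u ∈ criticalSpace K k :=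
  Submodule.starProjection_apply_mem _ _

lemma sub_proj_mem (k : ℕ) (u : State K) : u - proj k u ∈ (criticalSpace K k)ᗮ :=
  Submodule.sub_starProjection_mem_orthogonal _

lemma proj_of_mem {k : ℕ} {v : State K} (hv : v ∈ criticalSpace K k) : proj k v = v :=
  Submodule.starProjection_eq_self_iff.2 hv

lemma proj_of_mem_orthogonal {k : ℕ} {w : State K} (hw : w ∈ (criticalSpace K k)ᗮ) :
    proj k w = 0 := (criticalSpace K k).starProjection_apply_eq_zero_iff.2 hw

lemma norm_proj_le (k : ℕ) (u : State K) : ‖proj k u‖ ≤ ‖u‖ :=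
  Submodule.norm_starProjection_apply_le _ _

/-- The argument `α A z + b` of the nonlinearity. -/
noncomputable def netInput (c : ZMod K → ℝ) (α : ℝ) (b z : State K) : State K :=
  α • coupling c z + b

/-- The nonlinear part `S x - x`, componentwise. -/
noncomputable def residual (S : ℝ → ℝ) (x : State K) : State K :=
  WithLp.toLp 2 fun j => S (x j) - x j

lemma vectorField_apply (S : ℝ → ℝ) (d : ℝ) (c : ZMod K → ℝ) (α : ℝ) (b z : State K)
    (j : ZMod K) : vectorField S d c α b z j = -d * z j + S (netInput c α b z j) := rfl

lemma vectorField_eq (S : ℝ → ℝ) (d : ℝ) (c : ZMod K → ℝ) (α : ℝ) (b z : State K) :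
    vectorField S d c α b z =
      -d • z + netInput c α b z + residual S (netInput c α b z) := by
  ext j
  rw [vectorField_apply]
  simp [residual]

/-! ### Critical and noncritical components of the vector field -/

section decomposition

variable {S : ℝ → ℝ} {d : ℝ} {c : ZMod K → ℝ} {k : ℕ} (hc : ∀ j, c (-j) = c j) {v w : State K}
  (hv : v ∈ criticalSpace K k) (hw : w ∈ (criticalSpace K k)ᗮ) (α : ℝ) (b : State K)
include hc hv

lemma netInput_add :
    netInput c α b (v + w) = (α * eigenvalue c k) • v + α • coupling c w + b := by
  rw [netInput, map_add, coupling_of_mem hc hv]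
  module

include hw

/-- The coupling preserves both E_c and E_s, so w enters the critical component only through the
nonlinear residual. -/
lemma proj_vectorField :
    proj k (vectorField S d c α b (v + w)) =
      onset d c k α • v + proj k b + proj k (residual S (netInput c α b (v + w))) := by
  rw [vectorField_eq, proj_add]
  congr 1
  rw [netInput_add hc hv, proj_add, proj_add, proj_add, proj_smul, proj_add, proj_smul, proj_smul,
    proj_of_mem hv, proj_of_mem_orthogonal hw,
    proj_of_mem_orthogonal (coupling_mem_orthogonal hc hw), onset]
  module

/-- Pairing with w removes the terms linear in v and leaves the coercive quadratic form of E_s. -/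
lemma inner_vectorField :
    inner ℝ w (vectorField S d c α b (v + w)) =
      -inner ℝ w (d • w - α • coupling c w) + inner ℝ w b
        + inner ℝ w (residual S (netInput c α b (v + w))) := by
  have h : inner ℝ w v = 0 := by rw [real_inner_comm]; exact inner_eq_zero_of_mem hv hw
  rw [vectorField_eq, inner_add_right, inner_add_right, netInput_add hc hv]
  simp only [inner_add_right, inner_smul_right, inner_sub_right, h]
  ring

end decomposition

lemma criticalGain_mul_eigenvalue {d : ℝ} {c : ZMod K → ℝ} {k : ℕ} (hpos : 0 < eigenvalue c k) :
    criticalGain d c k * eigenvalue c k = d := div_mul_cancel₀ _ hpos.ne'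

lemma onset_eq {d : ℝ} {c : ZMod K → ℝ} {k : ℕ} (hpos : 0 < eigenvalue c k) (α : ℝ) :
    onset d c k α = (α - criticalGain d c k) * eigenvalue c k := by
  rw [sub_mul, criticalGain_mul_eigenvalue hpos, onset]; ring

lemma cubicCoeff_eq (S : ℝ → ℝ) {d : ℝ} {c : ZMod K → ℝ} {k : ℕ} (hpos : 0 < eigenvalue c k) :
    cubicCoeff S d c k = iteratedDeriv 3 S 0 / 4 * d ^ 3 := by
  rw [cubicCoeff, mul_assoc, ← mul_pow, criticalGain_mul_eigenvalue hpos]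

/-- Uniform coercivity of the linearization on the noncritical modes. -/
lemma exists_coercive {d : ℝ} {c : ZMod K → ℝ} {k : ℕ} (hd : 0 < d) (hc : ∀ j, c (-j) = c j)
    (hpos : 0 < eigenvalue c k)
    (hdom : ∀ m ≤ K / 2, m ≠ k → eigenvalue c m < eigenvalue c k) :
    ∃ γ > 0, ∃ ρ > 0, ∀ α, |α - criticalGain d c k| < ρ → 0 < α ∧
      ∀ w ∈ (criticalSpace K k)ᗮ, γ * ‖w‖ ^ 2 ≤ inner ℝ w (d • w - α • coupling c w) := by
  obtain ⟨g, hg, hgap⟩ := exists_spectral_gap hc hdom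
  have hcrit : 0 < criticalGain d c k := div_pos hd hpos
  have hdc := criticalGain_mul_eigenvalue (d := d) hpos
  set a := criticalGain d c k
  set l := eigenvalue c k
  -- On E_s the form is at least d - α(l - g) = αg - (α - a)l; here αg ≥ ag/2, and the second radius
  -- costs at most ag/4.
  refine ⟨a * g / 4, by positivity, min (a / 2) (a * g / (4 * l)), by positivity, ?_⟩
  intro α hα
  have h1 := abs_lt.1 (hα.trans_le (min_le_left _ _))
  have h2 := abs_lt.1 (hα.trans_le (min_le_right _ _))
  have hα0 : 0 < α := by linarith
  refine ⟨hα0, fun w hw => ?_⟩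
  rw [inner_sub_right, inner_smul_right, inner_smul_right, real_inner_self_eq_norm_sq]
  have h3 := mul_le_mul_of_nonneg_left (hgap w hw) hα0.le
  have h4 : (α - a) * l < a * g / 4 := by
    have := mul_lt_mul_of_pos_right h2.2 hpos
    calc _ < a * g / (4 * l) * l := this
      _ = a * g / 4 := by field_simp
  have h5 : a * g / 4 ≤ d - α * (l - g) := by nlinarith
  nlinarith [mul_le_mul_of_nonneg_right h5 (sq_nonneg ‖w‖)]

/-- Oddness and unit slope leave nothing below third order in S(x) - x. -/
lemma exists_norm_residual_le {S : ℝ → ℝ} (hSodd : ∀ x, S (-x) = -S x) (hS : ContDiff ℝ 3 S)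
    (hS1 : deriv S 0 = 1) :
    ∃ C > 0, ∃ ρ > 0, ∀ x : State K, ‖x‖ < ρ → ‖residual S x‖ ≤ C * ‖x‖ ^ 3 := by
  obtain ⟨ρ, hρ, hb⟩ := exists_expansion hSodd hS hS1 one_pos
  set s := iteratedDeriv 3 S 0
  have hK : (0 : ℝ) < K := Nat.cast_pos.2 (NeZero.pos K)
  refine ⟨K * (|s / 6| + 1), by positivity, ρ, hρ, fun x hx => ?_⟩
  rw [mul_assoc]
  refine norm_le_of_forall_abs_le fun j => ?_
  have hj := abs_apply_le_norm x j
  have h1 := hb (x j) (hj.trans_lt hx)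
  calc |residual S x j| = |(S (x j) - x j - s / 6 * x j ^ 3) + s / 6 * x j ^ 3| := by
        simp [residual]
    _ ≤ |S (x j) - x j - s / 6 * x j ^ 3| + |s / 6 * x j ^ 3| := abs_add_le _ _
    _ ≤ 1 * |x j| ^ 3 + |s / 6| * |x j| ^ 3 := by rw [abs_mul, abs_pow]; gcongr
    _ = (|s / 6| + 1) * |x j| ^ 3 := by ring
    _ ≤ _ := by gcongr

/-- Absorption of a cubic term into a linear a priori bound. -/
lemma exists_absorb_cubic {γ C₁ L : ℝ} (hγ : 0 < γ) (hC₁ : 0 < C₁) (hL : 1 ≤ L) :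
    ∃ C > 0, ∃ q > 0, ∀ t y β x : ℝ, 0 ≤ t → 0 ≤ y → 0 ≤ β → 0 ≤ x → t < q → y < q → β < q →
      x ≤ L * (t + y + β) → γ * y ≤ β + C₁ * x ^ 3 →
      y ≤ C * (β + t ^ 3) ∧ x ≤ C * (t + β) := by
  have hL0 : 0 < L := by linarith
  -- Since (t + y + β)² ≤ 9q² ≤ 9q, this q turns the cubic term into at most (γ/2)(t + y + β), half
  -- of whose coefficient on the left absorbs y.
  obtain ⟨q, hq0, hq1, hq⟩ : ∃ q > 0, q ≤ 1 ∧ C₁ * L ^ 3 * (9 * q) ≤ γ / 2 := by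
    refine ⟨min 1 (γ / (2 * (C₁ * (9 * L ^ 3)))), by positivity, min_le_left _ _, ?_⟩
    calc _ ≤ C₁ * L ^ 3 * (9 * (γ / (2 * (C₁ * (9 * L ^ 3))))) := by
          gcongr; exact min_le_right _ _
      _ = _ := by field_simp
  obtain ⟨L₂, hL₂⟩ : ∃ L₂, L₂ = L * (2 / γ + 2) := ⟨_, rfl⟩
  obtain ⟨C₂, hC₂⟩ : ∃ C₂, C₂ = (1 + 4 * C₁ * L₂ ^ 3) / γ := ⟨_, rfl⟩
  have hL₂0 : 0 < L₂ := by rw [hL₂]; positivity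
  have hC₂0 : 0 < C₂ := by rw [hC₂]; positivity
  refine ⟨L₂ + C₂, by positivity, q, hq0, ?_⟩
  intro t y β x ht hy hβ hx htq hyq hβq hxL hmain
  have hsmall : C₁ * x ^ 3 ≤ γ / 2 * (t + y + β) := by
    have h2 : (t + y + β) ^ 2 ≤ 9 * q := by nlinarith
    calc C₁ * x ^ 3 ≤ C₁ * (L * (t + y + β)) ^ 3 := by gcongr
      _ = C₁ * L ^ 3 * (t + y + β) ^ 2 * (t + y + β) := by ring
      _ ≤ C₁ * L ^ 3 * (9 * q) * (t + y + β) := by gcongr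
      _ ≤ _ := by gcongr
  have hw1 : y ≤ (2 / γ + 1) * β + t := by
    have : γ / 2 * y ≤ γ / 2 * ((2 / γ + 1) * β + t) := by
      have e : γ / 2 * ((2 / γ + 1) * β + t) = (1 + γ / 2) * β + γ / 2 * t := by
        field_simp
      rw [e]; linarith
    exact le_of_mul_le_mul_left this (by positivity)
  have hγ' : 0 < 2 / γ := by positivity
  have hx1 : x ≤ L₂ * (t + β) := by
    refine hxL.trans ?_
    rw [hL₂, mul_assoc]
    gcongr
    linarith [mul_nonneg hγ'.le ht]
  -- Bootstrap: the linear bound x = O(t + β) is fed back into the cubic term, and β³ ≤ β because β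
  -- < 1.
  have hw2 : y ≤ C₂ * (β + t ^ 3) := by
    rw [hC₂, div_mul_eq_mul_div, le_div_iff₀ hγ]
    have h1 : (t + β) ^ 3 ≤ 4 * (t ^ 3 + β) := by
      have hb1 : β ^ 3 ≤ β := pow_le_of_le_one hβ (by linarith) (by norm_num)
      nlinarith [mul_nonneg (add_nonneg ht hβ) (sq_nonneg (t - β))]
    have h2 : C₁ * x ^ 3 ≤ C₁ * L₂ ^ 3 * (4 * (t ^ 3 + β)) := by
      calc C₁ * x ^ 3 ≤ C₁ * (L₂ * (t + β)) ^ 3 := by gcongr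
        _ = C₁ * L₂ ^ 3 * (t + β) ^ 3 := by ring
        _ ≤ _ := by gcongr
    have h3 : 0 ≤ t ^ 3 := by positivity
    linarith
  have : 0 ≤ t ^ 3 := by positivity
  constructor
  · exact hw2.trans (by gcongr; linarith)
  · exact hx1.trans (by gcongr; linarith)

lemma abs_cube_sub_le {x y M : ℝ} (hx : |x| ≤ M) (hy : |y| ≤ M) :
    |x ^ 3 - y ^ 3| ≤ |x - y| * (3 * M ^ 2) := by
  have hM : 0 ≤ M := (abs_nonneg x).trans hx
  rw [show x ^ 3 - y ^ 3 = (x - y) * (x ^ 2 + x * y + y ^ 2) by ring, abs_mul]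
  gcongr
  refine (abs_add_three _ _ _).trans ?_
  rw [abs_mul, abs_pow, abs_pow]
  linarith [pow_le_pow_left₀ (abs_nonneg _) hx 2, pow_le_pow_left₀ (abs_nonneg _) hy 2,
    mul_le_mul hx hy (abs_nonneg _) hM]

/-- Error bookkeeping with t = ‖v‖, β = ‖b‖ and m = |μ| + C₁t². Pure powers of t receive the small
factor ε, while every monomial containing β has a coefficient independent of ε; this is why ε ≤ 1 is
required. -/
lemma cubic_error_le {κ ε a C₁ m t β : ℝ} (hκ : 0 < κ) (hε : 0 < ε) (hε1 : ε ≤ 1) (ha : 0 ≤ a)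
    (hC₁ : 0 ≤ C₁) (hm : a * m ≤ ε / (2 * κ)) (ht : 0 ≤ t) (hβ : 0 ≤ β) :
    κ * (ε / (2 * κ) * (t + β) ^ 3 + a * (t + β) ^ 2 * (m * t + C₁ * β)) ≤
      ε * t ^ 3 + (3 + κ * (2 * a * C₁)) * (β * t ^ 2 + β ^ 2 * t + β ^ 3) := by
  obtain ⟨E, hE⟩ : ∃ E, E = β * t ^ 2 + β ^ 2 * t + β ^ 3 := ⟨_, rfl⟩
  have p1 : 0 ≤ β * t ^ 2 := by positivity
  have p2 : 0 ≤ β ^ 2 * t := by positivity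
  have p3 : 0 ≤ β ^ 3 := by positivity
  have hE0 : 0 ≤ E := by rw [hE]; positivity
  have e1 : (t + β) ^ 3 ≤ t ^ 3 + 3 * E := by rw [hE]; linarith
  have e2 : (t + β) ^ 2 * t ≤ t ^ 3 + 2 * E := by rw [hE]; linarith
  have e3 : (t + β) ^ 2 * β ≤ 2 * E := by rw [hE]; linarith
  rw [← hE]
  calc _ = κ * (ε / (2 * κ) * (t + β) ^ 3 + a * m * ((t + β) ^ 2 * t)
        + a * C₁ * ((t + β) ^ 2 * β)) := by ring
    _ ≤ κ * (ε / (2 * κ) * (t ^ 3 + 3 * E) + ε / (2 * κ) * (t ^ 3 + 2 * E)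
        + a * C₁ * (2 * E)) := by gcongr
    _ = ε * t ^ 3 + (5 / 2 * ε + κ * (2 * a * C₁)) * E := by field_simp; ring
    _ ≤ _ := by gcongr; linarith

/-! ### A priori bounds and cubic expansion for solutions of the range equation -/

section reduction

variable {S : ℝ → ℝ} {d : ℝ} {c : ZMod K → ℝ} {k : ℕ} (hd : 0 < d)
    (hSodd : ∀ x, S (-x) = -S x) (hS : ContDiff ℝ 3 S) (hS1 : deriv S 0 = 1)
    (hc : ∀ j, c (-j) = c j) (hpos : 0 < eigenvalue c k)
    (hdom : ∀ m ≤ K / 2, m ≠ k → eigenvalue c m < eigenvalue c k)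
include hd hSodd hS hS1 hc hpos hdom

/-- A priori bounds for small solutions of the range equation. -/
lemma exists_range_bound :
    ∃ C > 0, ∃ ρ > 0, ∀ v ∈ criticalSpace K k, ∀ w ∈ (criticalSpace K k)ᗮ, ∀ (α : ℝ) (b : State K),
      ‖v‖ < ρ → ‖w‖ < ρ → |α - criticalGain d c k| < ρ → ‖b‖ < ρ →
      vectorField S d c α b (v + w) - proj k (vectorField S d c α b (v + w)) = 0 →
      ‖w‖ ≤ C * (‖b‖ + ‖v‖ ^ 3) ∧ ‖netInput c α b (v + w)‖ ≤ C * (‖v‖ + ‖b‖) ∧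
      ‖netInput c α b (v + w) - d • v‖ ≤ |onset d c k α| * ‖v‖ + C * (‖b‖ + ‖v‖ ^ 3) := by
  obtain ⟨γ, hγ, ρ₁, hρ₁, hcoer⟩ := exists_coercive hd hc hpos hdom
  obtain ⟨C₁, hC₁, ρ₂, hρ₂, hres⟩ := exists_norm_residual_le (K := K) hSodd hS hS1
  have hcrit : 0 < criticalGain d c k := div_pos hd hpos
  obtain ⟨L, hL⟩ : ∃ L, L = (criticalGain d c k + 1) * ‖coupling c‖ + 1 := ⟨_, rfl⟩
  have hL1 : 1 ≤ L := by
    have := mul_nonneg (add_pos hcrit one_pos).le (norm_nonneg (coupling c))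
    linarith
  have hL0 : 0 < L := by linarith
  obtain ⟨C₂, hC₂, q, hq, habs⟩ := exists_absorb_cubic hγ hC₁ hL1
  refine ⟨L * C₂ + C₂ + 1, by positivity, min (min 1 ρ₁) (min (ρ₂ / (3 * L)) q),
    by positivity, ?_⟩
  intro v hv w hw α b hvρ hwρ hαρ hbρ hrange
  simp only [lt_min_iff] at hvρ hwρ hαρ hbρ
  obtain ⟨hα0, hcw⟩ := hcoer α hαρ.1.2
  have hcw := hcw w hw
  -- The range equation says that the vector field lies in E_c.
  have hin : inner ℝ w (vectorField S d c α b (v + w)) = 0 := by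
    rw [sub_eq_zero.1 hrange, real_inner_comm]
    exact inner_eq_zero_of_mem (proj_mem k _) hw
  rw [inner_vectorField hc hv hw] at hin
  have hnet := netInput_add (w := w) hc hv α b
  have hα1 : α ≤ criticalGain d c k + 1 := by have := (abs_lt.1 hαρ.1.1).2; linarith
  have hAw : ∀ u : State K, ‖α • coupling c u‖ ≤ (L - 1) * ‖u‖ := fun u => by
    rw [norm_smul, norm_eq_abs, abs_of_pos hα0]
    calc α * ‖coupling c u‖ ≤ (criticalGain d c k + 1) * (‖coupling c‖ * ‖u‖) := by
          gcongr; exact (coupling c).le_opNorm u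
      _ = _ := by rw [hL]; ring
  have hv0 := norm_nonneg v
  have hw0 := norm_nonneg w
  have hb0 := norm_nonneg b
  have hxL : ‖netInput c α b (v + w)‖ ≤ L * (‖v‖ + ‖w‖ + ‖b‖) := by
    have h1 : ‖netInput c α b (v + w)‖ ≤ ‖α • coupling c (v + w)‖ + ‖b‖ := norm_add_le _ _
    have h2 : (L - 1) * ‖v + w‖ ≤ (L - 1) * (‖v‖ + ‖w‖) :=
      mul_le_mul_of_nonneg_left (norm_add_le _ _) (by linarith)
    have h3 : 0 ≤ (L - 1) * ‖b‖ := mul_nonneg (by linarith) hb0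
    linarith [hAw (v + w)]
  generalize netInput c α b (v + w) = x at *
  have hxρ : ‖x‖ < ρ₂ := by
    calc ‖x‖ ≤ L * (‖v‖ + ‖w‖ + ‖b‖) := hxL
      _ < L * (3 * (ρ₂ / (3 * L))) := by
        refine mul_lt_mul_of_pos_left ?_ hL0
        linarith [hvρ.2.1, hwρ.2.1, hbρ.2.1]
      _ = ρ₂ := by field_simp
  have hn := hres x hxρ
  have hmain : γ * ‖w‖ ≤ ‖b‖ + C₁ * ‖x‖ ^ 3 := by
    rcases hw0.eq_or_lt with h | h
    · rw [← h, mul_zero]; positivity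
    · have h1 := real_inner_le_norm w b
      have h2 := real_inner_le_norm w (residual S x)
      refine le_of_mul_le_mul_right ?_ h
      linarith [mul_le_mul_of_nonneg_left hn hw0]
  obtain ⟨hw2, hx1⟩ := habs ‖v‖ ‖w‖ ‖b‖ ‖x‖ hv0 hw0 hb0 (norm_nonneg x) hvρ.2.2 hwρ.2.2 hbρ.2.2
    hxL hmain
  have hLC : 0 ≤ L * C₂ := by positivity
  have hE : 0 ≤ ‖b‖ + ‖v‖ ^ 3 := by positivity
  refine ⟨hw2.trans (by gcongr; linarith), hx1.trans (by gcongr; linarith), ?_⟩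
  -- The critical part of αA(v + w) is αλ_k v = (d + μ) v.
  have e : x - d • v = onset d c k α • v + (α • coupling c w + b) := by
    rw [hnet, onset]; module
  rw [e]
  have h1 : ‖onset d c k α • v + (α • coupling c w + b)‖ ≤
      |onset d c k α| * ‖v‖ + (‖α • coupling c w‖ + ‖b‖) := by
    rw [← norm_eq_abs, ← norm_smul]
    exact (norm_add_le _ _).trans (by gcongr; exact norm_add_le _ _)
  have h2 : (L - 1) * ‖w‖ ≤ (L - 1) * (C₂ * (‖b‖ + ‖v‖ ^ 3)) :=
    mul_le_mul_of_nonneg_left hw2 (by linarith)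
  have h3 : 0 ≤ C₂ * (‖b‖ + ‖v‖ ^ 3) := by positivity
  have h4 : 0 ≤ ‖v‖ ^ 3 := by positivity
  linarith [hAw w]

/-- Expansion of the critical component of the vector field on small solutions of the range
equation. -/
lemma exists_critical_expansion (h2 : ¬ K ∣ 2 * k) (h4 : ¬ K ∣ 4 * k) :
    ∃ C > 0, ∀ ε > 0, ∃ ρ > 0, ∀ v ∈ criticalSpace K k, ∀ w ∈ (criticalSpace K k)ᗮ,
      ∀ (α : ℝ) (b : State K),
      ‖v‖ < ρ → ‖w‖ < ρ → |α - criticalGain d c k| < ρ → ‖b‖ < ρ →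
      vectorField S d c α b (v + w) - proj k (vectorField S d c α b (v + w)) = 0 →
      ‖proj k (vectorField S d c α b (v + w))
          - ((onset d c k α + cubicCoeff S d c k / K * ‖v‖ ^ 2) • v + proj k b)‖
        ≤ ε * ‖v‖ ^ 3 + C * (‖b‖ * ‖v‖ ^ 2 + ‖b‖ ^ 2 * ‖v‖ + ‖b‖ ^ 3) := by
  obtain ⟨C₁, hC₁, ρ₁, hρ₁, hrb⟩ := exists_range_bound hd hSodd hS hS1 hc hpos hdom
  have hK : (0 : ℝ) < K := Nat.cast_pos.2 (NeZero.pos K)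
  obtain ⟨s, hs⟩ : ∃ s, s = iteratedDeriv 3 S 0 := ⟨_, rfl⟩
  obtain ⟨D, hD⟩ : ∃ D, D = C₁ + d := ⟨_, rfl⟩
  have hD0 : 0 < D := by rw [hD]; positivity
  obtain ⟨a, ha⟩ : ∃ a, a = |s / 6| * 3 * D ^ 2 := ⟨_, rfl⟩
  have ha0 : 0 ≤ a := by rw [ha]; positivity
  refine ⟨3 + K * (2 * a * C₁), by positivity, ?_⟩
  intro ε₀ hε₀
  obtain ⟨ε, hε, hε1, hεε⟩ : ∃ ε > 0, ε ≤ 1 ∧ ε ≤ ε₀ :=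
    ⟨min 1 ε₀, by positivity, min_le_left _ _, min_le_right _ _⟩
  obtain ⟨ρ₂, hρ₂, hexp⟩ := exists_expansion hSodd hS hS1 (ε := ε / (2 * K * D ^ 3)) (by positivity)
  rw [← hs] at hexp
  -- Below this radius a(|μ| + C₁‖v‖²) ≤ ε/(2K), with |μ| ≤ q λ_k. The factor K anticipates the
  -- passage from components to the norm.
  obtain ⟨q, hq⟩ : ∃ q, q = ε / (2 * K * (a + 1) * (eigenvalue c k + C₁)) := ⟨_, rfl⟩
  have hq0 : 0 < q := by rw [hq]; positivity
  refine ⟨min (min 1 ρ₁) (min (ρ₂ / (2 * D)) q), by positivity, ?_⟩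
  intro v hv w hw α b hvρ hwρ hαρ hbρ hrange
  simp only [lt_min_iff] at hvρ hwρ hαρ hbρ
  obtain ⟨-, hx1, hxv⟩ := hrb v hv w hw α b hvρ.1.2 hwρ.1.2 hαρ.1.2 hbρ.1.2 hrange
  rw [proj_vectorField hc hv hw]
  generalize netInput c α b (v + w) = x at *
  have hv0 := norm_nonneg v
  have hb0 := norm_nonneg b
  have hx2 : ‖x‖ ≤ D * (‖v‖ + ‖b‖) := hx1.trans (by gcongr; linarith)
  have hdv : ‖d • v‖ ≤ D * (‖v‖ + ‖b‖) := by
    rw [norm_smul, norm_eq_abs, abs_of_pos hd, hD]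
    nlinarith
  have hxρ : ‖x‖ < ρ₂ := by
    calc ‖x‖ ≤ D * (‖v‖ + ‖b‖) := hx2
      _ < D * (2 * (ρ₂ / (2 * D))) := by
        refine mul_lt_mul_of_pos_left ?_ hD0
        linarith [hvρ.2.1, hbρ.2.1]
      _ = ρ₂ := by field_simp
  have hμ : a * (|onset d c k α| + C₁ * ‖v‖ ^ 2) ≤ ε / (2 * K) := by
    rw [onset_eq hpos, abs_mul, abs_of_pos hpos]
    have h1 : ‖v‖ ^ 2 ≤ q := by nlinarith [hvρ.1.1, hvρ.2.2]
    calc _ ≤ (a + 1) * (q * eigenvalue c k + C₁ * q) := by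
          gcongr
          · linarith
          · exact hαρ.2.2.le
      _ = _ := by rw [hq]; field_simp
  have hn : ‖residual S x - (s / 6 * d ^ 3) • (WithLp.toLp 2 fun j => v j ^ 3 : State K)‖ ≤
      ε * ‖v‖ ^ 3 + (3 + K * (2 * a * C₁)) *
        (‖b‖ * ‖v‖ ^ 2 + ‖b‖ ^ 2 * ‖v‖ + ‖b‖ ^ 3) := by
    refine le_trans (norm_le_of_forall_abs_le fun j => ?_)
      (cubic_error_le hK hε hε1 ha0 hC₁.le hμ hv0 hb0)
    have hj := abs_apply_le_norm x j
    have hj2 := (abs_apply_le_norm (d • v) j).trans hdv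
    have hj3 := (abs_apply_le_norm (x - d • v) j).trans hxv
    simp only [PiLp.sub_apply, PiLp.smul_apply, smul_eq_mul] at hj2 hj3
    have hj1 := hj.trans hx2
    have h1 := hexp (x j) (hj.trans_lt hxρ)
    have hcube := abs_cube_sub_le hj1 hj2
    calc _ = |(S (x j) - x j - s / 6 * x j ^ 3) + s / 6 * (x j ^ 3 - (d * v j) ^ 3)| := by
          simp only [residual, PiLp.sub_apply, PiLp.smul_apply, smul_eq_mul]; ring_nf
      _ ≤ |S (x j) - x j - s / 6 * x j ^ 3| + |s / 6 * (x j ^ 3 - (d * v j) ^ 3)| :=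
          abs_add_le _ _
      _ ≤ ε / (2 * K * D ^ 3) * (D * (‖v‖ + ‖b‖)) ^ 3 + |s / 6| *
          ((|onset d c k α| * ‖v‖ + C₁ * (‖b‖ + ‖v‖ ^ 3)) * (3 * (D * (‖v‖ + ‖b‖)) ^ 2)) := by
          rw [abs_mul]
          refine add_le_add (h1.trans (by gcongr)) ?_
          exact mul_le_mul_of_nonneg_left (hcube.trans
            (mul_le_mul_of_nonneg_right hj3 (by positivity))) (abs_nonneg _)
      _ = _ := by rw [ha]; field_simp; ring
  have e : onset d c k α • v + proj k b + proj k (residual S x)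
      - ((onset d c k α + cubicCoeff S d c k / K * ‖v‖ ^ 2) • v + proj k b) =
      proj k (residual S x - (s / 6 * d ^ 3) • (WithLp.toLp 2 fun j => v j ^ 3 : State K)) := by
    rw [proj_sub, proj_smul, proj_cube h2 h4 hv, smul_smul, cubicCoeff_eq S hpos, ← hs]
    -- The Taylor factor 1/6 times the isotropy constant 3/(2K) gives the 1/4 in Γ.
    have : s / 6 * d ^ 3 * (3 / (2 * K) * ‖v‖ ^ 2) = s / 4 * d ^ 3 / K * ‖v‖ ^ 2 := by
      field_simp; ring
    rw [this]
    module
  rw [e]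
  exact (norm_proj_le k _).trans (hn.trans (by gcongr))

end reduction

/-! ### Lyapunov–Schmidt reduction -/

/-- The Jacobian of the vector field at a state with net input `x`. -/
noncomputable def jacobian (S : ℝ → ℝ) (d : ℝ) (c : ZMod K → ℝ) (α : ℝ) (x : State K) :
    State K →L[ℝ] State K :=
  -d • ContinuousLinearMap.id ℝ (State K) +
    (Matrix.toEuclideanCLM (𝕜 := ℝ) (Matrix.diagonal fun j => deriv S (x j))) ∘L (α • coupling c)

lemma jacobian_apply (S : ℝ → ℝ) (d : ℝ) (c : ZMod K → ℝ) (α : ℝ) (x u : State K) (j : ZMod K) :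
    jacobian S d c α x u j = -d * u j + deriv S (x j) * (α * coupling c u j) := by
  simp [jacobian, Matrix.ofLp_toEuclideanCLM, Matrix.mulVec_diagonal]
  ring

lemma hasFDerivAt_vectorField {S : ℝ → ℝ} (hS : ContDiff ℝ 3 S) (d : ℝ) (c : ZMod K → ℝ) (α : ℝ)
    (b z : State K) :
    HasFDerivAt (vectorField S d c α b) (jacobian S d c α (netInput c α b z)) z := by
  rw [← hasFDerivWithinAt_univ, hasFDerivWithinAt_euclidean]
  intro j
  have h1 : HasFDerivAt (fun y : State K => y j) (PiLp.proj 2 (fun _ => ℝ) j : State K →L[ℝ] ℝ) z :=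
    (PiLp.proj 2 (fun _ => ℝ) j : State K →L[ℝ] ℝ).hasFDerivAt
  have h2 : HasFDerivAt (fun y : State K => netInput c α b y j)
      ((PiLp.proj 2 (fun _ => ℝ) j : State K →L[ℝ] ℝ) ∘L (α • coupling c)) z := by
    have := (((PiLp.proj 2 (fun _ => ℝ) j : State K →L[ℝ] ℝ) ∘L (α • coupling c)).hasFDerivAt
      (x := z)).add_const (b j)
    exact this
  have h3 := (h1.const_mul (-d)).add
    ((hasDerivAt_of_contDiff hS (netInput c α b z j)).comp_hasFDerivAt z h2)
  refine (h3.congr_fderiv ?_).hasFDerivWithinAt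
  ext u
  simp [jacobian_apply]

lemma contDiff_vectorField {S : ℝ → ℝ} (hS : ContDiff ℝ 3 S) (d : ℝ) (c : ZMod K → ℝ) :
    ContDiff ℝ 1 fun p : (State K × ℝ × State K) × State K =>
      vectorField S d c p.1.2.1 p.1.2.2 (p.1.1 + p.2) := by
  rw [contDiff_euclidean]
  intro j
  have hS' : ContDiff ℝ 1 S := hS.of_le (by norm_num)
  have h1 : ContDiff ℝ 1 fun p : (State K × ℝ × State K) × State K => (p.1.1 + p.2) j := by
    fun_prop
  have h2 : ContDiff ℝ 1 fun p : (State K × ℝ × State K) × State K =>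
      coupling c (p.1.1 + p.2) j := by
    have : ContDiff ℝ 1 fun p : (State K × ℝ × State K) × State K =>
      ((PiLp.proj 2 (fun _ => ℝ) j : State K →L[ℝ] ℝ) ∘L (coupling c)) (p.1.1 + p.2) := by fun_prop
    exact this
  have h3 : ContDiff ℝ 1 fun p : (State K × ℝ × State K) × State K =>
      p.1.2.1 * coupling c (p.1.1 + p.2) j + p.1.2.2 j := by fun_prop
  exact (contDiff_const.mul h1).add (hS'.comp h3)

lemma isInvertible_of_injective (M : State K →L[ℝ] State K) (h : ∀ w, M w = 0 → w = 0) :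
    M.IsInvertible := by
  have hinj : Function.Injective (M : State K →ₗ[ℝ] State K) :=
    (injective_iff_map_eq_zero _).2 h
  exact ⟨(LinearEquiv.ofInjectiveEndo _ hinj).toContinuousLinearEquiv, by ext; rfl⟩

lemma abs_sub_add_le_add {x y z a b : ℝ} (h1 : |x - y| ≤ a) (h2 : |z| ≤ b) :
    |x - (y + z)| ≤ a + b := by
  rw [← sub_sub]
  exact (abs_sub _ _).trans (add_le_add h1 h2)

section reduction

variable {S : ℝ → ℝ} {d : ℝ} {c : ZMod K → ℝ} {k : ℕ} (hd : 0 < d)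
    (hSodd : ∀ x, S (-x) = -S x) (hS : ContDiff ℝ 3 S) (hS1 : deriv S 0 = 1)
    (hc : ∀ j, c (-j) = c j) (hpos : 0 < eigenvalue c k)
    (hdom : ∀ m ≤ K / 2, m ≠ k → eigenvalue c m < eigenvalue c k)
include hd hSodd hS hS1 hc hpos hdom

/-- Existence of the reduction map, which is continuous at the bifurcation point. -/
lemma exists_reductionMap :
    ∃ (W : State K → ℝ → State K → State K) (ρ ρ' : ℝ), 0 < ρ ∧ 0 < ρ' ∧
      IsReductionMap S d c k W ρ ρ' ∧
      ∀ ε > 0, ∃ ρ₁ > 0, ∀ (v : State K) (α : ℝ) (b : State K), ‖v‖ < ρ₁ →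
        |α - criticalGain d c k| < ρ₁ → ‖b‖ < ρ₁ → ‖W v α b‖ < ε := by
  obtain ⟨γ, hγ, ρ₀, hρ₀, hcoer⟩ := exists_coercive hd hc hpos hdom
  obtain ⟨-, hcoer⟩ := hcoer (criticalGain d c k) (by simpa using hρ₀)
  set P : State K →L[ℝ] State K := (criticalSpace K k).starProjection with hP
  -- The two summands lie in E_c and E_s, so Φ = 0 encodes both w ∈ E_s and the range equation, and
  -- the implicit function theorem applies on the whole space.
  set Φ : (State K × ℝ × State K) × State K → State K := fun p =>
    P p.2 + (vectorField S d c p.1.2.1 p.1.2.2 (p.1.1 + p.2)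
      - P (vectorField S d c p.1.2.1 p.1.2.2 (p.1.1 + p.2))) with hΦ
  have hcd : ContDiff ℝ 1 Φ := by
    have := contDiff_vectorField hS d c
    fun_prop
  set u : (State K × ℝ × State K) × State K := ((0, criticalGain d c k, 0), 0) with hu
  have hstrict := (hcd.contDiffAt (x := u)).hasStrictFDerivAt one_ne_zero
  have hnet0 : netInput c (criticalGain d c k) 0 (0 : State K) = 0 := by simp [netInput]
  have hpart : fderiv ℝ Φ u ∘L .inr ℝ (State K × ℝ × State K) (State K) =
      P + (jacobian S d c (criticalGain d c k) 0 - P ∘L jacobian S d c (criticalGain d c k) 0) := by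
    have h1 : HasFDerivAt (fun w : State K => Φ ((0, criticalGain d c k, 0), w))
        (fderiv ℝ Φ u ∘L .inr ℝ (State K × ℝ × State K) (State K)) 0 :=
      HasFDerivAt.comp (g := Φ) (0 : State K) hstrict.hasFDerivAt
        (hasFDerivAt_prodMk_right (0, criticalGain d c k, 0) (0 : State K))
    have h2 : HasFDerivAt (fun w : State K => Φ ((0, criticalGain d c k, 0), w))
        (P + (jacobian S d c (criticalGain d c k) 0
          - P ∘L jacobian S d c (criticalGain d c k) 0)) 0 := by
      have hF := hasFDerivAt_vectorField hS d c (criticalGain d c k) 0 (0 : State K)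
      rw [hnet0] at hF
      have h3 := P.hasFDerivAt.add (hF.sub (P.hasFDerivAt.comp (0 : State K) hF))
      refine h3.congr_of_eventuallyEq (Eventually.of_forall fun w => ?_)
      simp [hΦ]
    exact h1.unique h2
  have hjac : ∀ w : State K, jacobian S d c (criticalGain d c k) 0 w =
      -(d • w - criticalGain d c k • coupling c w) := by
    intro w
    ext j
    rw [jacobian_apply]
    simp [hS1]
    ring
  have hinv : (fderiv ℝ Φ u ∘L .inr ℝ (State K × ℝ × State K) (State K)).IsInvertible := by
    rw [hpart]
    -- Projecting a kernel equation first puts w in E_s; there the derivative is -(d - α_c A), which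
    -- is injective by coercivity.
    refine isInvertible_of_injective _ fun w hw => ?_
    change proj k w + (jacobian S d c (criticalGain d c k) 0 w
      - proj k (jacobian S d c (criticalGain d c k) 0 w)) = 0 at hw
    have hPw : proj k w = 0 := by
      have := congrArg (proj k) hw
      rw [proj_add, proj_of_mem (proj_mem k w), proj_of_mem_orthogonal (sub_proj_mem k _),
        add_zero] at this
      rw [this]; exact map_zero P
    have hwo : w ∈ (criticalSpace K k)ᗮ := by
      have := sub_proj_mem k w
      rwa [hPw, sub_zero] at this
    have hJo : jacobian S d c (criticalGain d c k) 0 w ∈ (criticalSpace K k)ᗮ := by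
      rw [hjac]
      exact Submodule.neg_mem _ (Submodule.sub_mem _ (Submodule.smul_mem _ _ hwo)
        (Submodule.smul_mem _ _ (coupling_mem_orthogonal hc hwo)))
    rw [hPw, proj_of_mem_orthogonal hJo, zero_add, sub_zero, hjac, neg_eq_zero] at hw
    have := hcoer w hwo
    rw [hw, inner_zero_right] at this
    have h0 : ‖w‖ ^ 2 ≤ 0 := nonpos_of_mul_nonpos_right this hγ
    simpa using h0
  set ψ := hstrict.implicitFunctionOfProdDomain hinv
  have hΦu : Φ u = 0 := by
    have : vectorField S d c (criticalGain d c k) 0 (0 : State K) = 0 := by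
      ext j
      rw [vectorField_apply, hnet0]
      simp [odd_zero hSodd]
    simp [hΦ, hu, this]
  have hiff := hstrict.eventually_apply_eq_iff_implicitFunctionOfProdDomain hinv
  have htend : Tendsto ψ (𝓝 u.1) (𝓝 u.2) := hstrict.tendsto_implicitFunctionOfProdDomain hinv
  have hsmall : ∀ ε > 0, ∃ ρ₁ > 0, ∀ (v : State K) (α : ℝ) (b : State K), ‖v‖ < ρ₁ →
        |α - criticalGain d c k| < ρ₁ → ‖b‖ < ρ₁ → ‖ψ (v, α, b)‖ < ε := by
    intro ε hε
    obtain ⟨ρ₁, hρ₁, h⟩ := Metric.tendsto_nhds_nhds.1 htend ε hε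
    refine ⟨ρ₁, hρ₁, fun v α b hv hα hb => ?_⟩
    have := h (x := (v, α, b)) (by simp [hu, Prod.dist_eq, Real.dist_eq, hv, hα, hb])
    simpa [hu] using this
  obtain ⟨r₀, hr₀, hball⟩ := Metric.eventually_nhds_iff.1 hiff
  obtain ⟨ρ₁, hρ₁, hψ⟩ := hsmall r₀ hr₀
  -- The implicit function characterizes solutions in the ball of radius r₀, and ρ₁ keeps its own
  -- values inside that ball.
  refine ⟨fun v α b => ψ (v, α, b), min r₀ ρ₁, r₀, by positivity, hr₀, ?_, hsmall⟩
  intro v hv α b hvρ hαρ hbρ w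
  simp only [lt_min_iff] at hvρ hαρ hbρ
  have hequiv : ∀ w : State K, ‖w‖ < r₀ → (Φ ((v, α, b), w) = 0 ↔ ψ (v, α, b) = w) := by
    intro w hw
    rw [← hΦu]
    exact hball (y := ((v, α, b), w))
      (by simp [hu, Prod.dist_eq, Real.dist_eq, hvρ.1, hαρ.1, hbρ.1, hw])
  constructor
  · rintro ⟨hwo, hwρ, heq⟩
    refine ((hequiv w hwρ).1 ?_).symm
    change proj k w + _ = 0
    rw [proj_of_mem_orthogonal hwo, zero_add]
    exact heq
  · intro hw
    have hwρ : ‖w‖ < r₀ := by rw [hw]; exact hψ v α b hvρ.2 hαρ.2 hbρ.2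
    have h0 := (hequiv w hwρ).2 hw.symm
    change proj k w + (vectorField S d c α b (v + w)
      - proj k (vectorField S d c α b (v + w))) = 0 at h0
    have hPw : proj k w = 0 := by
      have := congrArg (proj k) h0
      rw [proj_add, proj_of_mem (proj_mem k w), proj_of_mem_orthogonal (sub_proj_mem k _),
        add_zero] at this
      rw [this]; exact map_zero P
    rw [hPw, zero_add] at h0
    refine ⟨?_, hwρ, h0⟩
    have := sub_proj_mem k w
    rwa [hPw, sub_zero] at this

omit hd hSodd hS hS1 hc hpos hdom in
lemma abs_pairing_direction_le (h2 : ¬ K ∣ 2 * k) (u : State K) (θ : ℝ) :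
    |pairing u (direction k θ)| ≤ ‖u‖ := by
  have hK : (1 : ℝ) ≤ K := Nat.one_le_cast.2 (NeZero.pos K)
  rw [pairing_eq_inner, abs_mul, abs_of_nonneg (by positivity : (0 : ℝ) ≤ 1 / K)]
  have h := abs_real_inner_le_norm u (direction k θ)
  rw [norm_direction h2] at h
  have hs : √(K : ℝ) ≤ K := by
    rw [sqrt_le_left (by positivity)]; nlinarith
  calc 1 / (K : ℝ) * |inner ℝ u (direction k θ)| ≤ 1 / (K : ℝ) * (‖u‖ * K) := by
        gcongr; exact h.trans (by gcongr)
    _ = ‖u‖ := by field_simp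

omit hd hSodd hS hS1 hc hpos hdom [NeZero K] in
-- Both amplitudes are O(‖b‖), so the η terms of the polar equations are O(‖b‖ r²) and belong to the
-- error.
lemma abs_mixed_le {η r A A' B x y : ℝ} (hA : 0 ≤ A) (hA' : 0 ≤ A') (hB : A ≤ B)
    (hB' : A' ≤ B) (hx : |x| ≤ 1) (hy : |y| ≤ 1) :
    |η * r ^ 2 / √2 * (3 * A * x + A' * y)| ≤ 4 * |η| * (B * r ^ 2) := by
  have h2 : (1 : ℝ) ≤ √2 := one_le_sqrt.2 (by norm_num)
  have h1 : |3 * A * x + A' * y| ≤ 4 * B := by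
    refine (abs_add_le _ _).trans ?_
    rw [abs_mul, abs_mul A', abs_of_nonneg (by positivity : 0 ≤ 3 * A), abs_of_nonneg hA']
    nlinarith [mul_le_mul_of_nonneg_left hx hA, mul_le_mul_of_nonneg_left hy hA']
  have h3 : |η * r ^ 2 / √2| ≤ |η| * r ^ 2 := by
    rw [abs_div, abs_mul, abs_of_nonneg (sq_nonneg r), abs_of_nonneg (sqrt_nonneg 2)]
    exact div_le_self (by positivity) h2
  rw [abs_mul]
  calc _ ≤ |η| * r ^ 2 * (4 * B) := by gcongr
    _ = _ := by ring

/-- Leading-order form of the reduced map. -/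
theorem exists_reduced_expansion (h2 : ¬ K ∣ 2 * k) (h4 : ¬ K ∣ 4 * k) :
    ∃ (W : State K → ℝ → State K → State K) (ρ ρ' C : ℝ), 0 < ρ ∧ 0 < ρ' ∧
      IsReductionMap S d c k W ρ ρ' ∧
      ∀ ε > 0, ∃ ρ₁ > 0, ∀ (r θ α : ℝ) (b : State K),
        0 ≤ r → r < ρ₁ → |α - criticalGain d c k| < ρ₁ → ‖b‖ < ρ₁ →
        (‖reducedMap S d c k W (r • direction k θ) α b
            - ((onset d c k α * r + cubicCoeff S d c k * r ^ 3) • direction k θ + proj k b)‖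
          ≤ ε * r ^ 3 + C * (‖b‖ * r ^ 2 + ‖b‖ ^ 2 * r + ‖b‖ ^ 3)) ∧
        |pairing (reducedMap S d c k W (r • direction k θ) α b) (direction k θ)
            - polarRadial S d c k α b r θ|
          ≤ ε * r ^ 3 + C * (‖b‖ * r ^ 2 + ‖b‖ ^ 2 * r + ‖b‖ ^ 3) ∧
        |pairing (reducedMap S d c k W (r • direction k θ) α b) (direction k (θ + π / 2))
            - polarAngular S d c k b r θ|
          ≤ ε * r ^ 3 + C * (‖b‖ * r ^ 2 + ‖b‖ ^ 2 * r + ‖b‖ ^ 3) := by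
  obtain ⟨W, ρ, ρ', hρ, hρ', hW, hWsmall⟩ := exists_reductionMap hd hSodd hS hS1 hc hpos hdom
  obtain ⟨C, hC, hexp⟩ := exists_critical_expansion hd hSodd hS hS1 hc hpos hdom h2 h4
  obtain ⟨B₁, hB₁, hA₁⟩ := exists_amplitude_le K k
  obtain ⟨B₃, hB₃, hA₃⟩ := exists_amplitude_le K (3 * k)
  have hK : (1 : ℝ) ≤ K := Nat.one_le_cast.2 (NeZero.pos K)
  set q := √(K : ℝ) with hq
  have hq1 : 1 ≤ q := one_le_sqrt.2 hK
  have hqK : q ^ 2 = K := sq_sqrt (by positivity)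
  set D := 4 * |mixedCoeff S d c k| * (B₁ + B₃) with hD
  have hD0 : 0 ≤ D := by positivity
  refine ⟨W, ρ, ρ', C * K + D, hρ, hρ', hW, fun ε hε => ?_⟩
  -- Here q = √K is the length of e_θ, so ‖v‖³ = q³r³.
  obtain ⟨ρ₂, hρ₂, hexp⟩ := hexp (ε / q ^ 3) (by positivity)
  obtain ⟨ρ₃, hρ₃, hWsmall⟩ := hWsmall ρ₂ hρ₂
  refine ⟨min ρ (min ρ₂ ρ₃) / q, by positivity, ?_⟩
  intro r θ α b hr hrρ hαρ hbρ
  have hle : min ρ (min ρ₂ ρ₃) / q ≤ min ρ (min ρ₂ ρ₃) := div_le_self (by positivity) hq1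
  have hα := hαρ.trans_le hle
  have hb := hbρ.trans_le hle
  have hvn : ‖r • (direction k θ : State K)‖ = q * r := by
    rw [norm_smul, norm_direction h2, norm_eq_abs, abs_of_nonneg hr, mul_comm]
  have hvρ : ‖r • (direction k θ : State K)‖ < min ρ (min ρ₂ ρ₃) := by
    rw [hvn, mul_comm]; exact (lt_div_iff₀ (by positivity)).1 hrρ
  have hmem : r • (direction k θ : State K) ∈ criticalSpace K k :=
    Submodule.smul_mem _ _ (direction_mem k θ)
  rw [lt_min_iff, lt_min_iff] at hα hb hvρ
  obtain ⟨hwo, -, hrange⟩ := (hW _ hmem α b hvρ.1 hα.1 hb.1 _).2 rfl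
  have hw := hWsmall (r • direction k θ) α b hvρ.2.2 hα.2.2 hb.2.2
  have hmain := hexp _ hmem _ hwo α b hvρ.2.1 hw hα.2.1 hb.2.1 hrange
  have hb0 := norm_nonneg b
  set E := ‖b‖ * r ^ 2 + ‖b‖ ^ 2 * r + ‖b‖ ^ 3 with hE
  have hE0 : 0 ≤ E := by positivity
  have hEb : ‖b‖ * r ^ 2 ≤ E := by
    have : 0 ≤ ‖b‖ ^ 2 * r + ‖b‖ ^ 3 := by positivity
    rw [hE]; linarith
  have hG : ‖reducedMap S d c k W (r • direction k θ) α b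
      - ((onset d c k α * r + cubicCoeff S d c k * r ^ 3) • direction k θ + proj k b)‖
      ≤ ε * r ^ 3 + C * K * E := by
    rw [hvn] at hmain
    have e : (onset d c k α + cubicCoeff S d c k / K * (q * r) ^ 2) • r • direction k θ =
        (onset d c k α * r + cubicCoeff S d c k * r ^ 3) • (direction k θ : State K) := by
      rw [smul_smul]
      congr 1
      rw [mul_pow, hqK]
      field_simp
    rw [e] at hmain
    refine hmain.trans ?_
    have e1 : ε / q ^ 3 * (q * r) ^ 3 = ε * r ^ 3 := by field_simp
    have e2 : ‖b‖ * (q * r) ^ 2 + ‖b‖ ^ 2 * (q * r) + ‖b‖ ^ 3 ≤ K * E := by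
      have hqK' : q ≤ K := by rw [← hqK]; nlinarith
      calc _ = K * (‖b‖ * r ^ 2) + q * (‖b‖ ^ 2 * r) + 1 * ‖b‖ ^ 3 := by rw [mul_pow, hqK]; ring
        _ ≤ K * (‖b‖ * r ^ 2) + K * (‖b‖ ^ 2 * r) + K * ‖b‖ ^ 3 := by gcongr
        _ = _ := by rw [hE]; ring
    rw [e1, mul_assoc]
    gcongr
  have hmixed : ∀ x y : ℝ, |x| ≤ 1 → |y| ≤ 1 →
      |mixedCoeff S d c k * r ^ 2 / √2 * (3 * amplitude b k * x + amplitude b (3 * k) * y)|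
        ≤ D * E := by
    intro x y hx hy
    refine (abs_mixed_le (B := (B₁ + B₃) * ‖b‖) (amplitude_nonneg _ _) (amplitude_nonneg _ _)
      ((hA₁ b).trans (by gcongr; linarith)) ((hA₃ b).trans (by gcongr; linarith)) hx hy).trans ?_
    calc _ = D * (‖b‖ * r ^ 2) := by rw [hD]; ring
      _ ≤ _ := by gcongr
  have hpair : ∀ θ' : ℝ, |pairing (reducedMap S d c k W (r • direction k θ) α b) (direction k θ')
      - ((onset d c k α * r + cubicCoeff S d c k * r ^ 3) * cos (θ' - θ)
        + amplitude b k / √2 * cos (θ' - phase b k))| ≤ ε * r ^ 3 + C * K * E := by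
    intro θ'
    refine le_trans (le_of_eq ?_) ((abs_pairing_direction_le h2 _ θ').trans hG)
    rw [← pairing_direction (K := K) h2, ← pairing_proj_direction h2]
    simp only [pairing_eq_inner, inner_sub_left, inner_add_left, real_inner_smul_left]
    congr 1
    ring
  refine ⟨hG.trans ?_, ?_, ?_⟩
  · nlinarith [mul_nonneg hD0 hE0]
  · have h1 := hpair θ
    have h3 := hmixed (cos (θ - phase b k)) (cos (3 * θ - phase b (3 * k))) (abs_cos_le_one _)
      (abs_cos_le_one _)
    rw [polarRadial]
    rw [sub_self, cos_zero, mul_one] at h1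
    refine (abs_sub_add_le_add h1 h3).trans (le_of_eq (by ring))
  · have h1 := hpair (θ + π / 2)
    have h3 := hmixed (sin (phase b k - θ)) (sin (phase b (3 * k) - 3 * θ)) (abs_sin_le_one _)
      (abs_sin_le_one _)
    rw [polarAngular]
    have e1 : cos (θ + π / 2 - θ) = 0 := by rw [add_sub_cancel_left, cos_pi_div_two]
    have e2 : cos (θ + π / 2 - phase b k) = sin (phase b k - θ) := by
      rw [show θ + π / 2 - phase b k = (θ - phase b k) + π / 2 by ring, cos_add_pi_div_two,
        ← sin_neg, neg_sub]
    rw [e1, e2, mul_zero, zero_add] at h1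
    refine (abs_sub_add_le_add h1 h3).trans (le_of_eq (by ring))

end reduction

/-! ### The angular equation -/

section phase

variable {a e p p₃ : ℝ}

lemma hasDerivAt_angular (a e p p₃ θ : ℝ) :
    HasDerivAt (fun θ => a * sin (p - θ) + e * sin (p₃ - 3 * θ))
      (-(a * cos (p - θ)) - 3 * e * cos (p₃ - 3 * θ)) θ := by
  have h1 := (((hasDerivAt_id θ).const_sub p).sin).const_mul a
  have h2 := ((((hasDerivAt_id θ).const_mul 3).const_sub p₃).sin).const_mul e
  exact (h1.add h2).congr_deriv (by simp; ring)

lemma abs_sin_le_of_angular_zero {θ : ℝ} (ha : 3 / 4 ≤ a)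
    (h : a * sin (p - θ) + e * sin (p₃ - 3 * θ) = 0) : |sin (p - θ)| ≤ 2 * |e| := by
  have h1 : a * |sin (p - θ)| ≤ |e| := by
    have : a * sin (p - θ) = -(e * sin (p₃ - 3 * θ)) := by linarith
    rw [← abs_of_nonneg (by linarith : 0 ≤ a), ← abs_mul, this, abs_neg, abs_mul]
    exact mul_le_of_le_one_right (abs_nonneg e) (abs_sin_le_one _)
  nlinarith [abs_nonneg (sin (p - θ))]

/-- A zero has |sin(p - θ)| ≤ 1/16, so it is near p or p + π; a negative derivative forces cos(p -
θ) > -1/8 and leaves only p. -/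
lemma half_le_cos_of_stable {θ : ℝ} (ha : 3 / 4 ≤ a) (he : |e| ≤ 1 / 32)
    (h : a * sin (p - θ) + e * sin (p₃ - 3 * θ) = 0)
    (h' : -(a * cos (p - θ)) - 3 * e * cos (p₃ - 3 * θ) < 0) : 1 / 2 ≤ cos (p - θ) := by
  have h1 := abs_sin_le_of_angular_zero ha h
  have h2 : |3 * e * cos (p₃ - 3 * θ)| ≤ 3 / 32 := by
    rw [abs_mul, abs_mul, abs_of_pos (by norm_num : (0 : ℝ) < 3)]
    nlinarith [abs_cos_le_one (p₃ - 3 * θ), abs_nonneg e, abs_nonneg (cos (p₃ - 3 * θ))]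
  have h3 := (abs_le.1 h2).2
  have h3' := (abs_le.1 h2).1
  have h4 : -(1 / 8) < cos (p - θ) := by
    by_contra hcon
    push Not at hcon
    nlinarith
  have h5 : sin (p - θ) ^ 2 ≤ 1 / 256 := by
    rw [← sq_abs]; nlinarith [abs_nonneg (sin (p - θ))]
  nlinarith [sin_sq_add_cos_sq (p - θ)]

/-- For cos(p - θ) ≥ 0 one has 1 - cos ≤ sin² ≤ |sin|. The bound is uniform in x, so it compares all
components of two critical vectors at once. -/
lemma abs_cos_sub_cos_le {x θ : ℝ} (h : 0 ≤ cos (p - θ)) :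
    |cos (x - θ) - cos (x - p)| ≤ 2 * |sin (p - θ)| := by
  have e : cos (x - θ) - cos (x - p) =
      -(cos (x - p) * (1 - cos (p - θ))) - sin (x - p) * sin (p - θ) := by
    rw [show x - θ = (x - p) + (p - θ) by ring, cos_add]; ring
  have h1 : |1 - cos (p - θ)| ≤ |sin (p - θ)| := by
    have h2 := cos_le_one (p - θ)
    rw [abs_of_nonneg (by linarith)]
    have h3 : |sin (p - θ)| ^ 2 ≤ |sin (p - θ)| := by
      nlinarith [abs_nonneg (sin (p - θ)), abs_sin_le_one (p - θ)]
    rw [sq_abs] at h3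
    nlinarith [sin_sq_add_cos_sq (p - θ)]
  rw [e]
  refine (abs_sub _ _).trans ?_
  rw [abs_neg, abs_mul, abs_mul]
  nlinarith [abs_cos_le_one (x - p), abs_sin_le_one (x - p), abs_nonneg (1 - cos (p - θ)),
    abs_nonneg (sin (p - θ))]

lemma half_le_cos_of_mem {θ : ℝ} (hθ : θ ∈ Set.Icc (p - π / 3) (p + π / 3)) :
    1 / 2 ≤ cos (p - θ) := by
  rw [← cos_abs, ← cos_pi_div_three]
  refine cos_le_cos_of_nonneg_of_le_pi (abs_nonneg _) (by linarith [pi_pos]) ?_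
  rw [abs_le]; constructor <;> linarith [hθ.1, hθ.2]

lemma angular_deriv_neg {θ : ℝ} (ha : 3 / 4 ≤ a) (he : |e| ≤ 1 / 32)
    (hθ : 1 / 2 ≤ cos (p - θ)) : -(a * cos (p - θ)) - 3 * e * cos (p₃ - 3 * θ) < 0 := by
  have h2 : |3 * e * cos (p₃ - 3 * θ)| ≤ 3 / 32 := by
    rw [abs_mul, abs_mul, abs_of_pos (by norm_num : (0 : ℝ) < 3)]
    nlinarith [abs_cos_le_one (p₃ - 3 * θ), abs_nonneg e, abs_nonneg (cos (p₃ - 3 * θ))]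
  have := (abs_le.1 h2).1
  nlinarith

lemma exists_angle_rep {θ : ℝ} (h : 1 / 2 ≤ cos (p - θ)) :
    ∃ θ' ∈ Set.Icc (p - π / 3) (p + π / 3), ∃ n : ℤ, θ' = θ + n * (2 * π) := by
  obtain ⟨n, hn⟩ : ∃ n : ℤ, (θ - p) + n * (2 * π) ∈ Set.Ioc (-π) π := by
    refine ⟨-toIocDiv two_pi_pos (-π) (θ - p), ?_⟩
    have := toIocMod_mem_Ioc two_pi_pos (-π) (θ - p)
    rw [toIocMod, zsmul_eq_mul] at this
    push_cast
    constructor <;> linarith [this.1, this.2]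
  refine ⟨θ + n * (2 * π), ?_, n, rfl⟩
  have hc : cos ((θ - p) + n * (2 * π)) = cos (p - θ) := by
    rw [cos_add_int_mul_two_pi, ← cos_neg, neg_sub]
  have habs : |(θ - p) + n * (2 * π)| ≤ π / 3 := by
    by_contra hcon
    push Not at hcon
    have := cos_lt_cos_of_nonneg_of_le_pi (by positivity) (abs_le.2 ⟨hn.1.le, hn.2⟩) hcon
    rw [cos_abs, hc, cos_pi_div_three] at this
    linarith
  have := abs_le.1 habs
  constructor <;> linarith

/-- A perturbed sine has exactly one descending zero modulo `2π`. -/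
lemma existsUnique_stable_angle (ha : 3 / 4 ≤ a) (he : |e| ≤ 1 / 32) :
    ∃ θ, (a * sin (p - θ) + e * sin (p₃ - 3 * θ) = 0 ∧
        -(a * cos (p - θ)) - 3 * e * cos (p₃ - 3 * θ) < 0) ∧
      ∀ θ', a * sin (p - θ') + e * sin (p₃ - 3 * θ') = 0 →
        -(a * cos (p - θ')) - 3 * e * cos (p₃ - 3 * θ') < 0 →
        (θ' : Real.Angle) = (θ : Real.Angle) := by
  set f : ℝ → ℝ := fun θ => a * sin (p - θ) + e * sin (p₃ - 3 * θ) with hf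
  have hcont : Continuous f := by fun_prop
  have hle : p - π / 3 ≤ p + π / 3 := by linarith [pi_pos]
  have hs : 1 / 2 ≤ sin (π / 3) := by
    rw [sin_pi_div_three]
    have : (1 : ℝ) ≤ √3 := one_le_sqrt.2 (by norm_num)
    linarith
  have hbd : ∀ θ, |e * sin θ| ≤ 1 / 32 := fun θ => by
    rw [abs_mul]; exact (mul_le_of_le_one_right (abs_nonneg e) (abs_sin_le_one _)).trans he
  have hleft : 0 ≤ f (p - π / 3) := by
    have h1 := (abs_le.1 (hbd (p₃ - 3 * (p - π / 3)))).1
    simp only [hf]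
    rw [sub_sub_cancel]
    nlinarith
  have hright : f (p + π / 3) ≤ 0 := by
    have h1 := (abs_le.1 (hbd (p₃ - 3 * (p + π / 3)))).2
    simp only [hf]
    rw [sub_add_cancel_left, sin_neg]
    nlinarith
  -- At p ∓ π/3 the leading sine has size at least 3/8, which decides the sign against the
  -- perturbation 1/32.
  obtain ⟨θ, hθ, hθ0⟩ := intermediate_value_Icc' hle hcont.continuousOn ⟨hright, hleft⟩
  have hanti : StrictAntiOn f (Set.Icc (p - π / 3) (p + π / 3)) := by
    refine strictAntiOn_of_deriv_neg (convex_Icc _ _) hcont.continuousOn fun x hx => ?_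
    rw [(hasDerivAt_angular a e p p₃ x).deriv]
    exact angular_deriv_neg ha he (half_le_cos_of_mem (interior_subset hx))
  refine ⟨θ, ⟨hθ0, angular_deriv_neg ha he (half_le_cos_of_mem hθ)⟩, fun θ' h0 h1 => ?_⟩
  obtain ⟨θ₁, hθ₁, n, hn⟩ := exists_angle_rep (half_le_cos_of_stable ha he h0 h1)
  have hθ₁0 : f θ₁ = 0 := by
    rw [← h0, hf, hn]
    simp only
    rw [show p - (θ' + n * (2 * π)) = p - θ' - n * (2 * π) by ring, sin_sub_int_mul_two_pi,
      show p₃ - 3 * (θ' + n * (2 * π)) = p₃ - 3 * θ' - ((3 * n : ℤ) : ℝ) * (2 * π) by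
        push_cast; ring, sin_sub_int_mul_two_pi]
  have heq : θ₁ = θ := hanti.injOn hθ₁ hθ (hθ₁0.trans hθ0.symm)
  rw [← heq, hn, Real.Angle.angle_eq_iff_two_pi_dvd_sub]
  exact ⟨-n, by push_cast; ring⟩

end phase

/-- A state close to a positive multiple of the projected evidence selects a best response. -/
lemma mem_bestResponse_of_near {k : ℕ} {δ s : ℝ} {b z : State K} (hdec : Decisive k δ b)
    (hz : ∀ j, |z j - s * proj k b j| < s * (δ * amplitude b k) / 2) (hs : 0 < s)
    {a : ZMod K} (ha : Selects z a) : a ∈ bestResponse k b := by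
  by_contra hna
  obtain ⟨a', -, ha'⟩ := exists_max_image (univ : Finset (ZMod K)) (fun j => proj k b j)
    univ_nonempty
  have hbr : a' ∈ bestResponse k b := fun j => ha' j (mem_univ j)
  have h1 := mul_le_mul_of_nonneg_left (hdec a' hbr a hna) hs.le
  have h2 := abs_lt.1 (hz a)
  have h3 := abs_lt.1 (hz a')
  linarith [ha a']

/-- The stable phase of the polar angular equation is unique and selects the best response. -/
theorem exists_stablePhase_selection (S : ℝ → ℝ) (d : ℝ) (c : ZMod K → ℝ) {k : ℕ}
    (h2 : ¬ K ∣ 2 * k) {δ : ℝ} (hδ : 0 < δ) :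
    ∃ ρ > 0, ∀ (r : ℝ) (b : State K), 0 < r → r < ρ →
      amplitude b (3 * k) < 3 * amplitude b k →
      (∃ θ, IsStablePhase S d c k b r θ ∧
        ∀ θ', IsStablePhase S d c k b r θ' → (θ' : Real.Angle) = (θ : Real.Angle)) ∧
      (Decisive k δ b → ∀ θ, IsStablePhase S d c k b r θ →
        ∀ a, Selects (r • direction k θ : State K) a → a ∈ bestResponse k b) := by
  set η := mixedCoeff S d c k
  -- The bound 1/96 gives |e| ≤ 3q₀ ≤ 1/32. The component error is 2|sin| ≤ 4|e| ≤ 12q₀, which must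
  -- be below δ/2.
  obtain ⟨q₀, hq₀, hq₁, hq₂⟩ : ∃ q₀ > 0, q₀ ≤ 1 / 96 ∧ q₀ < δ / 24 :=
    ⟨min (1 / 96) (δ / 48), by positivity, min_le_left _ _,
      (min_le_right _ _).trans_lt (by linarith)⟩
  refine ⟨min 1 (q₀ / (|η| + 1)), by positivity, fun r b hr hrρ hamp => ?_⟩
  rw [lt_min_iff] at hrρ
  have hA3 := amplitude_nonneg b (3 * k)
  have hA : 0 < amplitude b k := by linarith
  set A := amplitude b k with hAdef
  set A₃ := amplitude b (3 * k)
  have hq : |η * r ^ 2| ≤ q₀ := by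
    rw [abs_mul, abs_of_nonneg (sq_nonneg r)]
    have h1 := (lt_div_iff₀ (by positivity)).1 hrρ.2
    nlinarith [abs_nonneg η, hrρ.1, mul_nonneg (abs_nonneg η) hr.le]
  obtain ⟨q, hqdef⟩ : ∃ q, q = η * r ^ 2 := ⟨_, rfl⟩
  rw [← hqdef] at hq
  have hs2 : 0 < √2 := by positivity
  obtain ⟨a, haeq⟩ : ∃ a, a = 1 + 3 * q := ⟨_, rfl⟩
  obtain ⟨e, heeq⟩ : ∃ e, e = q * A₃ / A := ⟨_, rfl⟩
  have ha : 3 / 4 ≤ a := by have := (abs_le.1 hq).1; rw [haeq]; linarith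
  -- This is where A₃ < 3A enters: the third harmonic is small relative to the leading sine.
  have he3 : |e| ≤ 3 * |q| := by
    rw [heeq, abs_div, abs_mul, abs_of_pos hA, abs_of_nonneg hA3, div_le_iff₀ hA]
    nlinarith [abs_nonneg q]
  have he : |e| ≤ 1 / 32 := by linarith
  have hfun : polarAngular S d c k b r = fun θ => A / √2 *
      (a * sin (phase b k - θ) + e * sin (phase b (3 * k) - 3 * θ)) := by
    funext θ
    rw [polarAngular, haeq, heeq, hqdef]
    field_simp
    ring
  have hstab : ∀ θ, IsStablePhase S d c k b r θ ↔
      (a * sin (phase b k - θ) + e * sin (phase b (3 * k) - 3 * θ) = 0 ∧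
        -(a * cos (phase b k - θ)) - 3 * e * cos (phase b (3 * k) - 3 * θ) < 0) := by
    intro θ
    have hA' : 0 < A / √2 := by positivity
    rw [IsStablePhase, hfun, ((hasDerivAt_angular a e _ _ θ).const_mul (A / √2)).deriv]
    refine and_congr ⟨fun h => ?_, fun h => by simp only [h, mul_zero]⟩ ⟨fun h => ?_, fun h => ?_⟩
    · exact (mul_eq_zero.1 h).resolve_left hA'.ne'
    · exact neg_of_mul_neg_right h hA'.le
    · exact mul_neg_of_pos_of_neg hA' h
  constructor
  · obtain ⟨θ, hθ, huniq⟩ := existsUnique_stable_angle (p := phase b k) (p₃ := phase b (3 * k)) ha he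
    exact ⟨θ, (hstab θ).2 hθ, fun θ' h => huniq θ' ((hstab θ').1 h).1 ((hstab θ').1 h).2⟩
  · intro hdec θ hθ j hj
    obtain ⟨h0, h1⟩ := (hstab θ).1 hθ
    have hsin := abs_sin_le_of_angular_zero ha h0
    have hcos := half_le_cos_of_stable ha he h0 h1
    -- With this scale, s Ψ_A b is r times the direction of phase p.
    refine mem_bestResponse_of_near (s := r * √2 / A) hdec (fun l => ?_) (by positivity) hj
    have hdiff := abs_cos_sub_cos_le (x := k * sector l) (by linarith : 0 ≤ cos (phase b k - θ))
    have e1 : (r • direction k θ : State K) l - r * √2 / A * proj k b l =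
        r * √2 * (cos (k * sector l - θ) - cos (k * sector l - phase b k)) := by
      rw [PiLp.smul_apply, direction_apply, proj_apply h2, smul_eq_mul, ← hAdef]
      field_simp
    rw [e1, abs_mul, abs_of_pos (by positivity : 0 < r * √2)]
    calc _ < r * √2 * (δ / 2) := by gcongr; linarith
      _ = _ := by rw [← hAdef]; field_simp

/-! ### Stability of equilibria -/

/-- The quadratic form that decides stability: the weighted symmetrization of minus the
Jacobian. -/
noncomputable def stabilityForm (S : ℝ → ℝ) (d : ℝ) (c : ZMod K → ℝ) (α : ℝ) (x u : State K) : ℝ :=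
  ∑ j, d * u j ^ 2 / deriv S (x j) - α * inner ℝ u (coupling c u)

/-- The Jacobian matrix of the rescaled vector field. -/
noncomputable def jacobianMatrix (S : ℝ → ℝ) (d τ : ℝ) (c : ZMod K → ℝ) (α : ℝ) (x : State K) :
    Matrix (ZMod K) (ZMod K) ℝ :=
  LinearMap.toMatrix (EuclideanSpace.basisFun (ZMod K) ℝ).toBasis
    (EuclideanSpace.basisFun (ZMod K) ℝ).toBasis
    ((τ⁻¹ • jacobian S d c α x : State K →L[ℝ] State K) : State K →ₗ[ℝ] State K)

lemma jacobianMatrix_mulVec (S : ℝ → ℝ) (d τ : ℝ) (c : ZMod K → ℝ) (α : ℝ) (x u : State K) :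
    (jacobianMatrix S d τ c α x).mulVec u.ofLp = (τ⁻¹ • jacobian S d c α x u : State K).ofLp := by
  have h := LinearMap.toMatrix_mulVec_repr (EuclideanSpace.basisFun (ZMod K) ℝ).toBasis
    (EuclideanSpace.basisFun (ZMod K) ℝ).toBasis
    ((τ⁻¹ • jacobian S d c α x : State K →L[ℝ] State K) : State K →ₗ[ℝ] State K) u
  have hr : ∀ y : State K, ((EuclideanSpace.basisFun (ZMod K) ℝ).toBasis.repr y : ZMod K → ℝ) =
      y.ofLp := by
    intro y; ext j; simp
  rw [hr, hr] at h
  exact h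

lemma isStableEquilibrium_iff {S : ℝ → ℝ} (hS : ContDiff ℝ 3 S) {d τ : ℝ} (hτ : 0 < τ)
    (c : ZMod K → ℝ) (α : ℝ) (b z : State K) :
    IsStableEquilibrium (fun y => τ⁻¹ • vectorField S d c α b y) z ↔
      vectorField S d c α b z = 0 ∧
        ∀ x ∈ spectrum ℂ ((jacobianMatrix S d τ c α (netInput c α b z)).map (algebraMap ℝ ℂ)),
          x.re < 0 := by
  have hF := (hasFDerivAt_vectorField hS d c α b z).const_smul τ⁻¹
  have hfd : fderiv ℝ (fun y => τ⁻¹ • vectorField S d c α b y) z =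
      τ⁻¹ • jacobian S d c α (netInput c α b z) := hF.fderiv
  rw [IsStableEquilibrium, hfd]
  constructor
  · rintro ⟨h1, -, h3⟩
    exact ⟨(smul_eq_zero.1 h1).resolve_left (by positivity), h3⟩
  · rintro ⟨h1, h3⟩
    exact ⟨by simp [h1], hF.differentiableAt, h3⟩

/-- Dividing row j of the Jacobian by S'(x_j) leaves a symmetric matrix, so its weighted energy is
an honest quadratic form. -/
lemma sum_jacobian_mul_div {S : ℝ → ℝ} {d : ℝ} {c : ZMod K → ℝ} {α : ℝ} {x : State K}
    (hD : ∀ j, 0 < deriv S (x j)) (u : State K) :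
    ∑ j, jacobian S d c α x u j * u j / deriv S (x j) = -stabilityForm S d c α x u := by
  rw [stabilityForm, state_inner, mul_sum, ← sum_sub_distrib, ← sum_neg_distrib]
  refine sum_congr rfl fun j _ => ?_
  have := (hD j).ne'
  rw [jacobian_apply]
  field_simp
  ring

lemma mem_spectrum_iff_exists_mulVec (M : Matrix (ZMod K) (ZMod K) ℂ) (x : ℂ) :
    x ∈ spectrum ℂ M ↔ ∃ u : ZMod K → ℂ, u ≠ 0 ∧ M.mulVec u = x • u := by
  rw [← Matrix.spectrum_toLin', ← Module.End.hasEigenvalue_iff_mem_spectrum]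
  constructor
  · intro h
    obtain ⟨u, hu⟩ := h.exists_hasEigenvector
    exact ⟨u, hu.2, by simpa using hu.apply_eq_smul⟩
  · rintro ⟨u, hu, h⟩
    exact Module.End.hasEigenvalue_of_hasEigenvector
      (Module.End.hasEigenvector_iff.2 ⟨Module.End.mem_eigenspace_iff.2 (by simpa using h), hu⟩)

/-- Positivity of the stability form implies that the Jacobian is stable. -/
lemma re_neg_of_stabilityForm_pos {S : ℝ → ℝ} {d τ : ℝ} (hτ : 0 < τ) {c : ZMod K → ℝ}
    {α : ℝ} {x : State K} (hD : ∀ j, 0 < deriv S (x j))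
    (hQ : ∀ u, u ≠ 0 → 0 < stabilityForm S d c α x u) :
    ∀ y ∈ spectrum ℂ ((jacobianMatrix S d τ c α x).map (algebraMap ℝ ℂ)), y.re < 0 := by
  intro y hy
  obtain ⟨u, hu0, hu⟩ := (mem_spectrum_iff_exists_mulVec _ y).1 hy
  set p : State K := WithLp.toLp 2 fun j => (u j).re with hp
  set q : State K := WithLp.toLp 2 fun j => (u j).im with hq
  have hre : ∀ j, τ⁻¹ * jacobian S d c α x p j = y.re * p j - y.im * q j := by
    intro j
    have h1 := congrArg Complex.re (congrFun hu j)
    have h2 := congrFun (jacobianMatrix_mulVec S d τ c α x p) j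
    simp only [Matrix.mulVec, dotProduct, Matrix.map_apply, Complex.re_sum, Pi.smul_apply,
      smul_eq_mul, Complex.mul_re] at h1
    simp only [Matrix.mulVec, dotProduct, PiLp.smul_apply, smul_eq_mul] at h2
    rw [← h2, ← h1]
    refine sum_congr rfl fun i _ => ?_
    simp [hp]
  have him : ∀ j, τ⁻¹ * jacobian S d c α x q j = y.re * q j + y.im * p j := by
    intro j
    have h1 := congrArg Complex.im (congrFun hu j)
    have h2 := congrFun (jacobianMatrix_mulVec S d τ c α x q) j
    simp only [Matrix.mulVec, dotProduct, Matrix.map_apply, Complex.im_sum, Pi.smul_apply,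
      smul_eq_mul, Complex.mul_im] at h1
    simp only [Matrix.mulVec, dotProduct, PiLp.smul_apply, smul_eq_mul] at h2
    rw [← h2, ← h1]
    refine sum_congr rfl fun i _ => ?_
    simp [hq]
  -- The real and imaginary parts of the eigenvector carry the same weights, so the rotation terms
  -- with the imaginary part of y cancel.
  have hsum : τ⁻¹ * (-stabilityForm S d c α x p + -stabilityForm S d c α x q) =
      y.re * ∑ j, (p j ^ 2 + q j ^ 2) / deriv S (x j) := by
    rw [← sum_jacobian_mul_div hD, ← sum_jacobian_mul_div hD, ← sum_add_distrib, mul_sum, mul_sum]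
    refine sum_congr rfl fun j _ => ?_
    have := (hD j).ne'
    linear_combination (p j / deriv S (x j)) * hre j + (q j / deriv S (x j)) * him j
  have hnn : ∀ v : State K, 0 ≤ stabilityForm S d c α x v := fun v => by
    by_cases h : v = 0
    · simp [h, stabilityForm]
    · exact (hQ v h).le
  have hpos : 0 < stabilityForm S d c α x p + stabilityForm S d c α x q := by
    by_cases hp0 : p = 0
    · by_cases hq0 : q = 0
      · refine absurd (funext fun j => ?_) hu0
        have h1 := congrArg (fun v : State K => v j) hp0
        have h2 := congrArg (fun v : State K => v j) hq0
        exact Complex.ext (by simpa [hp] using h1) (by simpa [hq] using h2)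
      · have := hQ q hq0; have := hnn p; linarith
    · have := hQ p hp0; have := hnn q; linarith
  have hB : 0 ≤ ∑ j, (p j ^ 2 + q j ^ 2) / deriv S (x j) :=
    sum_nonneg fun j _ => div_nonneg (by positivity) (hD j).le
  have hneg : y.re * ∑ j, (p j ^ 2 + q j ^ 2) / deriv S (x j) < 0 := by
    rw [← hsum]
    exact mul_neg_of_pos_of_neg (by positivity) (by linarith)
  exact neg_of_mul_neg_left hneg hB

/-- At a stable Jacobian the stability form is nonnegative. -/
lemma stabilityForm_nonneg_of_re_neg {S : ℝ → ℝ} {d τ : ℝ} (hτ : 0 < τ) {c : ZMod K → ℝ}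
    (hc : ∀ j, c (-j) = c j) {α : ℝ} {x : State K} (hD : ∀ j, 0 < deriv S (x j))
    (hspec : ∀ y ∈ spectrum ℂ ((jacobianMatrix S d τ c α x).map (algebraMap ℝ ℂ)), y.re < 0)
    (u : State K) : 0 ≤ stabilityForm S d c α x u := by
  set w : ZMod K → ℝ := fun j => √(deriv S (x j)) with hw
  have hw0 : ∀ j, 0 < w j := fun j => sqrt_pos.2 (hD j)
  have hw2 : ∀ j, w j * w j = deriv S (x j) := fun j => mul_self_sqrt (hD j).le
  -- H is symmetric and J diag(w) = -diag(w) H, so eigenvectors of H, rescaled by w, are real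
  -- eigenvectors of the Jacobian with the opposite eigenvalue.
  set H : Matrix (ZMod K) (ZMod K) ℝ :=
    d • (1 : Matrix (ZMod K) (ZMod K) ℝ)
      - α • (Matrix.diagonal w * Matrix.circulant c * Matrix.diagonal w) with hH
  have hHv : ∀ (y : ZMod K → ℝ) (j : ZMod K), H.mulVec y j =
      d * y j - α * (w j * coupling c (WithLp.toLp 2 fun i => w i * y i) j) := by
    intro y j
    rw [hH, Matrix.sub_mulVec, Matrix.smul_mulVec, Matrix.smul_mulVec, Matrix.one_mulVec,
      ← Matrix.mulVec_mulVec, ← Matrix.mulVec_mulVec, coupling_apply]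
    simp only [Pi.sub_apply, Pi.smul_apply, smul_eq_mul, Matrix.mulVec_diagonal]
    congr 5
    funext i
    exact Matrix.mulVec_diagonal _ _ _
  have hHerm : H.IsHermitian := by
    ext i j
    simp only [hH, Matrix.conjTranspose_apply, Matrix.sub_apply, Matrix.smul_apply, smul_eq_mul,
      Matrix.mul_diagonal, Matrix.diagonal_mul, Matrix.circulant_apply, star_trivial]
    rw [← hc (j - i), neg_sub]
    rcases eq_or_ne i j with h | h
    · subst h; rfl
    · rw [Matrix.one_apply_ne h, Matrix.one_apply_ne h.symm]; ring
  have hPSD : H.PosSemidef := by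
    rw [hHerm.posSemidef_iff_eigenvalues_nonneg]
    intro i
    set y : State K := hHerm.eigenvectorBasis i with hy
    set h := hHerm.eigenvalues i
    have hy0 : y ≠ 0 := hHerm.eigenvectorBasis.orthonormal.ne_zero i
    have hev : H.mulVec y.ofLp = h • y.ofLp := hHerm.mulVec_eigenvectorBasis i
    set v : State K := WithLp.toLp 2 fun j => w j * y j with hv
    have hJ : ∀ j, jacobian S d c α x v j = -h * v j := by
      intro j
      have h1 := congrFun hev j
      rw [hHv] at h1
      change d * y j - α * (w j * coupling c v j) = h * y j at h1
      rw [jacobian_apply, ← hw2]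
      change -d * (w j * y j) + w j * w j * (α * coupling c v j) = -h * (w j * y j)
      linear_combination (-w j) * h1
    have hmem : ((-(τ⁻¹ * h) : ℝ) : ℂ) ∈
        spectrum ℂ ((jacobianMatrix S d τ c α x).map (algebraMap ℝ ℂ)) := by
      refine (mem_spectrum_iff_exists_mulVec _ _).2 ⟨fun j => (v j : ℂ), ?_, ?_⟩
      · intro h0
        refine hy0 ?_
        ext j
        have h1 : v j = 0 := by
          have := congrFun h0 j
          exact Complex.ofReal_eq_zero.1 this
        exact (mul_eq_zero.1 h1).resolve_left (hw0 j).ne'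
      · funext j
        have h2 := congrFun (jacobianMatrix_mulVec S d τ c α x v) j
        simp only [Matrix.mulVec, dotProduct, PiLp.smul_apply, smul_eq_mul, hJ] at h2
        simp only [Matrix.mulVec, dotProduct, Matrix.map_apply, Pi.smul_apply, smul_eq_mul,
          Complex.coe_algebraMap]
        rw [← Complex.ofReal_mul,
          show -(τ⁻¹ * h) * v j = τ⁻¹ * (-h * v j) by ring, ← h2, Complex.ofReal_sum]
        exact sum_congr rfl fun i _ => (Complex.ofReal_mul _ _).symm
    have := hspec _ hmem
    rw [Complex.ofReal_re, neg_lt_zero] at this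
    exact (pos_of_mul_pos_right this (by positivity)).le
  have hfin := hPSD.dotProduct_mulVec_nonneg (fun j => u j / w j)
  have hu : (WithLp.toLp 2 fun i => w i * (u i / w i) : State K) = u := by
    ext i; exact mul_div_cancel₀ _ (hw0 i).ne'
  refine hfin.trans (le_of_eq ?_)
  simp only [dotProduct, hHv, hu, star_trivial, stabilityForm, state_inner, mul_sum,
    ← sum_sub_distrib]
  refine sum_congr rfl fun j _ => ?_
  rw [← hw2]
  have := (hw0 j).ne'
  field_simp

/-! ### Equilibria near onset -/

/-- The variable part of the stability form. -/
noncomputable def slopeDefect (S : ℝ → ℝ) (d : ℝ) (x : State K) (j : ZMod K) : ℝ :=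
  d * ((deriv S (x j))⁻¹ - 1)

lemma stabilityForm_eq (S : ℝ → ℝ) (d : ℝ) (c : ZMod K → ℝ) (α : ℝ) (x u : State K) :
    stabilityForm S d c α x u =
      ∑ j, slopeDefect S d x j * u j ^ 2 + inner ℝ u (d • u - α • coupling c u) := by
  rw [inner_sub_right, inner_smul_right, inner_smul_right, state_inner, mul_sum, ← add_sub_assoc,
    ← sum_add_distrib, stabilityForm]
  congr 1
  exact sum_congr rfl fun j _ => by rw [slopeDefect]; ring

lemma stabilityForm_of_mem {S : ℝ → ℝ} {d : ℝ} {c : ZMod K → ℝ} (hc : ∀ j, c (-j) = c j) {k : ℕ}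
    (α : ℝ) (x : State K) {u : State K} (hu : u ∈ criticalSpace K k) :
    stabilityForm S d c α x u =
      ∑ j, slopeDefect S d x j * u j ^ 2 - onset d c k α * ‖u‖ ^ 2 := by
  rw [stabilityForm_eq, coupling_of_mem hc hu, onset, inner_sub_right, inner_smul_right,
    inner_smul_right, inner_smul_right, real_inner_self_eq_norm_sq]
  ring

/-- The stability form on the critical space at leading order. -/
lemma abs_stabilityForm_sub_le {S : ℝ → ℝ} {d : ℝ} {c : ZMod K → ℝ} (hc : ∀ j, c (-j) = c j)
    {k : ℕ} (hpos : 0 < eigenvalue c k) (h2 : ¬ K ∣ 2 * k) (h4 : ¬ K ∣ 4 * k) {α e : ℝ}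
    {x v u : State K} (hv : v ∈ criticalSpace K k) (hu : u ∈ criticalSpace K k)
    (hκ : ∀ j, |slopeDefect S d x j + iteratedDeriv 3 S 0 / 2 * d ^ 3 * v j ^ 2| ≤ e) :
    |stabilityForm S d c α x u - (-(onset d c k α + cubicCoeff S d c k / K * ‖v‖ ^ 2) * ‖u‖ ^ 2
        - 2 * (cubicCoeff S d c k / K) * inner ℝ v u ^ 2)| ≤ e * ‖u‖ ^ 2 := by
  have hK : (K : ℝ) ≠ 0 := NeZero.ne _
  have hsum := sum_sq_mul_sq h2 h4 hv hu
  have e1 : stabilityForm S d c α x u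
      - (-(onset d c k α + cubicCoeff S d c k / K * ‖v‖ ^ 2) * ‖u‖ ^ 2
        - 2 * (cubicCoeff S d c k / K) * inner ℝ v u ^ 2) =
      ∑ j, (slopeDefect S d x j + iteratedDeriv 3 S 0 / 2 * d ^ 3 * v j ^ 2) * u j ^ 2 := by
    have e2 : ∑ j, (slopeDefect S d x j + iteratedDeriv 3 S 0 / 2 * d ^ 3 * v j ^ 2) * u j ^ 2 =
        ∑ j, slopeDefect S d x j * u j ^ 2
          + iteratedDeriv 3 S 0 / 2 * d ^ 3 * ∑ j, v j ^ 2 * u j ^ 2 := by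
      rw [mul_sum, ← sum_add_distrib]
      exact sum_congr rfl fun j _ => by ring
    rw [e2, hsum, stabilityForm_of_mem hc α x hu, cubicCoeff_eq S hpos]
    field_simp
    ring
  rw [e1, norm_sq_eq_sum, mul_sum]
  refine (abs_sum_le_sum_abs _ _).trans (sum_le_sum fun j _ => ?_)
  rw [abs_mul, abs_of_nonneg (sq_nonneg (u j))]
  exact mul_le_mul_of_nonneg_right (hκ j) (sq_nonneg _)

/-- The stability form is positive definite if it is on the critical space and the noncritical
modes are coercive. -/
lemma stabilityForm_pos {S : ℝ → ℝ} {d : ℝ} {c : ZMod K → ℝ} (hc : ∀ j, c (-j) = c j)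
    {k : ℕ} {α γ B q t : ℝ} {x : State K} (hB : 0 < B) (hq : 0 < q) (ht : 0 < t)
    (hκ : ∀ j, |slopeDefect S d x j| ≤ B * t ^ 2)
    (hcoer : ∀ w ∈ (criticalSpace K k)ᗮ, γ * ‖w‖ ^ 2 ≤ inner ℝ w (d • w - α • coupling c w))
    (hcrit : ∀ u ∈ criticalSpace K k, q * t ^ 2 * ‖u‖ ^ 2 ≤ stabilityForm S d c α x u)
    (hsmall : B * (2 * B / q + 1) * t ^ 2 < γ) {u : State K} (hu : u ≠ 0) :
    0 < stabilityForm S d c α x u := by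
  obtain ⟨p, hp, w, hw, rfl⟩ : ∃ p ∈ criticalSpace K k, ∃ w ∈ (criticalSpace K k)ᗮ, u = p + w :=
    ⟨proj k u, proj_mem k u, u - proj k u, sub_proj_mem k u, by abel⟩
  have hpw : inner ℝ p w = 0 := inner_eq_zero_of_mem hp hw
  have hwp : inner ℝ w p = 0 := by rw [real_inner_comm]; exact hpw
  have hpAw : inner ℝ p (coupling c w) = 0 :=
    inner_eq_zero_of_mem hp (coupling_mem_orthogonal hc hw)
  have hwAp : inner ℝ w (coupling c p) = 0 := by
    rw [← inner_coupling_comm hc, real_inner_comm]; exact hpAw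
  have hlin : inner ℝ (p + w) (d • (p + w) - α • coupling c (p + w)) =
      inner ℝ p (d • p - α • coupling c p) + inner ℝ w (d • w - α • coupling c w) := by
    simp only [map_add, smul_add, inner_add_left, inner_add_right, inner_sub_right,
      inner_smul_right, hpw, hpAw, hwAp, hwp]
    ring
  -- The linear part decouples, so only the slope defect mixes E_c and E_s. The Young weight q/(2B)
  -- spends half of the coercivity q t² available on E_c.
  have hcross : -(B * t ^ 2) * (q / (2 * B) * ‖p‖ ^ 2 + (2 * B / q + 1) * ‖w‖ ^ 2) ≤
      ∑ j, slopeDefect S d x j * (p + w) j ^ 2 - ∑ j, slopeDefect S d x j * p j ^ 2 := by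
    rw [norm_sq_eq_sum, norm_sq_eq_sum, mul_sum, mul_sum, ← sum_add_distrib, mul_sum,
      ← sum_sub_distrib]
    refine sum_le_sum fun j _ => ?_
    have hyoung : |2 * (p j * w j) + w j ^ 2| ≤
        q / (2 * B) * p j ^ 2 + (2 * B / q + 1) * w j ^ 2 := by
      have hsq : ∀ s : ℝ, s ^ 2 = 1 →
          0 ≤ q / (2 * B) * p j ^ 2 + 2 * B / q * w j ^ 2 - 2 * s * (p j * w j) := by
        intro s hs
        have : q / (2 * B) * p j ^ 2 + 2 * B / q * w j ^ 2 - 2 * s * (p j * w j) =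
            q / (2 * B) * (p j - s * (2 * B / q) * w j) ^ 2 := by
          field_simp
          linear_combination (-(4 * B ^ 2 * w j ^ 2)) * hs
        rw [this]; positivity
      have h1 := hsq 1 (by norm_num)
      have h2 := hsq (-1) (by norm_num)
      rw [abs_le]
      constructor <;> nlinarith [sq_nonneg (w j)]
    have hprod : |slopeDefect S d x j * (2 * (p j * w j) + w j ^ 2)| ≤
        B * t ^ 2 * (q / (2 * B) * p j ^ 2 + (2 * B / q + 1) * w j ^ 2) := by
      rw [abs_mul]
      exact mul_le_mul (hκ j) hyoung (abs_nonneg _) (by positivity)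
    have := (abs_le.1 hprod).1
    rw [PiLp.add_apply]
    linarith
  have hform := stabilityForm_eq S d c α x (p + w)
  rw [hlin] at hform
  have hformp := stabilityForm_eq S d c α x p
  have h1 := hcrit p hp
  have h2 := hcoer w hw
  have e1 : B * t ^ 2 * (q / (2 * B) * ‖p‖ ^ 2) = q * t ^ 2 * ‖p‖ ^ 2 / 2 := by field_simp
  have hlow : q * t ^ 2 * ‖p‖ ^ 2 / 2 + (γ - B * (2 * B / q + 1) * t ^ 2) * ‖w‖ ^ 2 ≤
      stabilityForm S d c α x (p + w) := by linarith
  refine lt_of_lt_of_le ?_ hlow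
  have h3 : 0 < γ - B * (2 * B / q + 1) * t ^ 2 := by linarith
  by_cases hp0 : p = 0
  · have hw0 : w ≠ 0 := by rintro rfl; exact hu (by simp [hp0])
    have : 0 < ‖w‖ := norm_pos_iff.2 hw0
    positivity
  · have : 0 < ‖p‖ := norm_pos_iff.2 hp0
    positivity

lemma mul_le_of_le_of_le_one_right {a b σ : ℝ} (ha0 : 0 ≤ a) (ha : a ≤ σ) (hb : b ≤ 1) : a * b ≤ σ :=
  (mul_le_of_le_one_right ha0 hb).trans ha

/-- Here t = ‖v‖, β = ‖b‖, P = ‖Ψ_A b‖ and σ bounds all small quantities. Solving the equilibrium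
equation for P gives β ≤ (ε/2)t + β/2, and the last term is absorbed. -/
lemma absorb_evidence {B C L ε t β P m σ : ℝ} (hB : 0 < B) (hC : 0 < C) (ht : 0 ≤ t) (hβ : 0 ≤ β)
    (hε1 : ε ≤ 1) (htσ : t ≤ σ) (hβσ : β ≤ σ) (hσ1 : σ ≤ 1) (hm : m ≤ (L - 1) * σ)
    (hP : P ≤ m * t + (ε * t ^ 3 + C * (β * t ^ 2 + β ^ 2 * t + β ^ 3))) (hβP : β ≤ B * P)
    (h1 : σ * (2 * (B * L)) ≤ ε) (h2 : σ * (6 * (C * B)) ≤ 1) : β ≤ ε * t := by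
  have hσ0 : 0 ≤ σ := ht.trans htσ
  have t2 : t * t ≤ σ := mul_le_of_le_of_le_one_right ht htσ (htσ.trans hσ1)
  have tb : β * t ≤ σ := mul_le_of_le_of_le_one_right hβ hβσ (htσ.trans hσ1)
  have b2 : β * β ≤ σ := mul_le_of_le_of_le_one_right hβ hβσ (hβσ.trans hσ1)
  have h3 : ε * t ^ 3 ≤ σ * t := by
    calc ε * t ^ 3 = (ε * (t * t)) * t := by ring
      _ ≤ (1 * σ) * t := by gcongr
      _ = _ := by ring
  have h4 : β * t ^ 2 + β ^ 2 * t + β ^ 3 ≤ 3 * σ * β := by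
    calc _ = (t * t + β * t + β * β) * β := by ring
      _ ≤ (σ + σ + σ) * β := by gcongr
      _ = _ := by ring
  have h5 : P ≤ L * σ * t + 3 * C * σ * β := by
    have e1 := mul_le_mul_of_nonneg_right hm ht
    have e2 := mul_le_mul_of_nonneg_left h4 hC.le
    linarith
  have h6 : β ≤ (σ * (2 * (B * L))) / 2 * t + (σ * (6 * (C * B))) / 2 * β :=
    hβP.trans ((mul_le_mul_of_nonneg_left h5 hB.le).trans (le_of_eq (by ring)))
  have h7 : (σ * (2 * (B * L))) / 2 * t ≤ ε / 2 * t := by gcongr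
  have h8 : (σ * (6 * (C * B))) / 2 * β ≤ 1 / 2 * β := by gcongr
  linarith

/-- Once β = o(t), the evidence part of the error becomes o(t³). -/
lemma evidence_terms_le {e t β : ℝ} (he1 : e ≤ 1) (ht : 0 ≤ t) (hβ : 0 ≤ β)
    (h : β ≤ e * t) : β * t ^ 2 + β ^ 2 * t + β ^ 3 ≤ 3 * (e * t ^ 3) := by
  have hβt : β ≤ t := h.trans (mul_le_of_le_one_left ht he1)
  have h0 : 0 ≤ e * t := hβ.trans h
  calc _ = β * (t * t + β * t + β * β) := by ring
    _ ≤ e * t * (t * t + t * t + t * t) := by gcongr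
    _ = _ := by ring

section equilibria

variable {S : ℝ → ℝ} {d : ℝ} {c : ZMod K → ℝ} {k : ℕ} (hd : 0 < d)
    (hSodd : ∀ x, S (-x) = -S x) (hS : ContDiff ℝ 3 S) (hS1 : deriv S 0 = 1)
    (hc : ∀ j, c (-j) = c j) (hpos : 0 < eigenvalue c k)
    (hdom : ∀ m ≤ K / 2, m ≠ k → eigenvalue c m < eigenvalue c k)
include hd hSodd hS hS1 hc hpos hdom

/-- Near onset the evidence is negligible against the critical component of an equilibrium. -/
lemma exists_evidence_le (h2 : ¬ K ∣ 2 * k) (h4 : ¬ K ∣ 4 * k) {B : ℝ} (hB : 0 < B) :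
    ∃ C > 0, ∀ ε > 0, ∃ ρ > 0, ∀ v ∈ criticalSpace K k, ∀ w ∈ (criticalSpace K k)ᗮ,
      ∀ (α : ℝ) (b : State K),
      ‖v‖ < ρ → ‖w‖ < ρ → |α - criticalGain d c k| < ρ → ‖b‖ < ρ →
      vectorField S d c α b (v + w) = 0 → ‖b‖ ≤ B * ‖proj k b‖ →
      ‖b‖ ≤ ε * ‖v‖ ∧
      ‖(onset d c k α + cubicCoeff S d c k / K * ‖v‖ ^ 2) • v + proj k b‖
        ≤ ε * ‖v‖ ^ 3 + C * (‖b‖ * ‖v‖ ^ 2 + ‖b‖ ^ 2 * ‖v‖ + ‖b‖ ^ 3) := by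
  obtain ⟨C, hC, hexp⟩ := exists_critical_expansion hd hSodd hS hS1 hc hpos hdom h2 h4
  refine ⟨C, hC, fun ε₀ hε₀ => ?_⟩
  obtain ⟨ε, hε, hε1, hεε⟩ : ∃ ε > 0, ε ≤ 1 ∧ ε ≤ ε₀ :=
    ⟨min 1 ε₀, by positivity, min_le_left _ _, min_le_right _ _⟩
  obtain ⟨ρ₁, hρ₁, hexp⟩ := hexp ε hε
  obtain ⟨G, hG⟩ : ∃ G, G = |cubicCoeff S d c k / K| := ⟨_, rfl⟩
  have hG0 : 0 ≤ G := by rw [hG]; positivity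
  obtain ⟨l, hl⟩ : ∃ l, l = eigenvalue c k := ⟨_, rfl⟩
  have hl0 : 0 < l := hl ▸ hpos
  refine ⟨min (min 1 ρ₁) (min (ε / (2 * (B * (l + G + 1)))) (1 / (6 * (C * B)))),
    by positivity, ?_⟩
  intro v hv w hw α b hvρ hwρ hαρ hbρ hF hbB
  simp only [lt_min_iff] at hvρ hwρ hαρ hbρ
  have hmain := hexp v hv w hw α b hvρ.1.2 hwρ.1.2 hαρ.1.2 hbρ.1.2 (by rw [hF]; simp [proj])
  have hP0 : proj k (0 : State K) = 0 := by simp [proj]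
  rw [hF, hP0, zero_sub, norm_neg] at hmain
  have hv0 := norm_nonneg v
  have hb0 := norm_nonneg b
  have hE0 : 0 ≤ ‖b‖ * ‖v‖ ^ 2 + ‖b‖ ^ 2 * ‖v‖ + ‖b‖ ^ 3 := by positivity
  refine ⟨?_, hmain.trans (by gcongr)⟩
  obtain ⟨σ, hσv, hσb, hσα, hσ1, hσ2, hσ3⟩ : ∃ σ, ‖v‖ ≤ σ ∧ ‖b‖ ≤ σ ∧
      |α - criticalGain d c k| ≤ σ ∧ σ < 1 ∧ σ < ε / (2 * (B * (l + G + 1))) ∧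
      σ < 1 / (6 * (C * B)) :=
    ⟨max (max ‖v‖ ‖b‖) |α - criticalGain d c k|, (le_max_left _ _).trans (le_max_left _ _),
      (le_max_right _ _).trans (le_max_left _ _), le_max_right _ _,
      max_lt (max_lt hvρ.1.1 hbρ.1.1) hαρ.1.1, max_lt (max_lt hvρ.2.1 hbρ.2.1) hαρ.2.1,
      max_lt (max_lt hvρ.2.2 hbρ.2.2) hαρ.2.2⟩
  rw [lt_div_iff₀ (by positivity)] at hσ2 hσ3
  have hPb : ‖proj k b‖ ≤ |onset d c k α + cubicCoeff S d c k / K * ‖v‖ ^ 2| * ‖v‖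
      + (ε * ‖v‖ ^ 3 + C * (‖b‖ * ‖v‖ ^ 2 + ‖b‖ ^ 2 * ‖v‖ + ‖b‖ ^ 3)) := by
    have h1 := norm_sub_le
      ((onset d c k α + cubicCoeff S d c k / K * ‖v‖ ^ 2) • v + proj k b)
      ((onset d c k α + cubicCoeff S d c k / K * ‖v‖ ^ 2) • v)
    rw [add_sub_cancel_left, norm_smul, norm_eq_abs] at h1
    linarith
  have hm : |onset d c k α + cubicCoeff S d c k / K * ‖v‖ ^ 2| ≤ (l + G + 1 - 1) * σ := by
    refine (abs_add_le _ _).trans ?_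
    rw [abs_mul, ← hG, onset_eq hpos, abs_mul, abs_of_pos hpos, ← hl,
      abs_of_nonneg (sq_nonneg ‖v‖), sq]
    have h1 := mul_le_of_le_of_le_one_right hv0 hσv (hσv.trans hσ1.le)
    have h3 := mul_le_mul_of_nonneg_right hσα hl0.le
    have h5 := mul_le_mul_of_nonneg_left h1 hG0
    linarith
  exact (absorb_evidence hB hC hv0 hb0 hε1 hσv hσb hσ1.le hm hPb hbB hσ2.le hσ3.le).trans
    (by gcongr)

/-- Leading-order asymptotics of equilibria near onset. -/
lemma exists_equilibrium_asymptotics (h2 : ¬ K ∣ 2 * k) (h4 : ¬ K ∣ 4 * k) {B : ℝ} (hB : 0 < B)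
    {ε : ℝ} (hε : 0 < ε) :
    ∃ ρ > 0, ∀ v ∈ criticalSpace K k, ∀ w ∈ (criticalSpace K k)ᗮ, ∀ (α : ℝ) (b : State K),
      ‖v‖ < ρ → ‖w‖ < ρ → |α - criticalGain d c k| < ρ → ‖b‖ < ρ →
      vectorField S d c α b (v + w) = 0 → ‖b‖ ≤ B * ‖proj k b‖ → proj k b ≠ 0 →
      0 < ‖v‖ ∧ ‖w‖ ≤ ε * ‖v‖ ∧
      ‖(onset d c k α + cubicCoeff S d c k / K * ‖v‖ ^ 2) • v + proj k b‖ ≤ ε * ‖v‖ ^ 3 ∧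
      ∀ j, |slopeDefect S d (netInput c α b (v + w)) j
        + iteratedDeriv 3 S 0 / 2 * d ^ 3 * v j ^ 2| ≤ ε * ‖v‖ ^ 2 := by
  obtain ⟨C₁, hC₁, ρ₁, hρ₁, hrb⟩ := exists_range_bound hd hSodd hS hS1 hc hpos hdom
  obtain ⟨C, hC, hev⟩ := exists_evidence_le hd hSodd hS hS1 hc hpos hdom h2 h4 hB
  obtain ⟨s, hs⟩ : ∃ s, s = iteratedDeriv 3 S 0 := ⟨_, rfl⟩
  obtain ⟨l, hl⟩ : ∃ l, l = eigenvalue c k := ⟨_, rfl⟩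
  have hl0 : 0 < l := hl ▸ hpos
  -- The three groups of summands are the constants of the three estimates in the conclusion, so one
  -- e serves them all.
  obtain ⟨M, hM⟩ : ∃ M, M = 2 * C₁ + (1 + 3 * C) +
      d * ((2 * C₁) ^ 2 + |s / 2| * ((l + 2 * C₁) * (2 * C₁ + d))) := ⟨_, rfl⟩
  have hM1 : 0 ≤ d * ((2 * C₁) ^ 2 + |s / 2| * ((l + 2 * C₁) * (2 * C₁ + d))) := by positivity
  have hM0 : 0 < M := by rw [hM]; positivity
  obtain ⟨e, he, he1, heM⟩ : ∃ e > 0, e ≤ 1 ∧ M * e ≤ ε := by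
    refine ⟨min 1 (ε / M), by positivity, min_le_left _ _, ?_⟩
    rw [mul_comm, ← le_div_iff₀ hM0]; exact min_le_right _ _
  obtain ⟨ρ₂, hρ₂, hev⟩ := hev e he
  obtain ⟨ρ₃, hρ₃, hinv⟩ := exists_inv_deriv_expansion hSodd hS hS1 he
  rw [← hs] at hinv
  refine ⟨min (min e ρ₁) (min ρ₂ (ρ₃ / (2 * C₁))), by positivity, ?_⟩
  intro v hv w hw α b hvρ hwρ hαρ hbρ hF hbB hPb
  simp only [lt_min_iff] at hvρ hwρ hαρ hbρ
  obtain ⟨hwb, hxb, hxd⟩ := hrb v hv w hw α b hvρ.1.2 hwρ.1.2 hαρ.1.2 hbρ.1.2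
    (by rw [hF]; simp [proj])
  obtain ⟨hbe, hmain⟩ := hev v hv w hw α b hvρ.2.1 hwρ.2.1 hαρ.2.1 hbρ.2.1 hF hbB
  generalize netInput c α b (v + w) = x at hxb hxd ⊢
  have hv0 := norm_nonneg v
  have hb0 := norm_nonneg b
  -- If v vanished, ‖b‖ ≤ e‖v‖ would force b = 0.
  have hvpos : 0 < ‖v‖ := by
    rcases hv0.eq_or_lt with h | h
    · rw [← h, mul_zero] at hbe
      have : b = 0 := norm_le_zero_iff.1 hbe
      exact absurd (by rw [this]; simp [proj]) hPb
    · exact h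
  have hbv : ‖b‖ ≤ ‖v‖ := hbe.trans (mul_le_of_le_one_left hv0 he1)
  have hv3 : ‖v‖ ^ 3 ≤ e * ‖v‖ := by
    have := mul_le_of_le_of_le_one_right hv0 hvρ.1.1.le (hvρ.1.1.le.trans he1)
    calc ‖v‖ ^ 3 = ‖v‖ * ‖v‖ * ‖v‖ := by ring
      _ ≤ _ := by gcongr
  have hbd : C₁ * (‖b‖ + ‖v‖ ^ 3) ≤ 2 * C₁ * e * ‖v‖ := by
    calc _ ≤ C₁ * (e * ‖v‖ + e * ‖v‖) := by gcongr
      _ = _ := by ring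
  have hx1 : ‖x‖ ≤ 2 * C₁ * ‖v‖ := by
    calc _ ≤ C₁ * (‖v‖ + ‖b‖) := hxb
      _ ≤ C₁ * (‖v‖ + ‖v‖) := by gcongr
      _ = _ := by ring
  have hxd' : ‖x - d • v‖ ≤ (l + 2 * C₁) * e * ‖v‖ := by
    have : |onset d c k α| ≤ l * e := by
      rw [onset_eq hpos, abs_mul, abs_of_pos hpos, ← hl, mul_comm]
      gcongr; exact hαρ.1.1.le
    have := mul_le_mul_of_nonneg_right this hv0
    linarith
  have hMe : ∀ a ≤ M, a * e ≤ ε := fun a ha => (mul_le_mul_of_nonneg_right ha he.le).trans heM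
  refine ⟨hvpos, ?_, ?_, fun j => ?_⟩
  · refine (hwb.trans hbd).trans ?_
    gcongr
    exact hMe _ (by linarith)
  · refine hmain.trans ?_
    have h1 := mul_le_mul_of_nonneg_left (evidence_terms_le he1 hv0 hb0 hbe) hC.le
    have h3 := mul_le_mul_of_nonneg_right (hMe (1 + 3 * C) (by linarith)) (pow_nonneg hv0 3)
    linarith
  · have hxj := (abs_apply_le_norm x j).trans hx1
    have hxρ : |x j| < ρ₃ := by
      refine hxj.trans_lt ?_
      have := (lt_div_iff₀ (by positivity)).1 hvρ.2.2
      linarith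
    have h1 := hinv (x j) hxρ
    have h3 := (abs_apply_le_norm (x - d • v) j).trans hxd'
    simp only [PiLp.sub_apply, PiLp.smul_apply, smul_eq_mul] at h3
    have h5 : |d * v j| ≤ d * ‖v‖ := by
      rw [abs_mul, abs_of_pos hd]
      gcongr
      exact abs_apply_le_norm v j
    have h6 : |x j ^ 2 - (d * v j) ^ 2| ≤
        (l + 2 * C₁) * e * ‖v‖ * ((2 * C₁ + d) * ‖v‖) := by
      rw [sq_sub_sq, mul_comm, abs_mul]
      gcongr
      refine (abs_add_le _ _).trans ?_
      linarith
    have h7 : e * |x j| ^ 2 ≤ e * (2 * C₁ * ‖v‖) ^ 2 := by gcongr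
    rw [← hs, slopeDefect]
    calc _ = |d * (((deriv S (x j))⁻¹ - 1 + s / 2 * x j ^ 2)
          - s / 2 * (x j ^ 2 - (d * v j) ^ 2))| := by ring_nf
      _ ≤ d * (e * (2 * C₁ * ‖v‖) ^ 2 + |s / 2| *
          ((l + 2 * C₁) * e * ‖v‖ * ((2 * C₁ + d) * ‖v‖))) := by
        rw [abs_mul, abs_of_pos hd]
        refine mul_le_mul_of_nonneg_left ((abs_sub _ _).trans (add_le_add (h1.trans h7) ?_)) hd.le
        rw [abs_mul]
        exact mul_le_mul_of_nonneg_left h6 (abs_nonneg _)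
      _ = d * ((2 * C₁) ^ 2 + |s / 2| * ((l + 2 * C₁) * (2 * C₁ + d))) * e * ‖v‖ ^ 2 := by ring
      _ ≤ _ := by gcongr; exact hMe _ (by linarith)

end equilibria

/-! ### Structure of stable equilibria -/

/-- Suppose β were negligible against t³. The equilibrium equation then makes m negligible against
t². For G > 0 this contradicts the radial condition; for G < 0 it forces μ ≥ |G|t²/2, so μ³ is of
order t⁶ and exceeds M β². -/
lemma cube_le_of_stable {G m μ t β e M C₀ : ℝ} (hG : G ≠ 0) (ht : 0 < t) (hβ : 0 < β)
    (hm : m = μ + G * t ^ 2) (hmβ : |m| * t ≤ β + e * t ^ 3) (hrad : m + 2 * G * t ^ 2 ≤ e * t ^ 2)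
    (hμ : μ ^ 3 ≤ M * β ^ 2) (hC₀ : 0 < C₀) (he : e ≤ |G| / 8) (hC₁ : 8 ≤ |G| * C₀)
    (hC₂ : 8 * M ≤ |G| ^ 3 * C₀ ^ 2) : t ^ 3 ≤ C₀ * β := by
  by_contra hcon
  push Not at hcon
  have hg : 0 < |G| := abs_pos.2 hG
  have h1 : β ≤ |G| / 8 * t ^ 3 := by
    have : 8 * β ≤ |G| * (C₀ * β) := by
      rw [← mul_assoc]; exact mul_le_mul_of_nonneg_right hC₁ hβ.le
    have := mul_le_mul_of_nonneg_left hcon.le hg.le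
    linarith
  have ht3 : 0 < t ^ 3 := by positivity
  have ht2 : 0 < t ^ 2 := by positivity
  have h2 : |m| ≤ |G| / 4 * t ^ 2 := by
    refine le_of_mul_le_mul_right ?_ ht
    have := mul_le_mul_of_nonneg_right he ht3.le
    calc |m| * t ≤ |G| / 8 * t ^ 3 + |G| / 8 * t ^ 3 := by linarith
      _ = |G| / 4 * t ^ 2 * t := by ring
  have h3 := abs_le.1 h2
  rcases lt_or_gt_of_ne hG with hneg | hgt
  · have habs : |G| = -G := abs_of_neg hneg
    have h4 : |G| / 2 * t ^ 2 ≤ μ := by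
      have h := h3.1
      rw [habs] at h ⊢
      have : 0 ≤ -G * t ^ 2 := mul_nonneg (by linarith) ht2.le
      linarith
    have h5 : (|G| / 2 * t ^ 2) ^ 3 ≤ μ ^ 3 := pow_le_pow_left₀ (by positivity) h4 3
    have h6 : (C₀ * β) ^ 2 < (t ^ 3) ^ 2 := pow_lt_pow_left₀ hcon (by positivity) (by norm_num)
    have h7 : |G| ^ 3 / 8 * (C₀ * β) ^ 2 < |G| ^ 3 / 8 * (t ^ 3) ^ 2 := by gcongr
    have h8 : M * β ^ 2 ≤ |G| ^ 3 / 8 * (C₀ * β) ^ 2 := by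
      have := mul_le_mul_of_nonneg_right hC₂ (sq_nonneg β)
      linarith
    have h9 : (|G| / 2 * t ^ 2) ^ 3 = |G| ^ 3 / 8 * (t ^ 3) ^ 2 := by ring
    linarith
  · rw [abs_of_pos hgt] at *
    have h4 := mul_le_mul_of_nonneg_right he ht2.le
    have : 0 < G * t ^ 2 := by positivity
    linarith [h3.1]

lemma exists_cube_constant (M : ℝ) {g : ℝ} (hg : 0 < g) :
    ∃ C₀ > 0, 8 ≤ g * C₀ ∧ 8 * M ≤ g ^ 3 * C₀ ^ 2 := by
  refine ⟨8 / g + 8 * (|M| + 1) / g ^ 2, by positivity, ?_, ?_⟩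
  · have : 0 ≤ 8 * (|M| + 1) / g := by positivity
    calc (8 : ℝ) ≤ 8 + 8 * (|M| + 1) / g := by linarith
      _ = _ := by field_simp
  · have e : g ^ 3 * (8 / g + 8 * (|M| + 1) / g ^ 2) ^ 2 =
        64 * g + 128 * (|M| + 1) + 64 * (|M| + 1) ^ 2 / g := by field_simp; ring
    rw [e]
    have h1 : 0 ≤ 64 * (|M| + 1) ^ 2 / g := by positivity
    linarith [le_abs_self M, abs_nonneg M]

/-- The critical component of a stable equilibrium is aligned with the projected evidence. -/
lemma aligned_of_stable {v p : State K} {m β t e C₀ : ℝ} (ht : t = ‖v‖) (hβ : β = ‖p‖)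
    (ht0 : 0 < t) (hβ0 : 0 < β) (hC₀ : 0 < C₀) (hmain : ‖m • v + p‖ ≤ e * t ^ 3)
    (hcube : t ^ 3 ≤ C₀ * β) (he0 : 0 ≤ e) (he : 4 * (e * C₀) ≤ 1) (htan : m ≤ e * t ^ 2) :
    t ^ 2 / (2 * C₀) ≤ -m ∧ ‖v - (t / β) • p‖ ≤ 2 * (e * C₀) * t := by
  have hcube' : e * t ^ 3 ≤ e * C₀ * β := by
    rw [mul_assoc]; exact mul_le_mul_of_nonneg_left hcube he0
  have hnmv : ‖m • v‖ = |m| * t := by rw [norm_smul, norm_eq_abs, ht]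
  have h1 : β ≤ |m| * t + e * t ^ 3 := by
    have := norm_sub_le (m • v + p) (m • v)
    rw [add_sub_cancel_left, hnmv, ← hβ] at this
    linarith
  have h2 : |m| * t ≤ β + e * t ^ 3 := by
    have := norm_sub_le (m • v + p) p
    rw [add_sub_cancel_right, hnmv, ← hβ] at this
    linarith
  have heC : e * C₀ * β ≤ 1 / 4 * β := by
    have := mul_le_mul_of_nonneg_right he hβ0.le
    linarith
  -- If m were positive, the equation would give β ≤ 2e t³ ≤ β/2.
  have hm0 : m ≤ 0 := by
    by_contra hcon
    push Not at hcon
    rw [abs_of_pos hcon] at h1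
    have := mul_le_mul_of_nonneg_right htan ht0.le
    have e1 : e * t ^ 2 * t = e * t ^ 3 := by ring
    linarith
  rw [abs_of_nonpos hm0] at h1 h2
  constructor
  · have h3 : β / 2 ≤ -m * t := by linarith
    have h4 : t ^ 3 / (2 * C₀) ≤ -m * t := by
      rw [div_le_iff₀ (by positivity)]
      have := mul_le_mul_of_nonneg_left h3 (by positivity : 0 ≤ 2 * C₀)
      linarith
    refine le_of_mul_le_mul_right ?_ ht0
    calc t ^ 2 / (2 * C₀) * t = t ^ 3 / (2 * C₀) := by ring
      _ ≤ _ := h4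
  -- Alignment follows from the equation m v + p ≈ 0 and from β + m t ≈ 0, both up to e C₀ β.
  · have e1 : v - (t / β) • p = ((β + m * t) / β) • v - (t / β) • (m • v + p) := by
      rw [smul_add, smul_smul]
      have : ((β + m * t) / β) • v = v + (t / β * m) • v := by
        rw [show (β + m * t) / β = 1 + t / β * m by field_simp, add_smul, one_smul]
      rw [this]; abel
    have h5 : |β + m * t| ≤ e * C₀ * β := by
      rw [abs_le]; constructor <;> linarith
    rw [e1]
    calc _ ≤ ‖((β + m * t) / β) • v‖ + ‖(t / β) • (m • v + p)‖ := norm_sub_le _ _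
      _ = |β + m * t| / β * t + t / β * ‖m • v + p‖ := by
        rw [norm_smul, norm_smul, norm_eq_abs, norm_eq_abs, abs_div, abs_of_pos hβ0,
          abs_of_pos (by positivity : 0 < t / β), ht]
      _ ≤ e * C₀ * β / β * t + t / β * (e * C₀ * β) := by
        gcongr
        exact hmain.trans hcube'
      _ = _ := by field_simp; ring

section equilibria

variable {S : ℝ → ℝ} {d : ℝ} {c : ZMod K → ℝ} {k : ℕ} (hd : 0 < d)
    (hSodd : ∀ x, S (-x) = -S x) (hS : ContDiff ℝ 3 S) (hS1 : deriv S 0 = 1)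
    (hS3 : iteratedDeriv 3 S 0 ≠ 0)
    (hc : ∀ j, c (-j) = c j) (hpos : 0 < eigenvalue c k)
    (hdom : ∀ m ≤ K / 2, m ≠ k → eigenvalue c m < eigenvalue c k)
include hd hSodd hS hS1 hS3 hc hpos hdom

/-- Structure of equilibria near onset at which the stability form is nonnegative. -/
lemma exists_stable_structure (h2 : ¬ K ∣ 2 * k) (h4 : ¬ K ∣ 4 * k) {B : ℝ} (hB : 0 < B) (M : ℝ) :
    ∃ C₀ > 0, ∀ ε > 0, ∃ ρ > 0, ∀ v ∈ criticalSpace K k, ∀ w ∈ (criticalSpace K k)ᗮ,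
      ∀ (α : ℝ) (b : State K),
      ‖v‖ < ρ → ‖w‖ < ρ → |α - criticalGain d c k| < ρ → ‖b‖ < ρ →
      vectorField S d c α b (v + w) = 0 → ‖b‖ ≤ B * ‖proj k b‖ → proj k b ≠ 0 →
      onset d c k α ^ 3 ≤ M * ‖proj k b‖ ^ 2 →
      (∀ u ∈ criticalSpace K k, 0 ≤ stabilityForm S d c α (netInput c α b (v + w)) u) →
      0 < ‖v‖ ∧ ‖w‖ ≤ ε * ‖v‖ ∧ ‖v - (‖v‖ / ‖proj k b‖) • proj k b‖ ≤ ε * ‖v‖ ∧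
      (∀ u ∈ criticalSpace K k, 1 / (4 * C₀) * ‖v‖ ^ 2 * ‖u‖ ^ 2
        - 2 * (cubicCoeff S d c k / K) * inner ℝ v u ^ 2 ≤
          stabilityForm S d c α (netInput c α b (v + w)) u) ∧
      ∀ j, |slopeDefect S d (netInput c α b (v + w)) j
        + iteratedDeriv 3 S 0 / 2 * d ^ 3 * v j ^ 2| ≤ ε * ‖v‖ ^ 2 := by
  have hK : (K : ℝ) ≠ 0 := NeZero.ne _
  obtain ⟨G, hGdef⟩ : ∃ G, G = cubicCoeff S d c k / K := ⟨_, rfl⟩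
  have hG : G ≠ 0 := by
    rw [hGdef, cubicCoeff_eq S hpos]
    positivity
  have hg : 0 < |G| := abs_pos.2 hG
  obtain ⟨C₀, hC₀, hC₁, hC₂⟩ := exists_cube_constant M hg
  refine ⟨C₀, hC₀, fun ε hε => ?_⟩
  obtain ⟨e, he, heε, heG, heC, heCε⟩ : ∃ e > 0, e ≤ ε ∧ e ≤ |G| / 8 ∧ 4 * (e * C₀) ≤ 1 ∧
      2 * (e * C₀) ≤ ε := by
    refine ⟨min (min ε (|G| / 8)) (min (1 / (4 * C₀)) (ε / (2 * C₀))), by positivity,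
      (min_le_left _ _).trans (min_le_left _ _), (min_le_left _ _).trans (min_le_right _ _), ?_, ?_⟩
    · have := (le_div_iff₀ (by positivity)).1 ((min_le_right (min ε (|G| / 8))
        (min (1 / (4 * C₀)) (ε / (2 * C₀)))).trans (min_le_left _ _))
      linarith
    · have := (le_div_iff₀ (by positivity)).1 ((min_le_right (min ε (|G| / 8))
        (min (1 / (4 * C₀)) (ε / (2 * C₀)))).trans (min_le_right _ _))
      linarith
  obtain ⟨ρ, hρ, hasym⟩ :=
    exists_equilibrium_asymptotics hd hSodd hS hS1 hc hpos hdom h2 h4 hB he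
  refine ⟨ρ, hρ, fun v hv w hw α b hvρ hwρ hαρ hbρ hF hbB hPb hμ hQ => ?_⟩
  obtain ⟨hv0, hwe, hmain, hκ⟩ := hasym v hv w hw α b hvρ hwρ hαρ hbρ hF hbB hPb
  generalize netInput c α b (v + w) = x at hQ hκ ⊢
  have hform : ∀ u ∈ criticalSpace K k, _ := fun u hu =>
    abs_le.1 (abs_stabilityForm_sub_le hc hpos h2 h4 (α := α) hv hu hκ)
  rw [← hGdef] at hmain hform ⊢
  obtain ⟨m, hm⟩ : ∃ m, m = onset d c k α + G * ‖v‖ ^ 2 := ⟨_, rfl⟩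
  rw [← hm] at hmain hform
  have hβ0 : 0 < ‖proj k b‖ := norm_pos_iff.2 hPb
  have hv2 : 0 < ‖v‖ ^ 2 := by positivity
  -- Tangential condition: orthogonality removes the G term of the stability form, leaving only -m.
  have htan : m ≤ e * ‖v‖ ^ 2 := by
    obtain ⟨u, hu, huv, hun⟩ := exists_orthogonal_mem h2 hv
    have h1 := (hform u hu).2
    have h3 := hQ u hu
    rw [huv, hun] at h1
    refine le_of_mul_le_mul_right ?_ hv2
    linarith
  have hrad : m + 2 * G * ‖v‖ ^ 2 ≤ e * ‖v‖ ^ 2 := by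
    have h1 := (hform v hv).2
    have h3 := hQ v hv
    rw [real_inner_self_eq_norm_sq] at h1
    refine le_of_mul_le_mul_right ?_ hv2
    linarith
  have hmβ : |m| * ‖v‖ ≤ ‖proj k b‖ + e * ‖v‖ ^ 3 := by
    have := norm_sub_le (m • v + proj k b) (proj k b)
    rw [add_sub_cancel_right, norm_smul, norm_eq_abs] at this
    linarith
  have hcube := cube_le_of_stable hG hv0 hβ0 hm hmβ hrad hμ hC₀ heG hC₁ hC₂
  obtain ⟨hneg, halign⟩ := aligned_of_stable rfl rfl hv0 hβ0 hC₀ hmain hcube he.le heC htan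
  -- From -m ≥ t²/(2C₀), half pays for the error e ≤ 1/(4C₀) and half remains. The constant C₀
  -- depends on Γ/K and M only, not on ε.
  refine ⟨hv0, hwe.trans (by gcongr), halign.trans (by gcongr), fun u hu => ?_,
    fun j => (hκ j).trans (by gcongr)⟩
  have h1 := (hform u hu).1
  have h3 := mul_le_mul_of_nonneg_right hneg (sq_nonneg ‖u‖)
  have h5 : e ≤ 1 / (4 * C₀) := by rw [le_div_iff₀ (by positivity)]; linarith
  have h6 : e * ‖v‖ ^ 2 * ‖u‖ ^ 2 ≤ 1 / (4 * C₀) * ‖v‖ ^ 2 * ‖u‖ ^ 2 := by gcongr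
  have h7 : ‖v‖ ^ 2 / (2 * C₀) * ‖u‖ ^ 2 = 2 * (1 / (4 * C₀) * ‖v‖ ^ 2 * ‖u‖ ^ 2) := by
    field_simp; ring
  linarith

omit hd hSodd hS hS1 hS3 hc hpos hdom in
lemma norm_sub_proj_le (z : State K) : ‖z - proj k z‖ ≤ 2 * ‖z‖ := by
  have := norm_sub_le z (proj k z)
  have := norm_proj_le k z
  linarith

/-- Stable equilibria near onset select best responses to decisive evidence. -/
lemma exists_selection (h2 : ¬ K ∣ 2 * k) (h4 : ¬ K ∣ 4 * k) {B : ℝ} (hB : 0 < B) (M : ℝ) {δ : ℝ}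
    (hδ : 0 < δ) :
    ∃ ρ > 0, ∀ (α : ℝ) (b z : State K),
      ‖z‖ < ρ → |α - criticalGain d c k| < ρ → ‖b‖ < ρ →
      vectorField S d c α b z = 0 → ‖b‖ ≤ B * ‖proj k b‖ → proj k b ≠ 0 →
      onset d c k α ^ 3 ≤ M * ‖proj k b‖ ^ 2 →
      (∀ u, 0 ≤ stabilityForm S d c α (netInput c α b z) u) → Decisive k δ b →
      ∀ a, Selects z a → a ∈ bestResponse k b := by
  have hK : (1 : ℝ) ≤ K := Nat.one_le_cast.2 (NeZero.pos K)
  have hK0 : (0 : ℝ) < K := by linarith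
  obtain ⟨C₀, -, hstr⟩ :=
    exists_stable_structure hd hSodd hS hS1 hS3 hc hpos hdom h2 h4 hB M
  -- Misalignment and noncritical part together cost δ‖v‖/(4K), strictly less than δ‖v‖/(2K), which
  -- the decisive margin covers because ‖Ψ_A b‖ ≤ K A.
  obtain ⟨ρ, hρ, hstr⟩ := hstr (δ / (8 * K)) (by positivity)
  refine ⟨ρ / 2, by positivity, fun α b z hz hα hb hF hbB hPb hμ hQ hdec a ha => ?_⟩
  have hzz : proj k z + (z - proj k z) = z := by abel
  obtain ⟨hv0, hwe, halign, -, -⟩ := hstr (proj k z) (proj_mem k z) (z - proj k z)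
    (sub_proj_mem k z) α b (by linarith [norm_proj_le k z]) (by linarith [norm_sub_proj_le (k := k) z])
    (by linarith) (by linarith) (by rw [hzz]; exact hF) hbB hPb hμ
    (fun u _ => by rw [hzz]; exact hQ u)
  have hβ0 : 0 < ‖proj k b‖ := norm_pos_iff.2 hPb
  have hamp : ‖proj k b‖ ≤ K * amplitude b k := by
    refine (abs_le_of_sq_le_sq' (?_ : ‖proj k b‖ ^ 2 ≤ (K * amplitude b k) ^ 2)
      (mul_nonneg hK0.le (amplitude_nonneg b k))).2
    rw [norm_proj_sq h2, mul_pow]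
    gcongr
    nlinarith
  refine mem_bestResponse_of_near (s := ‖proj k z‖ / ‖proj k b‖) hdec (fun j => ?_)
    (by positivity) ha
  have h1 : ‖z - (‖proj k z‖ / ‖proj k b‖) • proj k b‖ ≤ δ / (4 * K) * ‖proj k z‖ := by
    calc _ = ‖(proj k z - (‖proj k z‖ / ‖proj k b‖) • proj k b) + (z - proj k z)‖ := by
          congr 1; abel
      _ ≤ δ / (8 * K) * ‖proj k z‖ + δ / (8 * K) * ‖proj k z‖ :=
          (norm_add_le _ _).trans (add_le_add halign hwe)
      _ = _ := by ring
  have h3 := (abs_apply_le_norm (z - (‖proj k z‖ / ‖proj k b‖) • proj k b) j).trans h1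
  rw [PiLp.sub_apply, PiLp.smul_apply, smul_eq_mul] at h3
  refine h3.trans_lt ?_
  have h5 : δ / (4 * K) * ‖proj k z‖ < δ / (2 * K) * ‖proj k z‖ := by
    gcongr; norm_num
  refine h5.trans_le ?_
  calc δ / (2 * K) * ‖proj k z‖ =
        ‖proj k z‖ / ‖proj k b‖ * (δ * ‖proj k b‖) / (2 * K) := by field_simp
    _ ≤ ‖proj k z‖ / ‖proj k b‖ * (δ * (K * amplitude b k)) / (2 * K) := by gcongr
    _ = _ := by field_simp

/-- For a saturating nonlinearity, nonnegativity of the stability form at an equilibrium near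
onset improves to positivity. -/
lemma exists_stabilityForm_pos (h2 : ¬ K ∣ 2 * k) (h4 : ¬ K ∣ 4 * k)
    (hneg : iteratedDeriv 3 S 0 < 0) {B : ℝ} (hB : 0 < B) (M : ℝ) :
    ∃ ρ > 0, ∀ (α : ℝ) (b z : State K),
      ‖z‖ < ρ → |α - criticalGain d c k| < ρ → ‖b‖ < ρ →
      vectorField S d c α b z = 0 → ‖b‖ ≤ B * ‖proj k b‖ → proj k b ≠ 0 →
      onset d c k α ^ 3 ≤ M * ‖proj k b‖ ^ 2 →
      (∀ u, 0 ≤ stabilityForm S d c α (netInput c α b z) u) →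
      ∀ u, u ≠ 0 → 0 < stabilityForm S d c α (netInput c α b z) u := by
  have hK0 : (0 : ℝ) < K := Nat.cast_pos.2 (NeZero.pos K)
  obtain ⟨γ, hγ, ρ₀, hρ₀, hcoer⟩ := exists_coercive hd hc hpos hdom
  obtain ⟨C₀, hC₀, hstr⟩ :=
    exists_stable_structure hd hSodd hS hS1 hS3 hc hpos hdom h2 h4 hB M
  obtain ⟨ρ, hρ, hstr⟩ := hstr 1 one_pos
  obtain ⟨D, hD⟩ : ∃ D, D = 1 + |iteratedDeriv 3 S 0 / 2 * d ^ 3| := ⟨_, rfl⟩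
  have hD0 : 0 < D := by rw [hD]; positivity
  obtain ⟨q, hq⟩ : ∃ q, q = 1 / (4 * C₀) := ⟨_, rfl⟩
  have hq0 : 0 < q := by rw [hq]; positivity
  obtain ⟨T, hT⟩ : ∃ T, T = D * (2 * D / q + 1) := ⟨_, rfl⟩
  have hT0 : 0 < T := by rw [hT]; positivity
  refine ⟨min (min ρ₀ (ρ / 2)) (min 1 (γ / T)), by positivity, ?_⟩
  intro α b z hz hα hb hF hbB hPb hμ hQ u hu
  simp only [lt_min_iff] at hz hα hb
  have hzz : proj k z + (z - proj k z) = z := by abel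
  have hpz := norm_proj_le k z
  obtain ⟨hv0, -, -, hcrit, hκ⟩ := hstr (proj k z) (proj_mem k z) (z - proj k z)
    (sub_proj_mem k z) α b (by linarith [hz.1.2])
    (by linarith [norm_sub_proj_le (k := k) z, hz.1.2])
    (by linarith [hα.1.2]) (by linarith [hb.1.2]) (by rw [hzz]; exact hF) hbB hPb hμ
    (fun u _ => by rw [hzz]; exact hQ u)
  rw [hzz] at hcrit hκ
  refine stabilityForm_pos hc hD0 hq0 hv0 (fun j => ?_) (hcoer α hα.1.1).2 (fun p hp => ?_) ?_ hu
  · have h1 : |iteratedDeriv 3 S 0 / 2 * d ^ 3 * proj k z j ^ 2| ≤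
        |iteratedDeriv 3 S 0 / 2 * d ^ 3| * ‖proj k z‖ ^ 2 := by
      rw [abs_mul, abs_pow]
      gcongr
      exact abs_apply_le_norm _ j
    calc _ = |(slopeDefect S d (netInput c α b z) j
          + iteratedDeriv 3 S 0 / 2 * d ^ 3 * proj k z j ^ 2)
          - iteratedDeriv 3 S 0 / 2 * d ^ 3 * proj k z j ^ 2| := by rw [add_sub_cancel_right]
      _ ≤ _ := (abs_sub _ _).trans (add_le_add (hκ j) h1)
      _ = D * ‖proj k z‖ ^ 2 := by rw [hD]; ring
  · refine le_trans ?_ (hcrit p hp)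
    -- Saturation is used here: for Γ < 0 the radial term of the form is nonnegative and can be
    -- dropped.
    have h1 : cubicCoeff S d c k / K ≤ 0 := by
      rw [cubicCoeff_eq S hpos]
      refine div_nonpos_of_nonpos_of_nonneg ?_ hK0.le
      exact mul_nonpos_of_nonpos_of_nonneg (by linarith) (by positivity)
    have h3 := mul_nonneg (neg_nonneg.2 h1) (sq_nonneg (inner ℝ (proj k z) p))
    rw [hq]
    linarith
  · rw [← hT]
    have h1 : ‖proj k z‖ < γ / T := by linarith [hz.2.2]
    rw [lt_div_iff₀ hT0] at h1
    have h3 : ‖proj k z‖ * ‖proj k z‖ ≤ ‖proj k z‖ :=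
      mul_le_of_le_of_le_one_right hv0.le le_rfl (by linarith [hz.2.1])
    have := mul_le_mul_of_nonneg_left h3 hT0.le
    linarith

end equilibria

/-! ### Existence of stable equilibria by energy minimization -/

/-- Second-order necessary condition at a local minimum. -/
lemma deriv_deriv_nonneg_of_isLocalMin {f : ℝ → ℝ} {a : ℝ} (hmin : IsLocalMin f a)
    (hf : ContinuousAt f a) : 0 ≤ deriv (deriv f) a := by
  by_contra hcon
  push Not at hcon
  have hmax := isLocalMax_of_deriv_deriv_neg hcon hmin.deriv_eq_zero hf
  -- A negative second derivative would make the minimum also a local maximum, hence f locally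
  -- constant.
  have heq : f =ᶠ[𝓝 a] fun _ => f a := by
    filter_upwards [hmin, hmax] with x h1 h2 using le_antisymm h2 h1
  have h1 : deriv f =ᶠ[𝓝 a] deriv fun _ => f a := heq.deriv
  have h2 : deriv (deriv f) a = 0 := by
    rw [h1.deriv_eq]; simp
  linarith

lemma hasDerivAt_state {f : ℝ → State K} {f' : State K} {t : ℝ}
    (h : ∀ j, HasDerivAt (fun s => f s j) (f' j) t) : HasDerivAt f f' t := by
  rw [hasDerivAt_iff_hasFDerivAt, ← hasFDerivWithinAt_univ, hasFDerivWithinAt_euclidean]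
  intro j
  refine ((h j).hasFDerivAt.congr_fderiv ?_).hasFDerivWithinAt
  ext
  simp

/-- The nonlinearity acting componentwise. -/
noncomputable def activation (S : ℝ → ℝ) (x : State K) : State K := WithLp.toLp 2 fun j => S (x j)

/-- The Lyapunov function of the decision dynamics in terms of the net input. -/
noncomputable def energy (S : ℝ → ℝ) (d : ℝ) (c : ZMod K → ℝ) (α : ℝ) (b x : State K) : ℝ :=
  ∑ j, (x j * S (x j) - ∫ s in (0 : ℝ)..x j, S s)
    - α / (2 * d) * inner ℝ (activation S x) (coupling c (activation S x))
    - inner ℝ b (activation S x)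

/-- The defect of the equilibrium equation in terms of the net input. -/
noncomputable def inputDefect (S : ℝ → ℝ) (d : ℝ) (c : ZMod K → ℝ) (α : ℝ) (b x : State K) :
    State K :=
  x - (α / d) • coupling c (activation S x) - b

section energy

variable {S : ℝ → ℝ} {d : ℝ} {c : ZMod K → ℝ} {α : ℝ} {b : State K} (hS : ContDiff ℝ 3 S)
include hS

lemma hasDerivAt_activation_line (x h : State K) (t : ℝ) :
    HasDerivAt (fun s : ℝ => activation S (x + s • h))
      (WithLp.toLp 2 fun j => deriv S ((x + t • h) j) * h j) t := by
  refine hasDerivAt_state fun j => ?_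
  have h1 : HasDerivAt (fun s : ℝ => (x + s • h) j) (h j) t := by
    have := ((hasDerivAt_id t).mul_const (h j)).const_add (x j)
    simpa using this
  exact (hasDerivAt_of_contDiff hS ((x + t • h) j)).comp t h1

lemma hasDerivAt_slope_line (x h : State K) (t : ℝ) :
    HasDerivAt (fun s : ℝ => (WithLp.toLp 2 fun j => deriv S ((x + s • h) j) * h j : State K))
      (WithLp.toLp 2 fun j => deriv (deriv S) ((x + t • h) j) * h j * h j) t := by
  refine hasDerivAt_state fun j => ?_
  have h1 : HasDerivAt (fun s : ℝ => (x + s • h) j) (h j) t := by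
    have := ((hasDerivAt_id t).mul_const (h j)).const_add (x j)
    simpa using this
  exact ((hasDerivAt_deriv_of_contDiff hS ((x + t • h) j)).comp t h1).mul_const (h j)

/-- The Legendre form of a primitive of the inverse of S, evaluated at S(y); written this way no
inverse function is needed. -/
lemma hasDerivAt_potential (y : ℝ) :
    HasDerivAt (fun y => y * S y - ∫ s in (0 : ℝ)..y, S s) (y * deriv S y) y := by
  have h1 := (hasDerivAt_id y).mul (hasDerivAt_of_contDiff hS y)
  have h2 := (hS.continuous.integral_hasStrictDerivAt 0 y).hasDerivAt
  exact (h1.sub h2).congr_deriv (by simp)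

/-- By symmetry of A, the energy gradient is the equilibrium defect weighted by the slopes S'(x_j),
so critical points with positive slopes are equilibria. -/
lemma hasDerivAt_energy_line (hc : ∀ j, c (-j) = c j) (x h : State K) (t : ℝ) :
    HasDerivAt (fun s : ℝ => energy S d c α b (x + s • h))
      (inner ℝ (WithLp.toLp 2 fun j => deriv S ((x + t • h) j) * h j : State K)
        (inputDefect S d c α b (x + t • h))) t := by
  have hσ := hasDerivAt_activation_line hS x h t
  set σ' : State K := WithLp.toLp 2 fun j => deriv S ((x + t • h) j) * h j with hσ'
  have h1 : HasDerivAt (fun s : ℝ => ∑ j, ((x + s • h) j * S ((x + s • h) j)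
      - ∫ r in (0 : ℝ)..(x + s • h) j, S r)) (inner ℝ σ' (x + t • h)) t := by
    rw [state_inner]
    refine HasDerivAt.fun_sum fun j _ => ?_
    have h2 : HasDerivAt (fun s : ℝ => (x + s • h) j) (h j) t := by
      have := ((hasDerivAt_id t).mul_const (h j)).const_add (x j)
      simpa using this
    refine ((hasDerivAt_potential hS ((x + t • h) j)).comp t h2).congr_deriv ?_
    simp only [hσ']
    ring
  have hA : HasDerivAt (fun s : ℝ => coupling c (activation S (x + s • h))) (coupling c σ') t :=
    (coupling c).hasFDerivAt.comp_hasDerivAt t hσ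
  have h3 := (hσ.inner ℝ hA).const_mul (α / (2 * d))
  have h4 := (hasDerivAt_const t b).inner ℝ hσ
  refine ((h1.sub h3).sub h4).congr_deriv ?_
  have e1 : inner ℝ (activation S (x + t • h)) (coupling c σ') =
      inner ℝ σ' (coupling c (activation S (x + t • h))) := by
    rw [← inner_coupling_comm hc, real_inner_comm]
  rw [e1, inputDefect, inner_sub_right, inner_sub_right, inner_smul_right, inner_zero_left,
    real_inner_comm b σ']
  ring

lemma continuous_energy : Continuous (energy S d c α b) := by
  have hact : Continuous (activation S : State K → State K) := by
    have : ∀ j : ZMod K, Continuous fun x : State K => S (x j) := fun j =>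
      hS.continuous.comp (by fun_prop)
    exact (PiLp.continuous_toLp 2 _).comp (continuous_pi this)
  have hpot : ∀ j : ZMod K, Continuous fun x : State K =>
      x j * S (x j) - ∫ s in (0 : ℝ)..x j, S s := fun j =>
    (continuous_iff_continuousAt.2 fun y => (hasDerivAt_potential hS y).continuousAt).comp
      (by fun_prop : Continuous fun x : State K => x j)
  unfold energy
  exact ((continuous_finsetSum _ fun j _ => hpot j).sub
    (continuous_const.mul (hact.inner ((coupling c).continuous.comp hact)))).sub
    (continuous_const.inner hact)

/-- An interior minimizer of the energy solves the equilibrium equation, and the stability form is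
nonnegative there. -/
lemma equilibrium_of_isLocalMin (hc : ∀ j, c (-j) = c j) (hd : 0 < d) {x : State K}
    (hmin : IsLocalMin (energy S d c α b) x) (hD : ∀ j, 0 < deriv S (x j)) :
    inputDefect S d c α b x = 0 ∧ ∀ u, 0 ≤ stabilityForm S d c α x u := by
  have hline : ∀ h : State K, IsLocalMin (fun s : ℝ => energy S d c α b (x + s • h)) 0 := by
    intro h
    have hcont : ContinuousAt (fun s : ℝ => x + s • h) 0 := by fun_prop
    have hx0 : x + (0 : ℝ) • h = x := by simp
    have : IsLocalMin (energy S d c α b) (x + (0 : ℝ) • h) := by rw [hx0]; exact hmin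
    exact IsLocalMin.comp_continuous (g := fun s : ℝ => x + s • h) this hcont
  -- Differentiating in the direction of the defect itself gives a sum of its squared components
  -- with positive weights.
  have hzero : inputDefect S d c α b x = 0 := by
    have h1 := (hline (inputDefect S d c α b x)).hasDerivAt_eq_zero
      (hasDerivAt_energy_line hS hc x _ 0)
    rw [zero_smul, add_zero, state_inner] at h1
    have h2 := (sum_eq_zero_iff_of_nonneg fun j _ => by
      have := (hD j).le
      rw [mul_assoc]
      exact mul_nonneg this (mul_self_nonneg _)).1 h1
    ext j
    have h3 := h2 j (mem_univ j)
    rw [mul_assoc] at h3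
    exact mul_self_eq_zero.1 ((mul_eq_zero.1 h3).resolve_left (hD j).ne')
  refine ⟨hzero, fun u => ?_⟩
  -- This direction makes the activation move with velocity u. The term with S'' multiplies the
  -- vanishing defect, so d times the second derivative is exactly the stability form at u.
  set h : State K := WithLp.toLp 2 fun j => u j / deriv S (x j) with hh
  have hder : deriv (fun s : ℝ => energy S d c α b (x + s • h)) = fun t =>
      inner ℝ (WithLp.toLp 2 fun j => deriv S ((x + t • h) j) * h j : State K)
        (inputDefect S d c α b (x + t • h)) :=
    funext fun t => (hasDerivAt_energy_line hS hc x h t).deriv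
  have hsec := deriv_deriv_nonneg_of_isLocalMin (hline h)
    (hasDerivAt_energy_line hS hc x h 0).continuousAt
  rw [hder] at hsec
  have hR : HasDerivAt (fun t : ℝ => inputDefect S d c α b (x + t • h))
      (h - (α / d) • coupling c (WithLp.toLp 2 fun j => deriv S ((x + (0 : ℝ) • h) j) * h j)) 0 := by
    have h1 : HasDerivAt (fun t : ℝ => x + t • h) h 0 := by
      simpa using ((hasDerivAt_id (0 : ℝ)).smul_const h).const_add x
    have h2 : HasDerivAt (fun s : ℝ => coupling c (activation S (x + s • h)))
        (coupling c (WithLp.toLp 2 fun j => deriv S ((x + (0 : ℝ) • h) j) * h j)) 0 :=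
      (coupling c).hasFDerivAt.comp_hasDerivAt 0 (hasDerivAt_activation_line hS x h 0)
    exact (h1.sub (h2.const_smul (α / d))).sub_const b
  have htot := (hasDerivAt_slope_line hS x h 0).inner ℝ hR
  rw [htot.deriv] at hsec
  have hu : (WithLp.toLp 2 fun j => deriv S ((x + (0 : ℝ) • h) j) * h j : State K) = u := by
    ext j
    simp only [zero_smul, add_zero, hh]
    exact mul_div_cancel₀ _ (hD j).ne'
  rw [hu] at hsec
  simp only [zero_smul, add_zero, hzero, inner_zero_right] at hsec
  rw [inner_sub_right, inner_smul_right] at hsec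
  have hsum : d * inner ℝ u h = ∑ j, d * u j ^ 2 / deriv S (x j) := by
    rw [state_inner, mul_sum]
    exact sum_congr rfl fun j _ => by simp only [hh]; ring
  have h5 := mul_nonneg hd.le hsec
  rw [mul_sub, hsum, ← mul_assoc, mul_div_cancel₀ _ hd.ne'] at h5
  exact h5

end energy

/-! ### The quartic energy well of a saturating nonlinearity -/

section existence

variable {S : ℝ → ℝ} {d : ℝ} {c : ZMod K → ℝ} {k : ℕ} (hd : 0 < d)
    (hSodd : ∀ x, S (-x) = -S x) (hS : ContDiff ℝ 3 S) (hS1 : deriv S 0 = 1)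
    (hneg : iteratedDeriv 3 S 0 < 0)
include hSodd hS hS1 hneg

/-- Quartic lower bound for the local part of the energy of a saturating nonlinearity. -/
lemma exists_quartic_le :
    ∃ a > 0, ∃ ρ > 0, ∀ y, |y| < ρ →
      a * y ^ 4 ≤ y * S y - (∫ s in (0 : ℝ)..y, S s) - S y ^ 2 / 2 := by
  set s₃ := iteratedDeriv 3 S 0 with hs₃
  -- Half of the cubic coefficient |s₃|/6 is given up to the remainder, leaving y - S(y) ≥ a y³ for
  -- y ≥ 0; with S' ≥ 1/2 the derivative of f then has the sign of y.
  obtain ⟨ρ₁, hρ₁, hexp⟩ := exists_expansion hSodd hS hS1 (ε := -s₃ / 12) (by linarith)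
  obtain ⟨ρ₂, hρ₂, hsl⟩ := exists_slope_bounds hS hS1
  obtain ⟨a, ha⟩ : ∃ a, a = -s₃ / 12 := ⟨_, rfl⟩
  have ha0 : 0 < a := by rw [ha]; linarith
  refine ⟨a / 8, by positivity, min ρ₁ ρ₂, by positivity, fun y hy => ?_⟩
  set f : ℝ → ℝ := fun y => y * S y - (∫ s in (0 : ℝ)..y, S s) - S y ^ 2 / 2 - a / 8 * y ^ 4
    with hf
  have hf' : ∀ y, HasDerivAt f (deriv S y * (y - S y) - a / 2 * y ^ 3) y := fun y => by
    have h1 := ((hasDerivAt_potential hS y).sub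
      (((hasDerivAt_of_contDiff hS y).pow 2).div_const 2)).sub
      ((hasDerivAt_pow 4 y).const_mul (a / 8))
    exact h1.congr_deriv (by push_cast; ring)
  have hcont : Continuous f := continuous_iff_continuousAt.2 fun y => (hf' y).continuousAt
  have hf0 : f 0 = 0 := by simp [hf, odd_zero hSodd]
  have hbd : ∀ r, |r| < min ρ₁ ρ₂ → 0 ≤ r → a * r ^ 3 ≤ r - S r := fun r hr hr0 => by
    rw [lt_min_iff] at hr
    have h1 := (abs_le.1 (hexp r hr.1)).2
    rw [abs_of_nonneg hr0] at h1
    rw [ha]; linarith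
  have hmono : ∀ r, |r| < min ρ₁ ρ₂ → 0 ≤ r → 0 ≤ deriv S r * (r - S r) - a / 2 * r ^ 3 := by
    intro r hr hr0
    have h1 := hbd r hr hr0
    rw [lt_min_iff] at hr
    have h2 := (hsl r hr.2).1
    have h3 : 0 ≤ a * r ^ 3 := by positivity
    nlinarith
  have hanti : ∀ r, |r| < min ρ₁ ρ₂ → r ≤ 0 → deriv S r * (r - S r) - a / 2 * r ^ 3 ≤ 0 := by
    intro r hr hr0
    have h1 := hmono (-r) (by rwa [abs_neg]) (by linarith)
    rw [deriv_neg_of_odd hSodd, hSodd] at h1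
    have e : (-r) ^ 3 = -r ^ 3 := by ring
    rw [e] at h1
    linarith
  have hgoal : 0 ≤ f y := by
    rcases le_total 0 y with hy0 | hy0
    · have hm : MonotoneOn f (Set.Icc 0 y) := by
        refine monotoneOn_of_deriv_nonneg (convex_Icc _ _) hcont.continuousOn
          (fun r _ => (hf' r).differentiableAt.differentiableWithinAt) fun r hr => ?_
        rw [(hf' r).deriv]
        have hr' := interior_subset hr
        refine hmono r ?_ hr'.1
        rw [abs_of_nonneg hr'.1]
        exact (hr'.2.trans (le_abs_self y)).trans_lt hy
      have := hm ⟨le_rfl, hy0⟩ ⟨hy0, le_rfl⟩ hy0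
      rwa [hf0] at this
    · have hm : AntitoneOn f (Set.Icc y 0) := by
        refine antitoneOn_of_deriv_nonpos (convex_Icc _ _) hcont.continuousOn
          (fun r _ => (hf' r).differentiableAt.differentiableWithinAt) fun r hr => ?_
        rw [(hf' r).deriv]
        have hr' := interior_subset hr
        refine hanti r ?_ hr'.2
        rw [abs_of_nonpos hr'.2]
        have := neg_le_abs y
        linarith [hr'.1]
      have := hm ⟨le_rfl, hy0⟩ ⟨hy0, le_rfl⟩ hy0
      rwa [hf0] at this
  simp only [hf] at hgoal
  linarith

omit hneg in
lemma exists_abs_le_two_mul : ∃ ρ > 0, ∀ y, |y| < ρ → |S y| ≤ 2 * |y| := by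
  obtain ⟨ρ, hρ, hsl⟩ := exists_slope_bounds hS hS1
  refine ⟨ρ, hρ, fun y hy => ?_⟩
  have := abs_le_pow_succ_of_deriv (n := 0) (C := 2) (f := S) (f' := deriv S) (odd_zero hSodd)
    (by norm_num) (hasDerivAt_of_contDiff hS) (fun r hr => by
      have := hsl r hr
      rw [pow_zero, mul_one, abs_of_nonneg (by linarith)]
      exact this.2) hy
  simpa using this

omit hneg in
lemma exists_norm_activation_le :
    ∃ ρ > 0, ∀ x : State K, ‖x‖ < ρ → ‖activation S x‖ ≤ 2 * ‖x‖ := by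
  obtain ⟨ρ, hρ, hb⟩ := exists_abs_le_two_mul hSodd hS hS1
  refine ⟨ρ, hρ, fun x hx => ?_⟩
  refine (abs_le_of_sq_le_sq' (?_ : ‖activation S x‖ ^ 2 ≤ (2 * ‖x‖) ^ 2) (by positivity)).2
  rw [mul_pow, norm_sq_eq_sum, norm_sq_eq_sum, mul_sum]
  refine sum_le_sum fun j _ => ?_
  have h1 := hb (x j) ((abs_apply_le_norm x j).trans_lt hx)
  have h2 := pow_le_pow_left₀ (abs_nonneg _) h1 2
  rw [mul_pow, sq_abs, sq_abs] at h2
  exact h2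

variable (hc : ∀ j, c (-j) = c j)
    (hdom : ∀ m ≤ K / 2, m ≠ k → eigenvalue c m < eigenvalue c k)
include hd hc hdom

/-- Lower bound of the energy. -/
lemma exists_energy_lower_bound :
    ∃ a > 0, ∃ ρ > 0, ∀ (α : ℝ) (b x : State K), 0 < α → ‖x‖ < ρ →
      a * ‖x‖ ^ 4 - 2 * |onset d c k α| / d * ‖x‖ ^ 2 - 2 * ‖b‖ * ‖x‖ ≤ energy S d c α b x := by
  obtain ⟨a, ha, ρ₁, hρ₁, hq⟩ := exists_quartic_le hSodd hS hS1 hneg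
  obtain ⟨ρ₂, hρ₂, hact⟩ := exists_norm_activation_le (K := K) hSodd hS hS1
  have hK0 : (0 : ℝ) < K := Nat.cast_pos.2 (NeZero.pos K)
  refine ⟨a / K, by positivity, min ρ₁ ρ₂, by positivity, fun α b x hα hx => ?_⟩
  rw [lt_min_iff] at hx
  have h1 : a / K * ‖x‖ ^ 4 ≤ ∑ j, a * x j ^ 4 := by
    have h := sq_sum_le_card_mul_sum_sq (s := univ) (f := fun j : ZMod K => x j ^ 2)
    rw [← norm_sq_eq_sum, card_univ, ZMod.card] at h
    rw [← mul_sum, div_mul_eq_mul_div, div_le_iff₀ hK0]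
    have e : ∑ j, (x j ^ 2) ^ 2 = ∑ j, x j ^ 4 := sum_congr rfl fun j _ => by ring
    rw [e] at h
    calc a * ‖x‖ ^ 4 = a * (‖x‖ ^ 2) ^ 2 := by ring
      _ ≤ a * (K * ∑ j, x j ^ 4) := by gcongr
      _ = _ := by ring
  have h2 : ∑ j, a * x j ^ 4 ≤
      ∑ j, (x j * S (x j) - ∫ s in (0 : ℝ)..x j, S s) - ‖activation S x‖ ^ 2 / 2 := by
    rw [norm_sq_eq_sum, sum_div, ← sum_sub_distrib]
    exact sum_le_sum fun j _ => hq (x j) ((abs_apply_le_norm x j).trans_lt hx.1)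
  have hA := hact x hx.2
  have h3 := mul_le_mul_of_nonneg_left (inner_coupling_le hc hdom (activation S x))
    (by positivity : 0 ≤ α / (2 * d))
  have h4 := real_inner_le_norm b (activation S x)
  have h5 := mul_le_mul_of_nonneg_left hA (norm_nonneg b)
  have h6 : ‖activation S x‖ ^ 2 ≤ 4 * ‖x‖ ^ 2 := by
    have := pow_le_pow_left₀ (norm_nonneg _) hA 2
    linarith
  -- Since αλ_k = d + μ, the coupling costs half the squared activation, already included in the
  -- quartic bound, plus a multiple of μ.
  have h7 : α / (2 * d) * (eigenvalue c k * ‖activation S x‖ ^ 2) =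
      ‖activation S x‖ ^ 2 / 2 + onset d c k α / (2 * d) * ‖activation S x‖ ^ 2 := by
    rw [onset]; field_simp; ring
  have h8 : onset d c k α / (2 * d) * ‖activation S x‖ ^ 2 ≤
      2 * |onset d c k α| / d * ‖x‖ ^ 2 := by
    calc _ ≤ |onset d c k α| / (2 * d) * (4 * ‖x‖ ^ 2) := by
          gcongr; exact le_abs_self _
      _ = _ := by field_simp; ring
  rw [energy]
  linarith

/-- Existence of an equilibrium near onset at which the stability form is nonnegative. -/
lemma exists_equilibrium (hpos : 0 < eigenvalue c k) {R : ℝ} (hR : 0 < R) :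
    ∃ ρ > 0, ∀ (α : ℝ) (b : State K), |α - criticalGain d c k| < ρ → ‖b‖ < ρ →
      ∃ z : State K, ‖z‖ < R ∧ vectorField S d c α b z = 0 ∧
        (∀ j, 0 < deriv S (netInput c α b z j)) ∧
        ∀ u, 0 ≤ stabilityForm S d c α (netInput c α b z) u := by
  obtain ⟨a, ha, ρ₁, hρ₁, hlow⟩ := exists_energy_lower_bound hd hSodd hS hS1 hneg hc hdom
  obtain ⟨ρ₂, hρ₂, hsl⟩ := exists_slope_bounds hS hS1
  obtain ⟨ρ₃, hρ₃, hact⟩ := exists_norm_activation_le (K := K) hSodd hS hS1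
  obtain ⟨γ, -, ρ₄, hρ₄, hcoer⟩ := exists_coercive hd hc hpos hdom
  obtain ⟨r, hr, hr1, hr2, hr3, hrR⟩ : ∃ r > 0, r < ρ₁ ∧ r < ρ₂ ∧ r < ρ₃ ∧ r < R * d / 2 := by
    obtain ⟨r, hr0, hr⟩ := exists_between
      (by positivity : 0 < min (min ρ₁ ρ₂) (min ρ₃ (R * d / 2)))
    simp only [lt_min_iff] at hr
    exact ⟨r, hr0, hr.1.1, hr.1.2, hr.2.1, hr.2.2⟩
  set q := 2 * eigenvalue c k / d * r ^ 2 + 2 * r with hq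
  have hq0 : 0 < q := by positivity
  -- With this radius the energy is positive on the sphere of radius r but zero at the origin, so
  -- the minimizer over the ball is interior.
  refine ⟨min ρ₄ (a * r ^ 4 / q), by positivity, fun α b hα hb => ?_⟩
  rw [lt_min_iff] at hα hb
  have hα0 := (hcoer α hα.1).1
  obtain ⟨x, hx, hmin⟩ := (isCompact_closedBall (0 : State K) r).exists_isMinOn
    ⟨0, Metric.mem_closedBall_self hr.le⟩ (continuous_energy (d := d) (c := c) (α := α) (b := b)
      hS).continuousOn
  rw [mem_closedBall_zero_iff] at hx
  have hE0 : energy S d c α b 0 = 0 := by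
    have : activation S (0 : State K) = 0 := by
      ext j
      exact odd_zero hSodd
    simp [energy, this]
  have hxr : ‖x‖ < r := by
    refine hx.lt_of_ne fun hxr => ?_
    have h1 : energy S d c α b x ≤ 0 := by
      rw [← hE0]; exact hmin (Metric.mem_closedBall_self hr.le)
    have h2 := hlow α b x hα0 (hx.trans_lt hr1)
    have h3 : |onset d c k α| ≤ a * r ^ 4 / q * eigenvalue c k := by
      rw [onset_eq hpos, abs_mul, abs_of_pos hpos]
      exact mul_le_mul_of_nonneg_right hα.2.le hpos.le
    rw [hxr] at h2
    have h4 : 2 * |onset d c k α| / d * r ^ 2 + 2 * ‖b‖ * r < a * r ^ 4 / q * q := by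
      calc 2 * |onset d c k α| / d * r ^ 2 + 2 * ‖b‖ * r
          < 2 * (a * r ^ 4 / q * eigenvalue c k) / d * r ^ 2 + 2 * (a * r ^ 4 / q) * r := by
            refine add_lt_add_of_le_of_lt ?_ ?_
            · gcongr
            · have := hb.2
              gcongr
        _ = a * r ^ 4 / q * q := by rw [hq]; ring
    rw [div_mul_cancel₀ _ hq0.ne'] at h4
    linarith
  have hloc : IsLocalMin (energy S d c α b) x :=
    hmin.isLocalMin (Metric.closedBall_mem_nhds_of_mem (mem_ball_zero_iff.2 hxr))
  have hD : ∀ j, 0 < deriv S (x j) := fun j => by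
    linarith [(hsl (x j) ((abs_apply_le_norm x j).trans_lt (hxr.trans hr2))).1]
  obtain ⟨hdef, hform⟩ := equilibrium_of_isLocalMin hS hc hd hloc hD
  -- The vanishing defect says that the state S(x)/d reproduces x as its net input.
  have hnet : netInput c α b (d⁻¹ • activation S x) = x := by
    rw [inputDefect, sub_sub, sub_eq_zero] at hdef
    rw [netInput, map_smul, smul_smul, ← div_eq_mul_inv]
    exact hdef.symm
  refine ⟨d⁻¹ • activation S x, ?_, ?_, ?_, ?_⟩
  · rw [norm_smul, norm_inv, norm_eq_abs, abs_of_pos hd, inv_mul_lt_iff₀ hd]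
    have := hact x (hxr.trans hr3)
    linarith
  · ext j
    rw [vectorField_apply, hnet]
    have : (d⁻¹ • activation S x) j = d⁻¹ * S (x j) := rfl
    rw [this]
    change -d * (d⁻¹ * S (x j)) + S (x j) = 0
    field_simp
    ring
  · rwa [hnet]
  · rwa [hnet]

end existence

/-! ### Decision dynamics near onset -/

lemma amplitude_le_two_mul_norm_proj {k : ℕ} (h2 : ¬ K ∣ 2 * k) (b : State K) :
    amplitude b k ^ 2 ≤ 2 * ‖proj k b‖ ^ 2 ∧ amplitude b k ≤ 2 * ‖proj k b‖ := by
  have hK : (1 : ℝ) ≤ K := Nat.one_le_cast.2 (NeZero.pos K)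
  have h := norm_proj_sq h2 b
  have h1 : amplitude b k ^ 2 ≤ 2 * ‖proj k b‖ ^ 2 := by
    have := mul_le_mul_of_nonneg_right hK (sq_nonneg (amplitude b k))
    rw [h]; linarith
  refine ⟨h1, (abs_le_of_sq_le_sq' ?_ (by positivity)).2⟩
  have := sq_nonneg ‖proj k b‖
  linarith

section dynamics

variable {S : ℝ → ℝ} {d τ : ℝ} {c : ZMod K → ℝ} {k : ℕ}

/-- The slope of the nonlinearity is positive at the net input of small states near onset. -/
lemma exists_deriv_netInput_pos (hS : ContDiff ℝ 3 S) (hS1 : deriv S 0 = 1) :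
    ∃ ρ > 0, ∀ (α : ℝ) (b z : State K), ‖z‖ < ρ → |α - criticalGain d c k| < ρ → ‖b‖ < ρ →
      ∀ j, 0 < deriv S (netInput c α b z j) := by
  obtain ⟨ρ₀, hρ₀, hsl⟩ := exists_slope_bounds hS hS1
  set L := (|criticalGain d c k| + 1) * ‖coupling c‖ + 1 with hL
  have hL0 : 0 < L := by positivity
  refine ⟨min 1 (ρ₀ / L), by positivity, fun α b z hz hα hb j => ?_⟩
  rw [lt_min_iff] at hz hα hb
  have h1 : |α| ≤ |criticalGain d c k| + 1 := by
    have := abs_add_le (α - criticalGain d c k) (criticalGain d c k)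
    rw [sub_add_cancel] at this
    linarith [hα.1]
  have h2 : ‖netInput c α b z‖ < ρ₀ := by
    calc ‖netInput c α b z‖ ≤ |α| * (‖coupling c‖ * ‖z‖) + ‖b‖ := by
          refine (norm_add_le _ _).trans ?_
          rw [norm_smul, norm_eq_abs]
          gcongr
          exact (coupling c).le_opNorm z
      _ < (|criticalGain d c k| + 1) * (‖coupling c‖ * (ρ₀ / L)) + ρ₀ / L := by
          refine add_lt_add_of_le_of_lt ?_ hb.2
          have := hz.2.le
          gcongr
      _ = L * (ρ₀ / L) := by rw [hL]; ring
      _ = ρ₀ := mul_div_cancel₀ _ hL0.ne'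
  linarith [(hsl _ ((abs_apply_le_norm _ j).trans_lt h2)).1]

variable (hd : 0 < d) (hτ : 0 < τ) (hSodd : ∀ x, S (-x) = -S x) (hS : ContDiff ℝ 3 S)
    (hS1 : deriv S 0 = 1) (hS3 : iteratedDeriv 3 S 0 ≠ 0)
    (hc : ∀ j, c (-j) = c j) (hpos : 0 < eigenvalue c k)
    (hdom : ∀ m ≤ K / 2, m ≠ k → eigenvalue c m < eigenvalue c k)
include hd hτ hSodd hS hS1 hS3 hc hpos hdom

/-- Near onset, every stable equilibrium selects best responses to decisive evidence, and for a
saturating nonlinearity there is a stable equilibrium. -/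
lemma exists_dynamics_selection (h2 : ¬ K ∣ 2 * k) (h4 : ¬ K ∣ 4 * k) {κ M δ : ℝ} (hκ : 0 < κ)
    (hM : 0 < M) (hδ : 0 < δ) :
    ∃ R > 0, ∃ ρ > 0, ∀ (α : ℝ) (b : State K),
      |α - criticalGain d c k| < ρ → ‖b‖ < ρ →
      amplitude b (3 * k) < 3 * amplitude b k → Suppressed d c k κ b →
      onset d c k α ^ 3 ≤ M * amplitude b k ^ 2 →
      (iteratedDeriv 3 S 0 < 0 → ∃ z : State K, ‖z‖ < R ∧
        IsStableEquilibrium (fun y => τ⁻¹ • vectorField S d c α b y) z) ∧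
      (Decisive k δ b → ∀ z : State K, ‖z‖ < R →
        IsStableEquilibrium (fun y => τ⁻¹ • vectorField S d c α b y) z →
        ∀ a, Selects z a → a ∈ bestResponse k b) := by
  obtain ⟨C, hC, hnorm⟩ := exists_norm_le_amplitude (K := K) (d := d) (c := c) (k := k) hκ.le
  have hB : 0 < C * 2 := by positivity
  -- The hypotheses are restated in terms of Ψ_A b; the strict inequality A₃ < 3A is what excludes
  -- Ψ_A b = 0.
  have hev : ∀ (α : ℝ) (b : State K), amplitude b (3 * k) < 3 * amplitude b k →
      Suppressed d c k κ b → onset d c k α ^ 3 ≤ M * amplitude b k ^ 2 →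
      ‖b‖ ≤ C * 2 * ‖proj k b‖ ∧ proj k b ≠ 0 ∧
        onset d c k α ^ 3 ≤ M * 2 * ‖proj k b‖ ^ 2 := by
    intro α b h3 hsup hμ
    obtain ⟨hsq, hle⟩ := amplitude_le_two_mul_norm_proj h2 b
    refine ⟨?_, ?_, ?_⟩
    · rw [mul_assoc]
      exact (hnorm b hsup).trans (mul_le_mul_of_nonneg_left hle hC.le)
    · rintro h0
      rw [h0, norm_zero] at hle
      linarith [amplitude_nonneg b (3 * k)]
    · rw [mul_assoc]
      exact hμ.trans (mul_le_mul_of_nonneg_left hsq hM.le)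
  obtain ⟨R₁, hR₁, hsel⟩ := exists_selection hd hSodd hS hS1 hS3 hc hpos hdom h2 h4 hB (M * 2) hδ
  obtain ⟨R₂, hR₂, hder⟩ := exists_deriv_netInput_pos (d := d) (c := c) (k := k) hS hS1
  have hselect : ∀ (α : ℝ) (b z : State K), ‖z‖ < min R₁ R₂ →
      |α - criticalGain d c k| < min R₁ R₂ → ‖b‖ < min R₁ R₂ →
      amplitude b (3 * k) < 3 * amplitude b k → Suppressed d c k κ b →
      onset d c k α ^ 3 ≤ M * amplitude b k ^ 2 → Decisive k δ b →
      IsStableEquilibrium (fun y => τ⁻¹ • vectorField S d c α b y) z →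
      ∀ a, Selects z a → a ∈ bestResponse k b := by
    intro α b z hz hα hb h3 hsup hμ hdec hst
    rw [lt_min_iff] at hz hα hb
    obtain ⟨hB1, hne, hμ'⟩ := hev α b h3 hsup hμ
    obtain ⟨hF, hspec⟩ := (isStableEquilibrium_iff hS hτ c α b z).1 hst
    exact hsel α b z hz.1 hα.1 hb.1 hF hB1 hne hμ'
      (stabilityForm_nonneg_of_re_neg hτ hc (hder α b z hz.2 hα.2 hb.2) hspec) hdec
  have hexist : ∃ ρ > 0, ∀ (α : ℝ) (b : State K), |α - criticalGain d c k| < ρ → ‖b‖ < ρ →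
      amplitude b (3 * k) < 3 * amplitude b k → Suppressed d c k κ b →
      onset d c k α ^ 3 ≤ M * amplitude b k ^ 2 → iteratedDeriv 3 S 0 < 0 →
      ∃ z : State K, ‖z‖ < min R₁ R₂ ∧
        IsStableEquilibrium (fun y => τ⁻¹ • vectorField S d c α b y) z := by
    by_cases hneg : iteratedDeriv 3 S 0 < 0
    · obtain ⟨ρ₁, hρ₁, hform⟩ :=
        exists_stabilityForm_pos hd hSodd hS hS1 hS3 hc hpos hdom h2 h4 hneg hB (M * 2)
      -- The equilibrium is sought in a ball small enough for the positivity argument and for the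
      -- common radius min R₁ R₂ of the selection claim.
      obtain ⟨ρ₂, hρ₂, heq⟩ := exists_equilibrium hd hSodd hS hS1 hneg hc hdom hpos
        (R := min ρ₁ (min R₁ R₂)) (by positivity)
      refine ⟨min ρ₁ ρ₂, by positivity, fun α b hα hb h3 hsup hμ _ => ?_⟩
      rw [lt_min_iff] at hα hb
      obtain ⟨hB1, hne, hμ'⟩ := hev α b h3 hsup hμ
      obtain ⟨z, hz, hF, hD, hnn⟩ := heq α b hα.2 hb.2
      rw [lt_min_iff] at hz
      exact ⟨z, hz.2, (isStableEquilibrium_iff hS hτ c α b z).2 ⟨hF,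
        re_neg_of_stabilityForm_pos hτ hD
          (hform α b z hz.1 hα.1 hb.1 hF hB1 hne hμ' hnn)⟩⟩
    · exact ⟨1, one_pos, fun _ _ _ _ _ _ _ h => absurd h hneg⟩
  obtain ⟨ρ, hρ, hexist⟩ := hexist
  refine ⟨min R₁ R₂, by positivity, min ρ (min R₁ R₂), by positivity,
    fun α b hα hb h3 hsup hμ => ?_⟩
  obtain ⟨hα1, hα2⟩ := lt_min_iff.1 hα
  obtain ⟨hb1, hb2⟩ := lt_min_iff.1 hb
  exact ⟨hexist α b hα1 hb1 h3 hsup hμ, fun hdec z hz hst =>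
    hselect α b z hz hα2 hb2 h3 hsup hμ hdec hst⟩

end dynamics

end NOD

theorem mainTheorem7 {K : ℕ} [NeZero K] (S : ℝ → ℝ) (d τ : ℝ) (c : ZMod K → ℝ) (k : ℕ)
    (hd : 0 < d) (hτ : 0 < τ)
    -- the nonlinearity
    (hSodd : ∀ x, S (-x) = -S x) (hS : ContDiff ℝ 3 S) (hS1 : deriv S 0 = 1)
    (hS3 : iteratedDeriv 3 S 0 ≠ 0)
    -- symmetric circulant coupling with a unique dominant mode; two-dimensional critical space
    (hc : ∀ j, c (-j) = c j) (hk : 0 < k) (hkK : 2 * k < K) (hres : 4 * k ≠ K)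
    (hpos : 0 < NOD.eigenvalue c k)
    (hdom : ∀ m ≤ K / 2, m ≠ k → NOD.eigenvalue c m < NOD.eigenvalue c k) :
    -- only the projected evidence enters the reduced equations at leading order
    (∃ (W : NOD.State K → ℝ → NOD.State K → NOD.State K) (ρ ρ' C : ℝ), 0 < ρ ∧ 0 < ρ' ∧
      NOD.IsReductionMap S d c k W ρ ρ' ∧
      ∀ ε > 0, ∃ ρ₁ > 0, ∀ (r θ α : ℝ) (b : NOD.State K),
        0 ≤ r → r < ρ₁ → |α - NOD.criticalGain d c k| < ρ₁ → ‖b‖ < ρ₁ →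
        (‖NOD.reducedMap S d c k W (r • NOD.direction k θ) α b
            - ((NOD.onset d c k α * r + NOD.cubicCoeff S d c k * r ^ 3) • NOD.direction k θ
                + NOD.proj k b)‖
          ≤ ε * r ^ 3 + C * (‖b‖ * r ^ 2 + ‖b‖ ^ 2 * r + ‖b‖ ^ 3)) ∧
        |NOD.pairing (NOD.reducedMap S d c k W (r • NOD.direction k θ) α b) (NOD.direction k θ)
            - NOD.polarRadial S d c k α b r θ|
          ≤ ε * r ^ 3 + C * (‖b‖ * r ^ 2 + ‖b‖ ^ 2 * r + ‖b‖ ^ 3) ∧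
        |NOD.pairing (NOD.reducedMap S d c k W (r • NOD.direction k θ) α b)
              (NOD.direction k (θ + Real.pi / 2))
            - NOD.polarAngular S d c k b r θ|
          ≤ ε * r ^ 3 + C * (‖b‖ * r ^ 2 + ‖b‖ ^ 2 * r + ‖b‖ ^ 3)) ∧
    -- the stable phase of the polar angular equation selects the best response
    (∀ δ > 0, ∃ ρ > 0, ∀ (r : ℝ) (b : NOD.State K), 0 < r → r < ρ →
      NOD.amplitude b (3 * k) < 3 * NOD.amplitude b k →
      (∃ θ, NOD.IsStablePhase S d c k b r θ ∧
        ∀ θ', NOD.IsStablePhase S d c k b r θ' → (θ' : Real.Angle) = (θ : Real.Angle)) ∧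
      (NOD.Decisive k δ b → ∀ θ, NOD.IsStablePhase S d c k b r θ →
        ∀ a, NOD.Selects (r • NOD.direction k θ) a → a ∈ NOD.bestResponse k b)) ∧
    -- the stable equilibria of the full decision dynamics near onset select the best response
    (∀ κ > 0, ∀ M > 0, ∀ δ > 0, ∃ R > 0, ∃ ρ > 0, ∀ (α : ℝ) (b : NOD.State K),
      |α - NOD.criticalGain d c k| < ρ → ‖b‖ < ρ →
      NOD.amplitude b (3 * k) < 3 * NOD.amplitude b k → NOD.Suppressed d c k κ b →
      NOD.onset d c k α ^ 3 ≤ M * NOD.amplitude b k ^ 2 →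
      (iteratedDeriv 3 S 0 < 0 → ∃ z : NOD.State K, ‖z‖ < R ∧
        NOD.IsStableEquilibrium (fun y => τ⁻¹ • NOD.vectorField S d c α b y) z) ∧
      (NOD.Decisive k δ b → ∀ z : NOD.State K, ‖z‖ < R →
        NOD.IsStableEquilibrium (fun y => τ⁻¹ • NOD.vectorField S d c α b y) z →
        ∀ a, NOD.Selects z a → a ∈ NOD.bestResponse k b)) := by
  have h2 := NOD.not_dvd_two_mul hk hkK
  have h4 := NOD.not_dvd_four_mul hk hkK hres
  exact ⟨NOD.exists_reduced_expansion hd hSodd hS hS1 hc hpos hdom h2 h4,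
    fun δ hδ => NOD.exists_stablePhase_selection S d c h2 hδ,
    fun κ hκ M hM δ hδ => NOD.exists_dynamics_selection hd hτ hSodd hS hS1 hS3 hc hpos hdom h2 h4
      hκ hM hδ⟩
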